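/- **Theorem (MSVR-v2, non-convex).** Let $1\le B_1\le m$ and $1\le B_2\le m$ be integers, and consider $F(\mathbf w)=\frac1m\sum_{i=1}^m f_i(g_i(\mathbf w))$ with $f_i:\mathbb R^p\to\mathbb R$, $g_i:\mathbb R^d\to\mathbb R^p$. Assume: * each $f_i$ is differentiable, $C_f$-Lipschitz, with $L_f$-Lipschitz gradient; each $g_i$ is differentiable, $C_g$-Lipschitz, with $L_g$-Lipschitz Jacobian (the transposed Jacobian is written $\nabla g_i$ below); * for a batch $\xi^i$ of $B_2$ samples, the oracles $g_i(\mathbf x;\xi^i)$ and $\nabla g_i(\mathbf x;\xi^i)$ are square integrable and unbiased for $g_i(\mathbf x)$ and $\nabla g_i(\mathbf x)$, with variances at most $\sigma^2/B_2$, and $\mathbb E\|g_i(\mathbf x;\xi^i)-g_i(\mathbf y;\xi^i)\|^2\le C_g^2\|\mathbf x-\mathbf y\|^2$, $\mathbb E\|\nabla g_i(\mathbf x;\xi^i)-\nabla g_i(\mathbf y;\xi^i)\|^2\le L_g^2\|\mathbf x-\mathbf y\|^2$ for all $\mathbf x,\mathbf y$. The method MSVR-v2 starts from $(\mathbf w_1,\mathbf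 u_1,\mathbf z_1)$, with $\mathbf u_0=\mathbf u_1$, where $\mathbf w_1$ is deterministic, $F$ is bounded below, $F(\mathbf w_1)-\inf F\le\Delta_F$, $\frac1m\sum_i\mathbb E\|\mathbf u_1^i-g_i(\mathbf w_1)\|^2\le D$ and $\|\mathbf z_1\|\le C_F:=C_fC_g$. For $t\ge1$ it sets $\mathbf w_{t+1}=\mathbf w_t-\eta_t\mathbf z_t$. For $t\ge2$ it draws, independently of each other and of the past, a uniformly random set $\mathcal B_1^t\subseteq\{1,\dots,m\}$ of size $B_1$ and batches $(\xi_t^i)_i$ of size $B_2$, and updates $$\mathbf u_t^i=(1-\beta_t)\mathbf u_{t-1}^i+\beta_t g_i(\mathbf w_t;\xi_t^i)+\gamma_t\,\delta_t^i\ \ (i\in\mathcal B_1^t),\qquad \mathbf u_t^i=\mathbf u_{t-1}^i\ \ (i\notin\mathcal B_1^t),$$ with $\gamma_t=\frac{m-B_1}{B_1(1-\beta_t)}+(1-\beta_t)$ and $\delta_t^i=g_i(\mathbf w_t;\xi_t^i)-g_i(\mathbf w_{t-1};\xi_t^i)$ (MSVR) or $\delta_t^i=\nabla g_i(\mathbf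 w_t;\xi_t^i)^\top(\mathbf w_t-\mathbf w_{t-1})$ (MSVR-SP), and $$\mathbf z_t=\Pi_{C_F}\big[(1-\alpha_t)\mathbf z_{t-1}+\alpha_t\mathbf v_t+(1-\alpha_t)(\mathbf v_t-\mathbf v_t')\big],$$ $$\mathbf v_t=\tfrac1{B_1}\sum_{i\in\mathcal B_1^t}\nabla g_i(\mathbf w_t;\xi_t^i)\nabla f_i(\mathbf u_{t-1}^i),\qquad \mathbf v_t'=\tfrac1{B_1}\sum_{i\in\mathcal B_1^t}\nabla g_i(\mathbf w_{t-1};\xi_t^i)\nabla f_i(\mathbf u_{t-2}^i),$$ where $\Pi_{C_F}$ is the projection onto the ball of radius $C_F$ around $0$. After $T$ iterations it returns $\mathbf w_\tau$ with $\tau$ uniform on $\{1,\dots,T\}$ and independent of the iterates. There are positive constants $c_\eta,c_a,c_\alpha,c_\beta$ depending only on $L_f,C_f,L_g,C_g,\sigma$, and for all $\Delta_F,D,K$ a constant $C>0$ depending only on these and on $L_f,C_f,L_g,C_g,\sigma$, such that, with $a=c_a\frac{mB_2}{B_1}$, $\alpha_{t+1}=c_\alpha\frac{m\eta_t^2}{B_1}$,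 $\beta_{t+1}=c_\beta\frac{m^2\eta_t^2}{B_1^2}$ and $s_t=c_\eta\big(\frac{B_1\sqrt{B_2}}m\big)^{2/3}(a+t)^{-1/3}$, the following holds for both inner estimators. 1. For every $\varepsilon>0$ with $B_2\le K\varepsilon^{-2}$ there are a number of iterations $T\ge 1$ with $$T\le C\,\frac{m\,\varepsilon^{-3}}{B_1\sqrt{B_2}},\qquad\text{hence at most } B_1B_2T\le C\,m\sqrt{B_2}\,\varepsilon^{-3}\text{ samples},$$ and step sizes $0<\eta_t\le s_t$ (so $\eta_t=O\big((B_1\sqrt{B_2}/m)^{2/3}(a+t)^{-1/3}\big)$), which do not depend on the problem instance beyond the listed constants and $m,B_1,B_2,\varepsilon$, such that $\mathbb E\|\nabla F(\mathbf w_\tau)\|\le\varepsilon$. 2. With the step sizes $\eta_t=s_t$ exactly, for every $T\ge1$, $$\mathbb E\|\nabla F(\mathbf w_\tau)\|\le C\,\sqrt{1+\ln(1+T/a)}\;\Big(\frac m{B_1\sqrt{B_2}}\Big)^{1/3}\frac{(a+T)^{1/6}}{\sqrt T}.$$ -/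

import Mathlib

open MeasureTheory ProbabilityTheory

universe u v

noncomputable section

namespace FCCO

/-- The Euclidean space of dimension `d`. -/
abbrev Euc (d : ℕ) : Type := EuclideanSpace ℝ (Fin d)

/-- The data of a finite-sum coupled compositional problem with `m` blocks: outer functions `f i`,
inner maps `g i`, and for every block a stochastic oracle. One oracle call for block `i` uses a
batch of `B₂` samples from the sample space `S`; the batch has law `P i`, the oracle value at `x`
is `G i x b` and the oracle Jacobian is `J i x b`. -/
structure Problem (d p m B₂ : ℕ) (S : Type*) [MeasurableSpace S] where
  f : Fin m → Euc p → ℝ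
  g : Fin m → Euc d → Euc p
  P : Fin m → Measure (Fin B₂ → S)
  G : Fin m → Euc d → (Fin B₂ → S) → Euc p
  J : Fin m → Euc d → (Fin B₂ → S) → (Euc d →L[ℝ] Euc p)

/-- The objective `F(w) = (1/m) ∑ i, f i (g i w)`. -/
def Problem.F {d p m B₂ : ℕ} {S : Type*} [MeasurableSpace S] (Q : Problem d p m B₂ S)
    (w : Euc d) : ℝ :=
  (1 / (m : ℝ)) * ∑ i, Q.f i (Q.g i w)

/-- A real-valued function is differentiable, with `L`-Lipschitz gradient, and `C`-Lipschitz. -/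
structure SmoothLipschitzFun {p : ℕ} (f : Euc p → ℝ) (L C : ℝ) : Prop where
  differentiable : Differentiable ℝ f
  smooth : ∀ x y, ‖gradient f x - gradient f y‖ ≤ L * ‖x - y‖
  lipschitz : ∀ x y, |f x - f y| ≤ C * ‖x - y‖

/-- A vector-valued map is differentiable, with `L`-Lipschitz Jacobian, and `C`-Lipschitz. -/
structure SmoothLipschitzMap {d p : ℕ} (g : Euc d → Euc p) (L C : ℝ) : Prop where
  differentiable : Differentiable ℝ g
  smooth : ∀ x y, ‖fderiv ℝ g x - fderiv ℝ g y‖ ≤ L * ‖x - y‖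
  lipschitz : ∀ x y, ‖g x - g y‖ ≤ C * ‖x - y‖

/-- The oracle for one block: it is measurable and square integrable, unbiased for the value and
for the Jacobian, both variances are at most `σ ^ 2 / B₂`, and value and Jacobian are Lipschitz
in mean square with constants `Cg` and `Lg`. -/
structure OracleAssumptions {d p B₂ : ℕ} {S : Type*} [MeasurableSpace S]
    (g : Euc d → Euc p) (P : Measure (Fin B₂ → S)) (G : Euc d → (Fin B₂ → S) → Euc p)
    (J : Euc d → (Fin B₂ → S) → (Euc d →L[ℝ] Euc p)) (Lg Cg σ : ℝ) : Prop where
  prob : IsProbabilityMeasure P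
  measurable_value : Measurable fun q : Euc d × (Fin B₂ → S) => G q.1 q.2
  measurable_jacobian : Measurable fun q : Euc d × (Fin B₂ → S) => J q.1 q.2
  memLp_value : ∀ x, MemLp (G x) 2 P
  memLp_jacobian : ∀ x, MemLp (J x) 2 P
  unbiased_value : ∀ x, ∫ b, G x b ∂P = g x
  unbiased_jacobian : ∀ x, ∫ b, J x b ∂P = fderiv ℝ g x
  variance_value : ∀ x, ∫ b, ‖G x b - g x‖ ^ 2 ∂P ≤ σ ^ 2 / B₂
  variance_jacobian : ∀ x, ∫ b, ‖J x b - fderiv ℝ g x‖ ^ 2 ∂P ≤ σ ^ 2 / B₂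
  meanLipschitz_value : ∀ x y, ∫ b, ‖G x b - G y b‖ ^ 2 ∂P ≤ Cg ^ 2 * ‖x - y‖ ^ 2
  meanLipschitz_jacobian : ∀ x y, ∫ b, ‖J x b - J y b‖ ^ 2 ∂P ≤ Lg ^ 2 * ‖x - y‖ ^ 2

/-- The standing assumptions on the problem (except those on the initial point). -/
structure Problem.Assumptions {d p m B₂ : ℕ} {S : Type*} [MeasurableSpace S]
    (Q : Problem d p m B₂ S) (Lf Cf Lg Cg σ : ℝ) : Prop where
  outer : ∀ i, SmoothLipschitzFun (Q.f i) Lf Cf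
  inner : ∀ i, SmoothLipschitzMap (Q.g i) Lg Cg
  oracle : ∀ i, OracleAssumptions (Q.g i) (Q.P i) (Q.G i) (Q.J i) Lg Cg σ

/-- The two inner estimators: the two-point one and the single-point one. -/
inductive InnerEstimator
  | msvr
  | msvrSP

/-- The Euclidean projection onto the closed ball of radius `r` around the origin. -/
def projBall {d : ℕ} (r : ℝ) (z : Euc d) : Euc d :=
  if ‖z‖ ≤ r then z else (r / ‖z‖) • z

/-- The weight `γ = (m - B₁) / (B₁ (1 - β)) + (1 - β)` of the error correction term. -/
def gammaWeight (m B₁ : ℕ) (β : ℝ) : ℝ :=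
  ((m : ℝ) - B₁) / (B₁ * (1 - β)) + (1 - β)

/-- The variables at time `t`: `w = w_t`, `u = u_t`, `uPrev = u_{t-1}`, `z = z_t`. -/
structure State (d p m : ℕ) where
  w : Euc d
  u : Fin m → Euc p
  uPrev : Fin m → Euc p
  z : Euc d

section Algorithm

variable {d p m B₂ : ℕ} {S : Type*} [MeasurableSpace S]

/-- The error correction direction for block `i` when moving from `w` to `w'`. -/
def correction (Q : Problem d p m B₂ S) (e : InnerEstimator) (i : Fin m) (w w' : Euc d)
    (b : Fin B₂ → S) : Euc p :=
  match e with
  | .msvr => Q.G i w' b - Q.G i w b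
  | .msvrSP => Q.J i w' b (w' - w)

/-- The update of the inner estimators: only the sampled blocks `i ∈ B` change. -/
def updateU (Q : Problem d p m B₂ S) (e : InnerEstimator) (B₁ : ℕ) (β : ℝ)
    (B : Finset (Fin m)) (ξ : Fin m → Fin B₂ → S) (w w' : Euc d) (u : Fin m → Euc p) :
    Fin m → Euc p := fun i =>
  if i ∈ B then
    (1 - β) • u i + β • Q.G i w' (ξ i) + gammaWeight m B₁ β • correction Q e i w w' (ξ i)
  else u i

/-- The minibatch gradient `(1 / B₁) ∑ i ∈ B, ∇g_i(w; ξ_i)ᵀ ∇f_i(u_i)`. -/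
def batchGrad (Q : Problem d p m B₂ S) (B₁ : ℕ) (B : Finset (Fin m))
    (ξ : Fin m → Fin B₂ → S) (w : Euc d) (u : Fin m → Euc p) : Euc d :=
  (1 / (B₁ : ℝ)) • ∑ i ∈ B, ContinuousLinearMap.adjoint (Q.J i w (ξ i)) (gradient (Q.f i) (u i))

/-- The projected STORM-type update of the gradient estimator; `r` is the radius of the ball,
`u = u_t` and `uPrev = u_{t-1}` when `z_{t+1}` is computed. -/
def updateZ (Q : Problem d p m B₂ S) (B₁ : ℕ) (r α : ℝ) (B : Finset (Fin m))
    (ξ : Fin m → Fin B₂ → S) (w w' : Euc d) (u uPrev : Fin m → Euc p) (z : Euc d) : Euc d :=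
  projBall r ((1 - α) • z + α • batchGrad Q B₁ B ξ w' u
    + (1 - α) • (batchGrad Q B₁ B ξ w' u - batchGrad Q B₁ B ξ w uPrev))

/-- One pass from time `t` to time `t + 1`, with `η = η_t`, `α = α_{t+1}`, `β = β_{t+1}`, and
blocks `B` and batches `ξ` drawn at time `t + 1`. -/
def step (Q : Problem d p m B₂ S) (e : InnerEstimator) (B₁ : ℕ) (r η α β : ℝ)
    (B : Finset (Fin m)) (ξ : Fin m → Fin B₂ → S) (s : State d p m) : State d p m where
  w := s.w - η • s.z
  u := updateU Q e B₁ β B ξ s.w (s.w - η • s.z) s.u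
  uPrev := s.u
  z := updateZ Q B₁ r α B ξ s.w (s.w - η • s.z) s.u s.uPrev s.z

/-- The state of the method at time `t ≥ 1`, started at time `1` from `(w₁, u₁, z₁)`, with the
convention `u₀ = u₁`. The value at `t = 0` is a dummy. -/
def run (Q : Problem d p m B₂ S) (e : InnerEstimator) (B₁ : ℕ) (r : ℝ) (η α β : ℕ → ℝ)
    (B : ℕ → Finset (Fin m)) (ξ : ℕ → Fin m → Fin B₂ → S)
    (w₁ : Euc d) (u₁ : Fin m → Euc p) (z₁ : Euc d) : ℕ → State d p m
  | 0 => ⟨w₁, u₁, u₁, z₁⟩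
  | 1 => ⟨w₁, u₁, u₁, z₁⟩
  | t + 2 => step Q e B₁ r (η (t + 1)) (α (t + 2)) (β (t + 2)) (B (t + 2)) (ξ (t + 2))
      (run Q e B₁ r η α β B ξ w₁ u₁ z₁ (t + 1))

/-- The randomness of the method. At every time `t ≥ 2` a set of `B₁` blocks is drawn uniformly
and for each block `i` a batch with law `P i` is drawn; the set of blocks, the family of batches
and the past are independent. No independence between batches of different blocks is required. -/
structure Sampling (Q : Problem d p m B₂ S) (B₁ : ℕ) {Ω : Type*} [mΩ : MeasurableSpace Ω]
    (μ : Measure Ω) (ℱ : Filtration ℕ mΩ) (B : ℕ → Ω → Finset (Fin m))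
    (ξ : ℕ → Ω → Fin m → Fin B₂ → S) : Prop where
  adapted : ∀ t, 2 ≤ t → Measurable[ℱ t] fun ω => (B t ω, ξ t ω)
  indep_past : ∀ t, 2 ≤ t →
    Indep (MeasurableSpace.comap (fun ω => (B t ω, ξ t ω)) inferInstance) (ℱ (t - 1)) μ
  indep_blocks : ∀ t, 2 ≤ t → IndepFun (B t) (ξ t) μ
  law_blocks : ∀ t, 2 ≤ t →
    Measure.map (B t) μ = uniformOn {s : Finset (Fin m) | s.card = B₁}
  law_batch : ∀ t, 2 ≤ t → ∀ i, Measure.map (fun ω => ξ t ω i) μ = Q.P i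

/-- The initial data: a deterministic `w₁` with `F w₁ - inf F ≤ Δ`, where `F` is bounded below,
and possibly random `u₁`, `z₁`, known at time `1`, where `u₁` has mean square error at most `D` per
block on average, and `z₁` lies in the ball of radius `r` onto which the method projects. -/
structure Initialization (Q : Problem d p m B₂ S) {Ω : Type*} [mΩ : MeasurableSpace Ω]
    (μ : Measure Ω) (ℱ : Filtration ℕ mΩ) (r Δ D : ℝ)
    (w₁ : Euc d) (u₁ : Ω → Fin m → Euc p) (z₁ : Ω → Euc d) : Prop where
  bddBelow : BddBelow (Set.range Q.F)
  gap : Q.F w₁ - (⨅ w, Q.F w) ≤ Δ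
  measurable_u : Measurable[ℱ 1] u₁
  measurable_z : Measurable[ℱ 1] z₁
  memLp_u : ∀ i, MemLp (fun ω => u₁ ω i) 2 μ
  error_u : (1 / (m : ℝ)) * ∑ i, ∫ ω, ‖u₁ ω i - Q.g i w₁‖ ^ 2 ∂μ ≤ D
  norm_z : ∀ ω, ‖z₁ ω‖ ≤ r

/-- The random iterates `w_t`. -/
def iterate (Q : Problem d p m B₂ S) (e : InnerEstimator) (B₁ : ℕ) (r : ℝ) (η α β : ℕ → ℝ)
    {Ω : Type*} (B : ℕ → Ω → Finset (Fin m)) (ξ : ℕ → Ω → Fin m → Fin B₂ → S)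
    (w₁ : Euc d) (u₁ : Ω → Fin m → Euc p) (z₁ : Ω → Euc d) (t : ℕ) (ω : Ω) : Euc d :=
  (run Q e B₁ r η α β (fun k => B k ω) (fun k => ξ k ω) w₁ (u₁ ω) (z₁ ω) t).w

end Algorithm

/-- The expected gradient norm `E ‖∇F(w_τ)‖` at the returned point, where `τ` is uniform on
`{1, …, T}` and independent of the iterates. -/
def outputGradNorm {d : ℕ} {Ω : Type*} [MeasurableSpace Ω] (μ : Measure Ω) (F : Euc d → ℝ)
    (w : ℕ → Ω → Euc d) (T : ℕ) : ℝ :=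
  ∫ q : Ω × ℕ, ‖gradient F (w q.2 q.1)‖ ∂(μ.prod (uniformOn (Set.Icc 1 T)))

/-- With the given parameters the method, with either inner estimator, returns after `T` iterations
a point with expected gradient norm at most `δ`, for every problem satisfying the assumptions, in
any dimensions `d` and `p`, every admissible source of randomness and every admissible start. -/
def Guarantee (Lf Cf Lg Cg σ Δ D : ℝ) (m B₁ B₂ : ℕ) (η α β : ℕ → ℝ) (T : ℕ) (δ : ℝ) : Prop :=
  ∀ (d p : ℕ) (S : Type u) [MeasurableSpace S] (Q : Problem d p m B₂ S),
    Q.Assumptions Lf Cf Lg Cg σ →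
  ∀ (Ω : Type v) [mΩ : MeasurableSpace Ω] (μ : Measure Ω) [IsProbabilityMeasure μ]
    (ℱ : Filtration ℕ mΩ) (B : ℕ → Ω → Finset (Fin m)) (ξ : ℕ → Ω → Fin m → Fin B₂ → S),
    Sampling Q B₁ μ ℱ B ξ →
  ∀ (w₁ : Euc d) (u₁ : Ω → Fin m → Euc p) (z₁ : Ω → Euc d),
    Initialization Q μ ℱ (Cf * Cg) Δ D w₁ u₁ z₁ →
  ∀ e : InnerEstimator,
    outputGradNorm μ Q.F (iterate Q e B₁ (Cf * Cg) η α β B ξ w₁ u₁ z₁) T ≤ δ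

/-- The step size profile `c (B₁ √B₂ / m) ^ (2/3) (a + t) ^ (-1/3)`. -/
def stepProfile (c a : ℝ) (m B₁ B₂ t : ℕ) : ℝ :=
  c * ((B₁ : ℝ) * √(B₂ : ℝ) / m) ^ (2 / 3 : ℝ) * (a + t) ^ (-(1 / 3) : ℝ)

/-- The coupling of the momentum parameters to the step sizes:
`α_{t+1} = cα m η_t² / B₁` and `β_{t+1} = cβ m² η_t² / B₁²`. -/
def Coupled (cα cβ : ℝ) (m B₁ : ℕ) (η α β : ℕ → ℝ) : Prop :=
  ∀ t : ℕ, 1 ≤ t → α (t + 1) = cα * (m * η t ^ 2 / B₁) ∧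
    β (t + 1) = cβ * ((m : ℝ) ^ 2 * η t ^ 2 / (B₁ : ℝ) ^ 2)

end FCCO

end

namespace FCCO

/-! Write q = B₁/m. The method is followed through mean squares at time t: the inner error U of the
estimates u_t against g(w_t), the inner increment V of u_t − u_{t−1}, the outer error Z of z_t
against the gradient formula evaluated at (w_t, u_{t−1}), and N = E‖z_t‖². The target of Z is chosen
so that the fresh minibatch gradients are unbiased for it given the past, although the same batches
also update u.

One step gives three recursions. The weight γ is exactly the one that cancels, after averaging over
whether a block is sampled, the inner product of the old inner error with the change of g. Hence U
contracts by 1 − qβ, up to noise qβ²σ²/B₂ and drift η²N/q (`innerErr_succ_le`). The bias of the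
single-point correction is quadratic in the displacement; the projection bounds ‖z‖, and η² ≤ β then
lets this bias be absorbed in the contraction. V has a similar bound (`innerInc_succ_le`). The
recursive correction makes Z contract by 1 − α, with noise α²(1/B₁ + 1/B₂), drift η²N and a multiple
of V (`outerErr_succ_le`). Finally E‖z − ∇F(w)‖² is controlled by Z, U and V (`trackErr_le`).

These are combined in the potential A (q/η_t)(Z + U + (2K₃+1)V). With α of order η²/q and β of order
η²/q², the weight q/η turns both contractions into a gain of order η. This gain pays for the growth
of the weight (at most η per step) and for the tracking error in the descent inequality, while a
small A lets the drift be paid by the −η/4 ‖z‖² of that inequality (`PotentialConstants.step`).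
Summation bounds ∑ η_t E‖∇F(w_t)‖² by the initial gap, the initial potential and a multiple of ∑
η_t³/(q²B₂) (`sum_gradSq_le`).

The profile satisfies s_t³ = q²B₂/(a+t), so its accumulated noise is a harmonic sum, and this is the
logarithm in the second claim. For the first claim the logarithm is removed by fixing the horizon T:
the steps decay like (a+t)^(−1/2) until they reach s_T and then stay there up to T. The noise is
then at most 3, while the first step remains of order q, which keeps the initial potential bounded.
A constant step s_T would not do that. The choice of T works because B₂ ≤ K/ε² makes a at most of
the order of T. -/

theorem norm_sum_sq_le {ι E : Type*} [SeminormedAddCommGroup E] (s : Finset ι) (a : ι → E) :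
    ‖∑ i ∈ s, a i‖ ^ 2 ≤ s.card * ∑ i ∈ s, ‖a i‖ ^ 2 :=
  (pow_le_pow_left₀ (norm_nonneg _) (norm_sum_le _ _) 2).trans sq_sum_le_card_mul_sum_sq

theorem norm_average_sq_le {ι E : Type*} [SeminormedAddCommGroup E] [NormedSpace ℝ E]
    (s : Finset ι) (a : ι → E) {n : ℕ} (hn : s.card = n) :
    ‖(1 / (n : ℝ)) • ∑ i ∈ s, a i‖ ^ 2 ≤ (1 / (n : ℝ)) * ∑ i ∈ s, ‖a i‖ ^ 2 := by
  rcases Nat.eq_zero_or_pos n with h | h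
  · simp [h]
  have h' : (0 : ℝ) < n := by exact_mod_cast h
  rw [norm_smul, mul_pow, Real.norm_eq_abs, sq_abs]
  calc (1 / (n : ℝ)) ^ 2 * ‖∑ i ∈ s, a i‖ ^ 2
      ≤ (1 / (n : ℝ)) ^ 2 * (n * ∑ i ∈ s, ‖a i‖ ^ 2) := by
        gcongr
        simpa [hn] using norm_sum_sq_le s a
    _ = _ := by field_simp

theorem norm_add_sq_le {E : Type*} [SeminormedAddCommGroup E] (x y : E) :
    ‖x + y‖ ^ 2 ≤ 2 * ‖x‖ ^ 2 + 2 * ‖y‖ ^ 2 := by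
  have := norm_add_le x y
  nlinarith [sq_nonneg (‖x‖ - ‖y‖), norm_nonneg (x + y), norm_nonneg x, norm_nonneg y]

theorem norm_sub_sq_le {E : Type*} [SeminormedAddCommGroup E] (x y : E) :
    ‖x - y‖ ^ 2 ≤ 2 * ‖x‖ ^ 2 + 2 * ‖y‖ ^ 2 := by
  simpa [sub_eq_add_neg] using norm_add_sq_le x (-y)

theorem norm_add_add_sq_le {E : Type*} [SeminormedAddCommGroup E] (x y z : E) :
    ‖x + y + z‖ ^ 2 ≤ 3 * (‖x‖ ^ 2 + ‖y‖ ^ 2 + ‖z‖ ^ 2) := by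
  have := norm_sum_sq_le Finset.univ ![x, y, z]
  simpa [Fin.sum_univ_three] using this

theorem norm_add_add_add_sq_le {E : Type*} [SeminormedAddCommGroup E] (x y z w : E) :
    ‖x + y + z + w‖ ^ 2 ≤ 4 * (‖x‖ ^ 2 + ‖y‖ ^ 2 + ‖z‖ ^ 2 + ‖w‖ ^ 2) := by
  have := norm_sum_sq_le Finset.univ ![x, y, z, w]
  simpa [Fin.sum_univ_four] using this

/-! ### Projection onto a ball -/

section projection

variable {d : ℕ} {r : ℝ}

theorem norm_projBall_le (hr : 0 ≤ r) (z : Euc d) : ‖projBall r z‖ ≤ r := by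
  unfold projBall
  split_ifs with h
  · exact h
  · have hz : 0 < ‖z‖ := hr.trans_lt (not_le.1 h)
    rw [norm_smul, Real.norm_eq_abs, abs_of_nonneg (by positivity), div_mul_cancel₀ _ hz.ne']

/-- For ‖z‖ > r and c = r/‖z‖, Cauchy–Schwarz bounds the loss ‖z − y‖² − ‖cz − y‖² below by (‖z‖ −
r)². Only targets inside the ball matter here, since the gradient formulas approximated by z have
norm at most the radius. -/
theorem norm_projBall_sub_le (hr : 0 ≤ r) (z y : Euc d) (hy : ‖y‖ ≤ r) :
    ‖projBall r z - y‖ ≤ ‖z - y‖ := by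
  unfold projBall
  split_ifs with h
  · exact le_rfl
  · have h' := not_le.1 h
    have hz : 0 < ‖z‖ := hr.trans_lt h'
    refine le_of_sq_le_sq ?_ (norm_nonneg _)
    rw [norm_sub_sq_real, norm_sub_sq_real, norm_smul, Real.norm_eq_abs,
      abs_of_nonneg (by positivity : 0 ≤ r / ‖z‖), div_mul_cancel₀ _ hz.ne', real_inner_smul_left]
    set c := r / ‖z‖ with hc
    have hcz : c * ‖z‖ = r := div_mul_cancel₀ _ hz.ne'
    have hc1 : 0 ≤ 1 - c := by
      rw [hc, sub_nonneg, div_le_one hz]; exact h'.le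
    have hin : inner ℝ z y ≤ ‖z‖ * r :=
      (real_inner_le_norm z y).trans (by gcongr)
    nlinarith [mul_le_mul_of_nonneg_left hin hc1, sq_nonneg (‖z‖ - r)]

theorem measurable_projBall (r : ℝ) : Measurable (projBall r : Euc d → Euc d) := by
  unfold projBall
  refine Measurable.ite (measurableSet_le measurable_norm measurable_const) measurable_id ?_
  exact (measurable_const.div measurable_norm).smul measurable_id

end projection

/-! ### Lipschitz gradients and first-order expansion -/

section smooth

variable {d p : ℕ} {L C : ℝ}

theorem SmoothLipschitzFun.norm_gradient_le {f : Euc p → ℝ} (hf : SmoothLipschitzFun f L C)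
    (hC : 0 ≤ C) (x : Euc p) : ‖gradient f x‖ ≤ C := by
  rw [gradient, LinearIsometryEquiv.norm_map]
  exact norm_fderiv_le_of_lip' ℝ hC (Filter.Eventually.of_forall fun y => hf.lipschitz y x)

theorem SmoothLipschitzMap.norm_fderiv_le {g : Euc d → Euc p} (hg : SmoothLipschitzMap g L C)
    (hC : 0 ≤ C) (x : Euc d) : ‖fderiv ℝ g x‖ ≤ C :=
  norm_fderiv_le_of_lip' ℝ hC (Filter.Eventually.of_forall fun y => hg.lipschitz y x)

theorem SmoothLipschitzFun.continuous_gradient {f : Euc p → ℝ} (hf : SmoothLipschitzFun f L C)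
    (hL : 0 ≤ L) : Continuous (gradient f) :=
  (LipschitzWith.of_dist_le_mul (K := ⟨L, hL⟩) fun x y => by
    simp only [dist_eq_norm]; exact hf.smooth x y).continuous

theorem SmoothLipschitzMap.continuous_fderiv {g : Euc d → Euc p} (hg : SmoothLipschitzMap g L C)
    (hL : 0 ≤ L) : Continuous (fderiv ℝ g) :=
  (LipschitzWith.of_dist_le_mul (K := ⟨L, hL⟩) fun x y => by
    simp only [dist_eq_norm]; exact hg.smooth x y).continuous

/-- The mean value inequality for g minus its linearisation at z. The base point may be anywhere on
the segment: the descent inequality expands at the left end, the single-point correction at the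
right end. The sharp factor 1/2 is not needed. -/
theorem norm_taylor_le {E F : Type*} [NormedAddCommGroup E] [NormedSpace ℝ E]
    [NormedAddCommGroup F] [NormedSpace ℝ F] {g : E → F} (hd : Differentiable ℝ g) (hL : 0 ≤ L)
    (hs : ∀ x y, ‖fderiv ℝ g x - fderiv ℝ g y‖ ≤ L * ‖x - y‖) {z : E} (x y : E)
    (hz : z ∈ segment ℝ x y) :
    ‖g y - g x - fderiv ℝ g z (y - x)‖ ≤ L * ‖y - x‖ ^ 2 := by
  have key := (convex_segment (𝕜 := ℝ) x y).norm_image_sub_le_of_norm_fderiv_le' (𝕜 := ℝ) (f := g)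
    (φ := fderiv ℝ g z) (C := L * ‖y - x‖) (fun t _ => hd t) (fun t ht => ?_)
    (left_mem_segment ℝ x y) (right_mem_segment ℝ x y)
  · rw [pow_two, ← mul_assoc]; exact key
  · refine (hs t z).trans (mul_le_mul_of_nonneg_left ?_ hL)
    rw [segment_eq_image'] at ht hz
    obtain ⟨a, ha, rfl⟩ := ht
    obtain ⟨b, hb, rfl⟩ := hz
    rw [add_sub_add_left_eq_sub, ← sub_smul, norm_smul, Real.norm_eq_abs]
    have : |a - b| ≤ 1 := abs_le.2 ⟨by linarith [ha.1, hb.2], by linarith [ha.2, hb.1]⟩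
    nlinarith [norm_nonneg (y - x)]

end smooth

/-! ### The objective and its descent inequality -/

section objective

variable {d p m B₂ : ℕ} {S : Type*} [MeasurableSpace S] {Q : Problem d p m B₂ S}
  {Lf Cf Lg Cg σ : ℝ}

/-- The gradient of the objective with the inner values replaced by the estimates `u`. -/
noncomputable def fullGrad (Q : Problem d p m B₂ S) (w : Euc d) (u : Fin m → Euc p) : Euc d :=
  (1 / (m : ℝ)) • ∑ i, ContinuousLinearMap.adjoint (fderiv ℝ (Q.g i) w) (gradient (Q.f i) (u i))

theorem Problem.Assumptions.hasGradientAt (hQ : Q.Assumptions Lf Cf Lg Cg σ) (w : Euc d) :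
    HasGradientAt Q.F (fullGrad Q w fun i => Q.g i w) w := by
  rw [hasGradientAt_iff_hasFDerivAt]
  have h : ∀ i ∈ Finset.univ, HasFDerivAt (fun w => Q.f i (Q.g i w))
      ((fderiv ℝ (Q.f i) (Q.g i w)).comp (fderiv ℝ (Q.g i) w)) w := fun i _ =>
    ((hQ.outer i).differentiable _).hasFDerivAt.comp w ((hQ.inner i).differentiable w).hasFDerivAt
  have h2 := (HasFDerivAt.fun_sum h).const_mul (1 / (m : ℝ))
  refine h2.congr_fderiv ?_
  ext x
  simp only [fullGrad, smul_apply, sum_apply,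
    ContinuousLinearMap.comp_apply, InnerProductSpace.toDual_apply_apply, real_inner_smul_left,
    sum_inner, ContinuousLinearMap.adjoint_inner_left, smul_eq_mul]
  congr 1
  refine Finset.sum_congr rfl fun i _ => ?_
  rw [gradient, InnerProductSpace.toDual_symm_apply]

theorem Problem.Assumptions.gradient_eq (hQ : Q.Assumptions Lf Cf Lg Cg σ) (w : Euc d) :
    gradient Q.F w = fullGrad Q w fun i => Q.g i w :=
  (hQ.hasGradientAt w).gradient

/-- Uniformity in u is the point: whatever the inner estimates are, the target of z lies in the
ball, so projecting never increases the error. -/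
theorem Problem.Assumptions.norm_fullGrad_le (hQ : Q.Assumptions Lf Cf Lg Cg σ) (hm : 0 < m)
    (hCf : 0 ≤ Cf) (hCg : 0 ≤ Cg) (w : Euc d) (u : Fin m → Euc p) :
    ‖fullGrad Q w u‖ ≤ Cf * Cg := by
  have h' : (0 : ℝ) < m := by exact_mod_cast hm
  rw [fullGrad, norm_smul, Real.norm_eq_abs, abs_of_nonneg (by positivity)]
  have : ‖∑ i, ContinuousLinearMap.adjoint (fderiv ℝ (Q.g i) w) (gradient (Q.f i) (u i))‖
      ≤ ∑ _i : Fin m, Cf * Cg := by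
    refine norm_sum_le_of_le _ fun i _ => ?_
    refine (ContinuousLinearMap.le_opNorm _ _).trans ?_
    rw [LinearIsometryEquiv.norm_map, mul_comm]
    exact mul_le_mul ((hQ.outer i).norm_gradient_le hCf _) ((hQ.inner i).norm_fderiv_le hCg _)
      (norm_nonneg _) hCf
  calc _ ≤ 1 / (m : ℝ) * ∑ _i : Fin m, Cf * Cg := by gcongr
    _ = _ := by simp; field_simp

theorem norm_adjoint_sub_le {E F : Type*} [NormedAddCommGroup E] [InnerProductSpace ℝ E]
    [CompleteSpace E] [NormedAddCommGroup F] [InnerProductSpace ℝ F] [CompleteSpace F]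
    (A A' : E →L[ℝ] F) (h h' : F) :
    ‖ContinuousLinearMap.adjoint A h - ContinuousLinearMap.adjoint A' h'‖
      ≤ ‖A - A'‖ * ‖h‖ + ‖A'‖ * ‖h - h'‖ := by
  have e : ContinuousLinearMap.adjoint A h - ContinuousLinearMap.adjoint A' h'
      = ContinuousLinearMap.adjoint (A - A') h + ContinuousLinearMap.adjoint A' (h - h') := by
    simp
  rw [e]
  refine (norm_add_le _ _).trans (add_le_add ?_ ?_)
  · refine (ContinuousLinearMap.le_opNorm _ _).trans ?_
    rw [LinearIsometryEquiv.norm_map]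
  · refine (ContinuousLinearMap.le_opNorm _ _).trans ?_
    rw [LinearIsometryEquiv.norm_map]

theorem Problem.Assumptions.norm_fullGrad_sub_sq_le (hQ : Q.Assumptions Lf Cf Lg Cg σ)
    (hCg : 0 ≤ Cg) (w : Euc d) (u u' : Fin m → Euc p) :
    ‖fullGrad Q w u - fullGrad Q w u'‖ ^ 2
      ≤ Cg ^ 2 * Lf ^ 2 * (1 / (m : ℝ) * ∑ i, ‖u i - u' i‖ ^ 2) := by
  rw [fullGrad, fullGrad, ← smul_sub, ← Finset.sum_sub_distrib]
  refine (norm_average_sq_le (n := m) _ _ (by simp)).trans ?_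
  rw [mul_left_comm (Cg ^ 2 * Lf ^ 2), Finset.mul_sum _ _ (Cg ^ 2 * Lf ^ 2)]
  refine mul_le_mul_of_nonneg_left (Finset.sum_le_sum fun i _ => ?_) (by positivity)
  rw [← mul_pow, ← mul_pow]
  gcongr
  refine (norm_adjoint_sub_le _ _ _ _).trans ?_
  rw [sub_self, norm_zero, zero_mul, zero_add, mul_assoc]
  exact mul_le_mul ((hQ.inner i).norm_fderiv_le hCg _) ((hQ.outer i).smooth _ _)
    (norm_nonneg _) hCg

theorem Problem.Assumptions.norm_gradient_sub_le (hQ : Q.Assumptions Lf Cf Lg Cg σ) (hm : 0 < m)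
    (hLf : 0 ≤ Lf) (hCf : 0 ≤ Cf) (hLg : 0 ≤ Lg) (hCg : 0 ≤ Cg) (x y : Euc d) :
    ‖gradient Q.F x - gradient Q.F y‖ ≤ (Cf * Lg + Cg ^ 2 * Lf) * ‖x - y‖ := by
  have h' : (0 : ℝ) < m := by exact_mod_cast hm
  rw [hQ.gradient_eq, hQ.gradient_eq, fullGrad, fullGrad, ← smul_sub, ← Finset.sum_sub_distrib,
    norm_smul, Real.norm_eq_abs, abs_of_nonneg (by positivity)]
  have : ‖∑ i, (ContinuousLinearMap.adjoint (fderiv ℝ (Q.g i) x) (gradient (Q.f i) (Q.g i x))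
      - ContinuousLinearMap.adjoint (fderiv ℝ (Q.g i) y) (gradient (Q.f i) (Q.g i y)))‖
      ≤ ∑ _i : Fin m, (Cf * Lg + Cg ^ 2 * Lf) * ‖x - y‖ := by
    refine norm_sum_le_of_le _ fun i _ => ?_
    refine (norm_adjoint_sub_le _ _ _ _).trans ?_
    have h1 := mul_le_mul ((hQ.inner i).smooth x y) ((hQ.outer i).norm_gradient_le hCf (Q.g i x))
      (norm_nonneg _) (by positivity)
    have h2 := ((hQ.outer i).smooth (Q.g i x) (Q.g i y)).trans
      (mul_le_mul_of_nonneg_left ((hQ.inner i).lipschitz x y) hLf)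
    have h3 := mul_le_mul ((hQ.inner i).norm_fderiv_le hCg y) h2 (norm_nonneg _) hCg
    linarith
  calc _ ≤ 1 / (m : ℝ) * ∑ _i : Fin m, (Cf * Lg + Cg ^ 2 * Lf) * ‖x - y‖ := by gcongr
    _ = _ := by simp; field_simp

/-- Polarisation rewrites −η⟨∇F, z⟩ as half of η(‖z − ∇F‖² − ‖∇F‖² − ‖z‖²). The second-order
remainder uses half of the resulting −η/2 ‖z‖²; the remaining quarter later pays for the drift in
the error recursions. -/
theorem Problem.Assumptions.descent (hQ : Q.Assumptions Lf Cf Lg Cg σ) (hm : 0 < m)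
    (hLf : 0 ≤ Lf) (hCf : 0 ≤ Cf) (hLg : 0 ≤ Lg) (hCg : 0 ≤ Cg) (w z : Euc d) {η : ℝ}
    (hη : 0 < η) (hηL : η * (Cf * Lg + Cg ^ 2 * Lf) ≤ 1 / 4) :
    η / 2 * ‖gradient Q.F w‖ ^ 2 + η / 4 * ‖z‖ ^ 2
      ≤ Q.F w - Q.F (w - η • z) + η / 2 * ‖z - gradient Q.F w‖ ^ 2 := by
  have hd : Differentiable ℝ Q.F := fun x => (hQ.hasGradientAt x).differentiableAt
  have hfd : ∀ x, fderiv ℝ Q.F x = InnerProductSpace.toDual ℝ _ (gradient Q.F x) := fun x => by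
    simp [gradient]
  have key := norm_taylor_le (L := Cf * Lg + Cg ^ 2 * Lf) hd (by positivity) (fun x y => by
    rw [hfd, hfd, ← map_sub, LinearIsometryEquiv.norm_map]
    exact hQ.norm_gradient_sub_le hm hLf hCf hLg hCg x y) w (w - η • z) (left_mem_segment ℝ _ _)
  rw [hfd, InnerProductSpace.toDual_apply_apply, sub_sub_cancel_left, norm_neg, inner_neg_right,
    real_inner_smul_right, norm_smul, Real.norm_eq_abs, Real.norm_eq_abs, abs_of_pos hη] at key
  have h1 := (abs_le.1 key).2
  have h2 := norm_sub_sq_real z (gradient Q.F w)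
  rw [real_inner_comm] at h2
  rw [h2]
  have h3 : (Cf * Lg + Cg ^ 2 * Lf) * (η * ‖z‖) ^ 2 ≤ η / 4 * ‖z‖ ^ 2 := by
    have := mul_le_mul_of_nonneg_right hηL (by positivity : 0 ≤ η * ‖z‖ ^ 2)
    nlinarith
  nlinarith

end objective

/-! ### Uniformly random sets of blocks -/

section uniform

theorem integral_uniformOn_finset {α E : Type*} [MeasurableSpace α] [MeasurableSingletonClass α]
    [NormedAddCommGroup E] [NormedSpace ℝ E] [CompleteSpace E] (s : Finset α) (f : α → E) :
    ∫ x, f x ∂(uniformOn (s : Set α)) = (1 / (s.card : ℝ)) • ∑ x ∈ s, f x := by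
  have hint : IntegrableOn f (s : Set α) Measure.count := by
    have : IsFiniteMeasure (Measure.count.restrict (s : Set α)) :=
      ⟨by simp [Measure.count_apply_finset]⟩
    have h := IntegrableOn.finset (s := s) (f := f) (μ := Measure.count.restrict (s : Set α))
    rwa [IntegrableOn, Measure.restrict_restrict s.measurableSet, Set.inter_self] at h
  rw [uniformOn, ProbabilityTheory.cond, integral_smul_measure, setIntegral_finset s hint]
  simp [measureReal_def]

variable {m k : ℕ}

/-- The law of a uniformly random set of `k` among `m` blocks. -/
noncomputable abbrev blockLaw (m k : ℕ) : Measure (Finset (Fin m)) :=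
  uniformOn {s : Finset (Fin m) | s.card = k}

theorem setOf_card_eq (m k : ℕ) : {s : Finset (Fin m) | s.card = k}
    = (Finset.powersetCard k (Finset.univ : Finset (Fin m)) : Set (Finset (Fin m))) := by
  ext s; simp [Finset.mem_powersetCard]

theorem isProbabilityMeasure_blockLaw (hkm : k ≤ m) : IsProbabilityMeasure (blockLaw m k) := by
  refine isProbabilityMeasure_uniformOn (Set.toFinite _) ?_
  rw [setOf_card_eq, Finset.coe_nonempty]
  exact Finset.powersetCard_nonempty.2 (by simpa using hkm)

theorem integral_blockLaw {E : Type*} [NormedAddCommGroup E] [NormedSpace ℝ E] [CompleteSpace E]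
    (f : Finset (Fin m) → E) : ∫ s, f s ∂(blockLaw m k)
      = (1 / (m.choose k : ℝ)) • ∑ s ∈ Finset.powersetCard k Finset.univ, f s := by
  rw [blockLaw, setOf_card_eq, integral_uniformOn_finset]
  simp

theorem sum_powersetCard_map {E : Type*} [AddCommMonoid E] (σ : Equiv.Perm (Fin m))
    (f : Finset (Fin m) → E) :
    ∑ s ∈ Finset.powersetCard k Finset.univ, f (s.map σ.toEmbedding)
      = ∑ s ∈ Finset.powersetCard k Finset.univ, f s := by
  refine Finset.sum_bij' (fun s _ => s.map σ.toEmbedding) (fun s _ => s.map σ.symm.toEmbedding)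
    ?_ ?_ ?_ ?_ ?_
  · intro s hs; simpa [Finset.mem_powersetCard] using hs
  · intro s hs; simpa [Finset.mem_powersetCard] using hs
  · intro s _; ext; simp
  · intro s _; ext; simp
  · intro s _; rfl

theorem integral_blockLaw_map (σ : Equiv.Perm (Fin m)) (f : Finset (Fin m) → ℝ) :
    ∫ s, f (s.map σ.toEmbedding) ∂(blockLaw m k) = ∫ s, f s ∂(blockLaw m k) := by
  rw [integral_blockLaw, integral_blockLaw, sum_powersetCard_map]

theorem integral_blockLaw_congr {E : Type*} [NormedAddCommGroup E] [NormedSpace ℝ E]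
    [CompleteSpace E] {f g : Finset (Fin m) → E} (h : ∀ s, s.card = k → f s = g s) :
    ∫ s, f s ∂(blockLaw m k) = ∫ s, g s ∂(blockLaw m k) := by
  rw [integral_blockLaw, integral_blockLaw]
  congr 1
  exact Finset.sum_congr rfl fun s hs => h s (Finset.mem_powersetCard.1 hs).2

theorem integrable_blockLaw (hkm : k ≤ m) {E : Type*} [NormedAddCommGroup E]
    (f : Finset (Fin m) → E) : Integrable f (blockLaw m k) := by
  have := isProbabilityMeasure_blockLaw hkm
  exact Integrable.of_finite

theorem integral_blockLaw_mono {f g : Finset (Fin m) → ℝ}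
    (h : ∀ s, s.card = k → f s ≤ g s) :
    ∫ s, f s ∂(blockLaw m k) ≤ ∫ s, g s ∂(blockLaw m k) := by
  rw [integral_blockLaw, integral_blockLaw]
  refine smul_le_smul_of_nonneg_left ?_ (by positivity)
  exact Finset.sum_le_sum fun s hs => h s (Finset.mem_powersetCard.1 hs).2

/-- Transpositions preserve the law, so every block has the same inclusion probability, and these
probabilities sum to the size k. -/
theorem integral_block_mem (hkm : k ≤ m) (i : Fin m) :
    ∫ s, (if i ∈ s then (1 : ℝ) else 0) ∂(blockLaw m k) = k / m := by
  have := isProbabilityMeasure_blockLaw hkm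
  have hm : (0 : ℝ) < m := by exact_mod_cast i.pos
  have hsym : ∀ j, ∫ s, (if j ∈ s then (1 : ℝ) else 0) ∂(blockLaw m k)
      = ∫ s, (if i ∈ s then (1 : ℝ) else 0) ∂(blockLaw m k) := by
    intro j
    rw [← integral_blockLaw_map (Equiv.swap i j) (fun s => if j ∈ s then (1 : ℝ) else 0)]
    refine integral_congr_ae (Filter.Eventually.of_forall fun s => ?_)
    have : (j ∈ s.map (Equiv.swap i j).toEmbedding) ↔ i ∈ s := by
      rw [Finset.mem_map_equiv]; simp
    simp only [this]
  have hsum : ∑ j, ∫ s, (if j ∈ s then (1 : ℝ) else 0) ∂(blockLaw m k) = k := by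
    rw [← integral_finsetSum _ fun j _ => integrable_blockLaw hkm _,
      integral_blockLaw_congr (g := fun _ => (k : ℝ))]
    · simp
    · intro s hs; simp [hs]
  simp only [hsym, Finset.sum_const, Finset.card_univ, Fintype.card_fin, nsmul_eq_mul] at hsum
  rw [← hsum]; field_simp

theorem sum_mem_eq {E : Type*} [AddCommGroup E] [Module ℝ E] (s : Finset (Fin m))
    (c : Fin m → E) : ∑ i ∈ s, c i = ∑ i, (if i ∈ s then (1 : ℝ) else 0) • c i := by
  simp [ite_smul, Finset.sum_ite_mem]

theorem integral_block_average (hk : 1 ≤ k) (hkm : k ≤ m) {E : Type*} [NormedAddCommGroup E]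
    [NormedSpace ℝ E] [CompleteSpace E] (c : Fin m → E) :
    ∫ s, (1 / (k : ℝ)) • ∑ i ∈ s, c i ∂(blockLaw m k) = (1 / (m : ℝ)) • ∑ i, c i := by
  have hk' : (k : ℝ) ≠ 0 := by positivity
  simp_rw [fun s => sum_mem_eq s c]
  rw [integral_smul, integral_finsetSum _ fun j _ => integrable_blockLaw hkm _]
  simp_rw [integral_smul_const, integral_block_mem hkm]
  rw [← Finset.smul_sum, smul_smul]
  congr 1
  · field_simp
  · simp

theorem exists_perm_pair {i j i' j' : Fin m} (h : i ≠ j) (h' : i' ≠ j') :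
    ∃ σ : Equiv.Perm (Fin m), σ i = i' ∧ σ j = j' := by
  refine ⟨Equiv.swap (Equiv.swap i i' j) j' * Equiv.swap i i', ?_, ?_⟩
  · rw [Equiv.Perm.mul_apply, Equiv.swap_apply_left, Equiv.swap_apply_of_ne_of_ne _ h']
    intro hh
    have := (Equiv.swap i i').injective (hh.symm.trans (Equiv.swap_apply_left i i').symm)
    exact h this.symm
  · rw [Equiv.Perm.mul_apply, Equiv.swap_apply_left]

/-- Any pair of distinct blocks can be carried to any other by a permutation. Only the sign of the
common value is used, so it is not computed. -/
theorem integral_block_pair : ∃ c : ℝ, 0 ≤ c ∧ ∀ i j : Fin m, i ≠ j →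
    ∫ s, (if i ∈ s then (1 : ℝ) else 0) * (if j ∈ s then (1 : ℝ) else 0) ∂(blockLaw m k) = c := by
  by_cases h : ∃ i j : Fin m, i ≠ j
  · obtain ⟨i, j, hij⟩ := h
    refine ⟨∫ s, (if i ∈ s then (1 : ℝ) else 0) * (if j ∈ s then (1 : ℝ) else 0) ∂(blockLaw m k),
      integral_nonneg fun s => by positivity, fun i' j' hij' => ?_⟩
    obtain ⟨σ, rfl, rfl⟩ := exists_perm_pair hij hij'
    rw [← integral_blockLaw_map σ]
    refine integral_congr_ae (Filter.Eventually.of_forall fun s => ?_)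
    simp
  · push Not at h
    exact ⟨0, le_rfl, fun i j hij => absurd (h i j) hij⟩

/-- Expanding the square, all off-diagonal pairs carry the same weight c. Since the vectors sum to
zero, the off-diagonal part equals −c times the diagonal, and c ≥ 0 allows it to be dropped. -/
theorem integral_block_norm_sum_sq_le (hkm : k ≤ m) {E : Type*} [NormedAddCommGroup E]
    [InnerProductSpace ℝ E] (a : Fin m → E) (ha : ∑ i, a i = 0) :
    ∫ s, ‖∑ i ∈ s, a i‖ ^ 2 ∂(blockLaw m k) ≤ k / m * ∑ i, ‖a i‖ ^ 2 := by
  obtain ⟨c, hc0, hc⟩ := integral_block_pair (m := m) (k := k)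
  have hexp : ∀ s : Finset (Fin m), ‖∑ i ∈ s, a i‖ ^ 2 = ∑ i, ∑ j,
      (if i ∈ s then (1 : ℝ) else 0) * (if j ∈ s then (1 : ℝ) else 0) * inner ℝ (a i) (a j) := by
    intro s
    rw [← real_inner_self_eq_norm_sq, sum_mem_eq, sum_inner]
    refine Finset.sum_congr rfl fun i _ => ?_
    rw [inner_sum]
    refine Finset.sum_congr rfl fun j _ => ?_
    rw [real_inner_smul_left, real_inner_smul_right]; ring
  simp_rw [hexp]
  rw [integral_finsetSum _ fun j _ => integrable_blockLaw hkm _]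
  have hrow : ∀ i, ∫ s, ∑ j, (if i ∈ s then (1 : ℝ) else 0) * (if j ∈ s then (1 : ℝ) else 0)
      * inner ℝ (a i) (a j) ∂(blockLaw m k) = (k / m - c) * ‖a i‖ ^ 2 := by
    intro i
    rw [integral_finsetSum _ fun j _ => integrable_blockLaw hkm _]
    simp_rw [integral_mul_const]
    -- The weight is c for every j, with a correction on the diagonal; the constant part then
    -- vanishes because the vectors sum to zero.
    have hterm : ∀ j, (∫ s, (if i ∈ s then (1 : ℝ) else 0) * (if j ∈ s then (1 : ℝ) else 0)
        ∂(blockLaw m k)) * inner ℝ (a i) (a j) = c * inner ℝ (a i) (a j)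
          + if i = j then (k / m - c) * ‖a i‖ ^ 2 else 0 := by
      intro j
      by_cases hij : i = j
      · subst hij
        have : ∀ s : Finset (Fin m), (if i ∈ s then (1 : ℝ) else 0) * (if i ∈ s then (1 : ℝ) else 0)
            = if i ∈ s then (1 : ℝ) else 0 := fun s => by split_ifs <;> simp
        simp_rw [this]
        rw [integral_block_mem hkm, real_inner_self_eq_norm_sq, if_pos trivial]; ring
      · rw [hc i j hij, if_neg hij, add_zero]
    simp_rw [hterm]
    rw [Finset.sum_add_distrib, ← Finset.mul_sum, ← inner_sum, ha]
    simp
  simp_rw [hrow]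
  rw [← Finset.mul_sum]
  exact mul_le_mul_of_nonneg_right (by linarith) (Finset.sum_nonneg fun i _ => by positivity)

/-- Centring reduces this to vectors of sum zero and does not increase the sum of squares. Sampling
without replacement thus still gains the factor 1/k. -/
theorem integral_block_variance_le (hk : 1 ≤ k) (hkm : k ≤ m) {E : Type*} [NormedAddCommGroup E]
    [InnerProductSpace ℝ E] (c : Fin m → E) :
    ∫ s, ‖(1 / (k : ℝ)) • ∑ i ∈ s, c i - (1 / (m : ℝ)) • ∑ i, c i‖ ^ 2 ∂(blockLaw m k)
      ≤ 1 / k * (1 / m * ∑ i, ‖c i‖ ^ 2) := by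
  have hk' : (0 : ℝ) < k := by positivity
  have hm' : (0 : ℝ) < m := by exact_mod_cast (hk.trans hkm)
  set cbar : E := (1 / (m : ℝ)) • ∑ i, c i with hcbar
  have hsum : ∑ i, c i = (m : ℝ) • cbar := by rw [hcbar, smul_smul]; field_simp; simp
  have ha : ∑ i, (c i - cbar) = 0 := by
    rw [Finset.sum_sub_distrib, hsum]; simp [← Nat.cast_smul_eq_nsmul ℝ]
  have h1 := integral_block_norm_sum_sq_le (k := k) hkm (fun i => c i - cbar) ha
  have h2 : ∑ i, ‖c i - cbar‖ ^ 2 ≤ ∑ i, ‖c i‖ ^ 2 := by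
    have : ∑ i, ‖c i - cbar‖ ^ 2 = ∑ i, ‖c i‖ ^ 2 - m * ‖cbar‖ ^ 2 := by
      simp_rw [norm_sub_sq_real]
      rw [Finset.sum_add_distrib, Finset.sum_sub_distrib, ← Finset.mul_sum, ← sum_inner, hsum,
        real_inner_smul_left, real_inner_self_eq_norm_sq]
      simp; ring
    rw [this]
    have : 0 ≤ m * ‖cbar‖ ^ 2 := by positivity
    linarith
  rw [integral_blockLaw_congr (g := fun s => (1 / (k : ℝ)) ^ 2 * ‖∑ i ∈ s, (c i - cbar)‖ ^ 2),
    integral_const_mul]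
  · calc _ ≤ (1 / (k : ℝ)) ^ 2 * (k / m * ∑ i, ‖c i‖ ^ 2) := by
          gcongr; exact h1.trans (by gcongr)
      _ = _ := by field_simp
  · intro s hs
    rw [← sq_abs (1 / (k : ℝ)), ← Real.norm_eq_abs, ← mul_pow, ← norm_smul,
      Finset.sum_sub_distrib, smul_sub]
    simp only [Finset.sum_const, hs, ← Nat.cast_smul_eq_nsmul ℝ, smul_smul]
    rw [one_div_mul_cancel hk'.ne', one_smul]

end uniform

/-! ### Freezing the past -/

section freezing

/-- By independence the joint law is a product, so Tonelli integrates out the fresh noise at a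
frozen past. Integrability of the composed variable is a conclusion, which allows moment bounds to
be propagated along the iteration. -/
theorem integrable_and_integral_le_of_indepFun {Ω E Y : Type*} [MeasurableSpace Ω]
    [MeasurableSpace E] [MeasurableSpace Y] {μ : Measure Ω} [IsProbabilityMeasure μ] {X : Ω → E}
    {N : Ω → Y} (hX : Measurable X) (hN : Measurable N) (hind : IndepFun X N μ)
    {h : E × Y → ℝ} (hh : Measurable h) (h0 : ∀ q, 0 ≤ h q) {b : Ω → ℝ} (hb : Integrable b μ)
    (hle : ∀ ω, Integrable (fun y => h (X ω, y)) (μ.map N) ∧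
      ∫ y, h (X ω, y) ∂(μ.map N) ≤ b ω) :
    Integrable (fun ω => h (X ω, N ω)) μ ∧ ∫ ω, h (X ω, N ω) ∂μ ≤ ∫ ω, b ω ∂μ := by
  have hb0 : ∀ ω, 0 ≤ b ω := fun ω => (integral_nonneg fun y => h0 _).trans (hle ω).2
  have hmeas : Measurable fun ω => h (X ω, N ω) := hh.comp (hX.prodMk hN)
  have hprob := Measure.isProbabilityMeasure_map (μ := μ) hN.aemeasurable
  -- Extended nonnegative integrals are used because integrability on the product is not yet known.
  have key : ∫⁻ ω, ENNReal.ofReal (h (X ω, N ω)) ∂μ ≤ ∫⁻ ω, ENNReal.ofReal (b ω) ∂μ := by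
    have e1 : ∫⁻ ω, ENNReal.ofReal (h (X ω, N ω)) ∂μ
        = ∫⁻ q, ENNReal.ofReal (h q) ∂(μ.map fun ω => (X ω, N ω)) :=
      (lintegral_map hh.ennreal_ofReal (hX.prodMk hN)).symm
    rw [e1, (indepFun_iff_map_prod_eq_prod_map_map hX.aemeasurable hN.aemeasurable).1 hind,
      lintegral_prod _ hh.ennreal_ofReal.aemeasurable,
      lintegral_map hh.ennreal_ofReal.lintegral_prod_right' hX]
    refine lintegral_mono fun ω => ?_
    rw [← ofReal_integral_eq_lintegral_ofReal (hle ω).1 (Filter.Eventually.of_forall fun y => h0 _)]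
    exact ENNReal.ofReal_le_ofReal (hle ω).2
  have hfin : ∫⁻ ω, ENNReal.ofReal (b ω) ∂μ < ⊤ := hb.lintegral_lt_top
  have hint : Integrable (fun ω => h (X ω, N ω)) μ := by
    refine ⟨hmeas.aestronglyMeasurable, ?_⟩
    rw [hasFiniteIntegral_iff_ofReal (Filter.Eventually.of_forall fun ω => h0 _)]
    exact key.trans_lt hfin
  refine ⟨hint, ?_⟩
  rw [integral_eq_lintegral_of_nonneg_ae (Filter.Eventually.of_forall fun ω => h0 _)
    hmeas.aestronglyMeasurable, integral_eq_lintegral_of_nonneg_ae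
    (Filter.Eventually.of_forall hb0) hb.aestronglyMeasurable]
  exact ENNReal.toReal_mono hfin.ne key

end freezing

/-! ### Joint law of blocks and batches -/

section product

/-- The first factor is finite, so the function is a finite sum of its slices and integrability can
be checked slice by slice. -/
theorem integrable_prod_of_finite {A B E : Type*} [MeasurableSpace A] [Finite A]
    [MeasurableSingletonClass A] [MeasurableSpace B] [NormedAddCommGroup E] {ρ : Measure A}
    [IsFiniteMeasure ρ] {π : Measure B} [SFinite π] {h : A × B → E}
    (hh : ∀ a, Integrable (fun b => h (a, b)) π) : Integrable h (ρ.prod π) := by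
  have := Fintype.ofFinite A
  have e : h = fun q => ∑ a, (({a} : Set A) ×ˢ (Set.univ : Set B)).indicator
      (fun q => h (a, q.2)) q := by
    funext q
    rw [Finset.sum_eq_single q.1]
    · simp
    · intro a _ ha; simp [ha.symm]
    · simp
  rw [e]
  refine integrable_finsetSum _ fun a _ => Integrable.indicator ?_
    ((measurableSet_singleton a).prod MeasurableSet.univ)
  exact (hh a).comp_snd ρ

variable {m k : ℕ} {T E : Type*} [MeasurableSpace T] [NormedAddCommGroup E]
  {π : Measure (Fin m → T)} {P : Fin m → Measure T}

/-- The law of a uniformly random set of `k` blocks together with independent samples for all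
blocks, of joint law `π`. -/
noncomputable abbrev noiseLaw (k : ℕ) (π : Measure (Fin m → T)) :
    Measure (Finset (Fin m) × (Fin m → T)) :=
  (blockLaw m k).prod π

theorem integrable_eval (hP : ∀ i, π.map (fun ξ => ξ i) = P i) {i : Fin m}
    {φ : T → E} (hφ : Integrable φ (P i)) : Integrable (fun ξ : Fin m → T => φ (ξ i)) π := by
  rw [← hP i] at hφ
  exact hφ.comp_measurable (measurable_pi_apply i)

theorem memLp_eval (hP : ∀ i, π.map (fun ξ => ξ i) = P i) {i : Fin m}
    {φ : T → E} (hφ : MemLp φ 2 (P i)) : MemLp (fun ξ : Fin m → T => φ (ξ i)) 2 π := by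
  rw [← hP i] at hφ
  exact (memLp_map_measure_iff hφ.1 (measurable_pi_apply i).aemeasurable).1 hφ

theorem integral_eval [NormedSpace ℝ E] (hP : ∀ i, π.map (fun ξ => ξ i) = P i) {i : Fin m}
    {φ : T → E} (hφ : Integrable φ (P i)) : ∫ ξ, φ (ξ i) ∂π = ∫ b, φ b ∂(P i) := by
  rw [← hP i] at hφ ⊢
  exact (integral_map (measurable_pi_apply i).aemeasurable hφ.1).symm

variable [IsProbabilityMeasure π]

theorem integrable_noiseLaw (hkm : k ≤ m) {h : Finset (Fin m) × (Fin m → T) → E}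
    (hh : ∀ s, Integrable (fun ξ => h (s, ξ)) π) : Integrable h (noiseLaw k π) := by
  have := isProbabilityMeasure_blockLaw hkm
  exact integrable_prod_of_finite hh

theorem integral_noiseLaw [NormedSpace ℝ E] (hkm : k ≤ m) {h : Finset (Fin m) × (Fin m → T) → E}
    (hh : ∀ s, Integrable (fun ξ => h (s, ξ)) π) :
    ∫ q, h q ∂(noiseLaw k π) = ∫ s, ∫ ξ, h (s, ξ) ∂π ∂(blockLaw m k) := by
  have := isProbabilityMeasure_blockLaw hkm
  exact integral_prod _ (integrable_noiseLaw hkm hh)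

theorem integral_noiseLaw_mono (hkm : k ≤ m) {f g : Finset (Fin m) × (Fin m → T) → ℝ}
    (hf : ∀ s, Integrable (fun ξ => f (s, ξ)) π) (hg : ∀ s, Integrable (fun ξ => g (s, ξ)) π)
    (h : ∀ s ξ, s.card = k → f (s, ξ) ≤ g (s, ξ)) :
    ∫ q, f q ∂(noiseLaw k π) ≤ ∫ q, g q ∂(noiseLaw k π) := by
  rw [integral_noiseLaw hkm hf, integral_noiseLaw hkm hg]
  exact integral_blockLaw_mono fun s hs => integral_mono (hf s) (hg s) fun ξ => h s ξ hs

theorem integrable_ite_eval (hP : ∀ i, π.map (fun ξ => ξ i) = P i) {i : Fin m} {φ : T → E}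
    (hφ : Integrable φ (P i)) (c : E) (s : Finset (Fin m)) :
    Integrable (fun ξ : Fin m → T => if i ∈ s then φ (ξ i) else c) π := by
  split_ifs
  · exact integrable_eval hP hφ
  · exact integrable_const c

/-- Block i is refreshed with probability k/m and frozen otherwise. Only the marginal law of its own
batch enters, so dependence between batches of different blocks is harmless. -/
theorem integral_noiseLaw_ite (hkm : k ≤ m) (hP : ∀ i, π.map (fun ξ => ξ i) = P i) {i : Fin m}
    {φ : T → ℝ} (hφ : Integrable φ (P i)) (c : ℝ) :
    ∫ q, (if i ∈ q.1 then φ (q.2 i) else c) ∂(noiseLaw k π)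
      = k / m * ∫ b, φ b ∂(P i) + (1 - k / m) * c := by
  have := isProbabilityMeasure_blockLaw hkm
  rw [integral_noiseLaw hkm (integrable_ite_eval hP hφ c)]
  have : ∀ s : Finset (Fin m), ∫ ξ, (if i ∈ s then φ (ξ i) else c) ∂π
      = (if i ∈ s then (1 : ℝ) else 0) * ((∫ b, φ b ∂(P i)) - c) + c := by
    intro s
    split_ifs
    · rw [integral_eval hP hφ]; ring
    · simp
  simp_rw [this]
  rw [integral_add (integrable_blockLaw hkm _) (integrable_blockLaw hkm _), integral_mul_const,
    integral_block_mem hkm]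
  simp; ring

theorem integral_noiseLaw_average [NormedSpace ℝ E] [CompleteSpace E] (hk : 1 ≤ k)
    (hkm : k ≤ m) (hP : ∀ i, π.map (fun ξ => ξ i) = P i)
    {φ : Fin m → T → E} (hφ : ∀ i, Integrable (φ i) (P i)) :
    ∫ q, (1 / (k : ℝ)) • ∑ i ∈ q.1, φ i (q.2 i) ∂(noiseLaw k π)
      = (1 / (m : ℝ)) • ∑ i, ∫ b, φ i b ∂(P i) := by
  have hi : ∀ s : Finset (Fin m), Integrable (fun ξ => ∑ i ∈ s, φ i (ξ i)) π := fun s =>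
    integrable_finsetSum _ fun i _ => integrable_eval hP (hφ i)
  rw [integral_noiseLaw hkm fun s => (hi s).smul _, ← integral_block_average hk hkm]
  refine integral_congr_ae (Filter.Eventually.of_forall fun s => ?_)
  simp only
  rw [integral_smul, integral_finsetSum _ fun i _ => integrable_eval hP (hφ i)]
  simp_rw [fun i => integral_eval hP (hφ i)]

end product

/-! ### Second moments of minibatch averages -/

section secondMoment

variable {T E : Type*} [MeasurableSpace T] [NormedAddCommGroup E] [InnerProductSpace ℝ E]

theorem integral_norm_const_add_sq [CompleteSpace E] {P : Measure T} [IsProbabilityMeasure P]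
    {X : T → E} (hX : MemLp X 2 P) (a : E) :
    ∫ b, ‖a + X b‖ ^ 2 ∂P = ‖a‖ ^ 2 + 2 * inner ℝ a (∫ b, X b ∂P) + ∫ b, ‖X b‖ ^ 2 ∂P := by
  have hX1 : Integrable X P := hX.integrable one_le_two
  have hX2 : Integrable (fun b => ‖X b‖ ^ 2) P := hX.integrable_norm_pow two_ne_zero
  have hin : Integrable (fun b => inner ℝ a (X b)) P := hX1.const_inner a
  simp_rw [norm_add_sq_real]
  have hc : Integrable (fun _ : T => ‖a‖ ^ 2) P := integrable_const _
  have hs : Integrable (fun b => ‖a‖ ^ 2 + 2 * inner ℝ a (X b)) P := hc.add (hin.const_mul 2)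
  rw [integral_add hs hX2, integral_add hc (hin.const_mul 2), integral_const_mul,
    integral_inner hX1]
  simp

theorem integral_norm_sub_mean_sq_le [CompleteSpace E] {P : Measure T} [IsProbabilityMeasure P]
    {X : T → E} (hX : MemLp X 2 P) :
    ∫ b, ‖X b - ∫ c, X c ∂P‖ ^ 2 ∂P ≤ ∫ b, ‖X b‖ ^ 2 ∂P := by
  have h := integral_norm_const_add_sq hX (-∫ c, X c ∂P)
  simp only [neg_add_eq_sub, norm_neg, inner_neg_left, real_inner_self_eq_norm_sq] at h
  rw [h]
  nlinarith [sq_nonneg ‖∫ c, X c ∂P‖]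

variable {m k : ℕ} {π : Measure (Fin m → T)} {P : Fin m → Measure T}

theorem memLp_average (hP : ∀ i, π.map (fun ξ => ξ i) = P i)
    {φ : Fin m → T → E} (hφ : ∀ i, MemLp (φ i) 2 (P i)) (s : Finset (Fin m)) :
    MemLp (fun ξ : Fin m → T => (1 / (k : ℝ)) • ∑ i ∈ s, φ i (ξ i)) 2 π := by
  have h := memLp_finsetSum s (f := fun i (ξ : Fin m → T) => φ i (ξ i)) (p := 2) (μ := π)
    fun i _ => memLp_eval hP (hφ i)
  exact h.const_smul (1 / (k : ℝ))

variable [IsProbabilityMeasure π]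

/-- Convexity of the square, not independence: the batches of different blocks may be correlated, so
no factor 1/k is available here. -/
theorem integral_noiseLaw_average_sq_le (hk : 1 ≤ k) (hkm : k ≤ m)
    (hP : ∀ i, π.map (fun ξ => ξ i) = P i)
    {φ : Fin m → T → E} (hφ : ∀ i, MemLp (φ i) 2 (P i)) :
    ∫ q, ‖(1 / (k : ℝ)) • ∑ i ∈ q.1, φ i (q.2 i)‖ ^ 2 ∂(noiseLaw k π)
      ≤ 1 / (m : ℝ) * ∑ i, ∫ b, ‖φ i b‖ ^ 2 ∂(P i) := by
  have h := integral_noiseLaw_average hk hkm hP (φ := fun i b => ‖φ i b‖ ^ 2)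
    fun i => (hφ i).integrable_norm_pow two_ne_zero
  rw [smul_eq_mul] at h
  rw [← h]
  refine integral_noiseLaw_mono hkm
    (fun s => (memLp_average hP hφ s).integrable_norm_pow two_ne_zero) (fun s => ?_) ?_
  · exact (integrable_finsetSum _ fun i _ => integrable_eval hP
      ((hφ i).integrable_norm_pow two_ne_zero)).const_mul _
  · intro s ξ hs
    exact norm_average_sq_le _ _ hs

theorem memLp_noiseLaw_average (hkm : k ≤ m) (hP : ∀ i, π.map (fun ξ => ξ i) = P i)
    {φ : Fin m → T → E} (hφ : ∀ i, MemLp (φ i) 2 (P i)) :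
    MemLp (fun q : Finset (Fin m) × (Fin m → T) => (1 / (k : ℝ)) • ∑ i ∈ q.1, φ i (q.2 i)) 2
      (noiseLaw k π) := by
  have hi := integrable_noiseLaw (E := E) hkm
    (h := fun q : Finset (Fin m) × (Fin m → T) => (1 / (k : ℝ)) • ∑ i ∈ q.1, φ i (q.2 i))
    fun s => (memLp_average hP hφ s).integrable one_le_two
  rw [memLp_two_iff_integrable_sq_norm hi.1]
  exact integrable_noiseLaw hkm fun s => (memLp_average hP hφ s).integrable_norm_pow two_ne_zero

/-- The error splits into batch noise, averaged by convexity, and the fluctuation of the block means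
under sampling, which does gain 1/k. This is the origin of the term 1/B₁ + 1/B₂ in the outer
recursion. -/
theorem integral_noiseLaw_variance_le [CompleteSpace E] (hk : 1 ≤ k) (hkm : k ≤ m)
    (hP : ∀ i, π.map (fun ξ => ξ i) = P i) [∀ i, IsProbabilityMeasure (P i)]
    {φ : Fin m → T → E} (hφ : ∀ i, MemLp (φ i) 2 (P i)) {V M : ℝ}
    (hV : ∀ i, ∫ b, ‖φ i b - ∫ c, φ i c ∂(P i)‖ ^ 2 ∂(P i) ≤ V)
    (hM : ∀ i, ‖∫ b, φ i b ∂(P i)‖ ^ 2 ≤ M) :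
    ∫ q, ‖(1 / (k : ℝ)) • ∑ i ∈ q.1, φ i (q.2 i) - (1 / (m : ℝ)) • ∑ i, ∫ b, φ i b ∂(P i)‖ ^ 2
      ∂(noiseLaw k π) ≤ 2 * V + 2 * (1 / k * M) := by
  have := isProbabilityMeasure_blockLaw hkm
  have hm' : (0 : ℝ) < m := by exact_mod_cast (hk.trans hkm)
  set c : Fin m → E := fun i => ∫ b, φ i b ∂(P i) with hc
  have hφc : ∀ i, MemLp (fun b => φ i b - c i) 2 (P i) := fun i => (hφ i).sub (memLp_const _)
  have h1 := integral_noiseLaw_average_sq_le hk hkm hP hφc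
  have h2 := integral_block_variance_le hk hkm c
  have h1' : 1 / (m : ℝ) * ∑ i, ∫ b, ‖φ i b - c i‖ ^ 2 ∂(P i) ≤ V := by
    calc _ ≤ 1 / (m : ℝ) * ∑ _i : Fin m, V := by gcongr with i; exact hV i
      _ = V := by simp; field_simp
  have h2' : 1 / (m : ℝ) * ∑ i, ‖c i‖ ^ 2 ≤ M := by
    calc _ ≤ 1 / (m : ℝ) * ∑ _i : Fin m, M := by gcongr with i; exact hM i
      _ = M := by simp; field_simp
  have hi1 : ∀ s, Integrable (fun ξ : Fin m → T =>
      2 * ‖(1 / (k : ℝ)) • ∑ i ∈ s, (φ i (ξ i) - c i)‖ ^ 2) π := fun s =>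
    ((memLp_average hP hφc s).integrable_norm_pow two_ne_zero).const_mul 2
  have hi2 : ∀ s : Finset (Fin m), Integrable (fun _ : Fin m → T =>
      2 * ‖(1 / (k : ℝ)) • ∑ i ∈ s, c i - (1 / (m : ℝ)) • ∑ i, c i‖ ^ 2) π := fun s =>
    integrable_const _
  calc _ ≤ ∫ q, (2 * ‖(1 / (k : ℝ)) • ∑ i ∈ q.1, (φ i (q.2 i) - c i)‖ ^ 2
        + 2 * ‖(1 / (k : ℝ)) • ∑ i ∈ q.1, c i - (1 / (m : ℝ)) • ∑ i, c i‖ ^ 2)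
        ∂(noiseLaw k π) := by
        refine integral_noiseLaw_mono hkm (fun s => ?_)
          (fun s => (hi1 s).add (hi2 s)) fun s ξ _ => ?_
        · exact ((memLp_average hP hφ s).sub (memLp_const _)).integrable_norm_pow two_ne_zero
        · refine le_of_eq_of_le ?_ (norm_add_sq_le _ _)
          rw [Finset.sum_sub_distrib, smul_sub]; simp
    _ = 2 * ∫ q, ‖(1 / (k : ℝ)) • ∑ i ∈ q.1, (φ i (q.2 i) - c i)‖ ^ 2 ∂(noiseLaw k π)
        + 2 * ∫ s, ‖(1 / (k : ℝ)) • ∑ i ∈ s, c i - (1 / (m : ℝ)) • ∑ i, c i‖ ^ 2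
          ∂(blockLaw m k) := by
        rw [integral_add (integrable_noiseLaw hkm hi1)
          (integrable_noiseLaw hkm hi2), integral_const_mul]
        congr 1
        rw [integral_noiseLaw hkm hi2]
        simp [integral_const_mul]
    _ ≤ 2 * V + 2 * (1 / k * M) := by
        have h3 : 1 / (k : ℝ) * (1 / m * ∑ i, ‖c i‖ ^ 2) ≤ 1 / k * M := by gcongr
        linarith

end secondMoment

/-! ### Moments of the stochastic oracles -/

section oracle

variable {d p m B₂ : ℕ} {S : Type*} [MeasurableSpace S] {Q : Problem d p m B₂ S}
  {Lf Cf Lg Cg σ : ℝ}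

theorem Problem.Assumptions.isProbabilityMeasure (hQ : Q.Assumptions Lf Cf Lg Cg σ) (i : Fin m) :
    IsProbabilityMeasure (Q.P i) := (hQ.oracle i).prob

theorem Problem.Assumptions.integral_jacobian_sq_le (hQ : Q.Assumptions Lf Cf Lg Cg σ)
    (hCg : 0 ≤ Cg) (hB₂ : 1 ≤ B₂) (i : Fin m) (x : Euc d) :
    ∫ b, ‖Q.J i x b‖ ^ 2 ∂(Q.P i) ≤ 2 * Cg ^ 2 + 2 * σ ^ 2 := by
  have := hQ.isProbabilityMeasure i
  have hB : (1 : ℝ) ≤ B₂ := by exact_mod_cast hB₂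
  have hJ := (hQ.oracle i).memLp_jacobian x
  have hc : MemLp (fun b => Q.J i x b - fderiv ℝ (Q.g i) x) 2 (Q.P i) := hJ.sub (memLp_const _)
  have hci := hc.integrable_norm_pow two_ne_zero
  have hg : ‖fderiv ℝ (Q.g i) x‖ ^ 2 ≤ Cg ^ 2 :=
    pow_le_pow_left₀ (norm_nonneg _) ((hQ.inner i).norm_fderiv_le hCg x) 2
  have hv : σ ^ 2 / (B₂ : ℝ) ≤ σ ^ 2 := div_le_self (sq_nonneg _) hB
  calc ∫ b, ‖Q.J i x b‖ ^ 2 ∂(Q.P i)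
      ≤ ∫ b, (2 * ‖Q.J i x b - fderiv ℝ (Q.g i) x‖ ^ 2 + 2 * Cg ^ 2) ∂(Q.P i) := by
        refine integral_mono (hJ.integrable_norm_pow two_ne_zero)
          ((hci.const_mul 2).add (integrable_const _)) fun b => ?_
        have := norm_add_sq_le (Q.J i x b - fderiv ℝ (Q.g i) x) (fderiv ℝ (Q.g i) x)
        rw [sub_add_cancel] at this
        simp only
        linarith
    _ = 2 * ∫ b, ‖Q.J i x b - fderiv ℝ (Q.g i) x‖ ^ 2 ∂(Q.P i) + 2 * Cg ^ 2 := by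
        rw [integral_add (hci.const_mul 2) (integrable_const _), integral_const_mul]; simp
    _ ≤ _ := by linarith [(hQ.oracle i).variance_jacobian x]

theorem Problem.Assumptions.memLp_correction (hQ : Q.Assumptions Lf Cf Lg Cg σ)
    (e : InnerEstimator) (i : Fin m) (w w' : Euc d) :
    MemLp (correction Q e i w w') 2 (Q.P i) := by
  cases e
  · exact ((hQ.oracle i).memLp_value w').sub ((hQ.oracle i).memLp_value w)
  · exact (ContinuousLinearMap.apply ℝ (Euc p) (w' - w)).comp_memLp'
      ((hQ.oracle i).memLp_jacobian w')

/-- The two-point correction is unbiased for the increment of g. The single-point one has mean equal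
to the linearisation at the new point, so its bias is a second-order remainder. This lemma and the
second moment bound below let both estimators be treated together. -/
theorem Problem.Assumptions.norm_integral_correction_sub_le (hQ : Q.Assumptions Lf Cf Lg Cg σ)
    (hLg : 0 ≤ Lg) (e : InnerEstimator) (i : Fin m) (w w' : Euc d) :
    ‖∫ b, correction Q e i w w' b ∂(Q.P i) - (Q.g i w' - Q.g i w)‖ ≤ Lg * ‖w' - w‖ ^ 2 := by
  have := hQ.isProbabilityMeasure i
  have O := hQ.oracle i
  cases e
  · simp only [correction]
    rw [integral_sub ((O.memLp_value w').integrable one_le_two)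
      ((O.memLp_value w).integrable one_le_two), O.unbiased_value, O.unbiased_value, sub_self,
      norm_zero]
    positivity
  · simp only [correction]
    rw [← ContinuousLinearMap.integral_apply ((O.memLp_jacobian w').integrable one_le_two),
      O.unbiased_jacobian, norm_sub_rev]
    exact norm_taylor_le (hQ.inner i).differentiable hLg (hQ.inner i).smooth w w'
      (right_mem_segment ℝ w w')

theorem Problem.Assumptions.integral_correction_sq_le (hQ : Q.Assumptions Lf Cf Lg Cg σ)
    (hCg : 0 ≤ Cg) (hB₂ : 1 ≤ B₂) (e : InnerEstimator) (i : Fin m) (w w' : Euc d) :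
    ∫ b, ‖correction Q e i w w' b‖ ^ 2 ∂(Q.P i) ≤ (2 * Cg ^ 2 + 2 * σ ^ 2) * ‖w' - w‖ ^ 2 := by
  have O := hQ.oracle i
  cases e
  · refine (O.meanLipschitz_value w' w).trans ?_
    gcongr
    nlinarith [sq_nonneg Cg, sq_nonneg σ]
  · calc ∫ b, ‖Q.J i w' b (w' - w)‖ ^ 2 ∂(Q.P i)
        ≤ ∫ b, ‖Q.J i w' b‖ ^ 2 * ‖w' - w‖ ^ 2 ∂(Q.P i) := by
          refine integral_mono
            ((hQ.memLp_correction .msvrSP i w w').integrable_norm_pow two_ne_zero)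
            (((O.memLp_jacobian w').integrable_norm_pow two_ne_zero).mul_const _) fun b => ?_
          simp only
          rw [← mul_pow]
          exact pow_le_pow_left₀ (norm_nonneg _) (ContinuousLinearMap.le_opNorm _ _) 2
      _ ≤ _ := by
          rw [integral_mul_const]
          gcongr
          exact hQ.integral_jacobian_sq_le hCg hB₂ i w'

end oracle

theorem memLp_const_add {T E : Type*} [MeasurableSpace T] [NormedAddCommGroup E] {P : Measure T}
    [IsProbabilityMeasure P] {X : T → E} (hX : MemLp X 2 P) (a : E) :
    MemLp (fun b => a + X b) 2 P :=
  (memLp_const a).add hX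

/-! ### One step of the inner estimators -/

section innerStep

variable {d p m B₁ B₂ : ℕ} {S : Type*} [MeasurableSpace S] {Q : Problem d p m B₂ S}
  {Lf Cf Lg Cg σ : ℝ} {π : Measure (Fin m → Fin B₂ → S)} [IsProbabilityMeasure π]

/-- The last identity is the defining property of γ: it balances the cross terms from the sampled
and the unsampled case. The quadratic bound is the price, a variance amplified by m/B₁. -/
theorem gammaWeight_bounds (hB₁ : 1 ≤ B₁) (hB₁m : B₁ ≤ m) {β : ℝ} (hβ0 : 0 ≤ β)
    (hβ : β ≤ 1 / 2) :
    0 ≤ gammaWeight m B₁ β ∧ (B₁ / m : ℝ) * gammaWeight m B₁ β ^ 2 ≤ 4 * (m / B₁) ∧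
      (B₁ / m : ℝ) * (1 - β) * gammaWeight m B₁ β
        = (1 - B₁ / m : ℝ) + (B₁ / m) * (1 - β) ^ 2 := by
  have hk : (0 : ℝ) < B₁ := by positivity
  have hkm : (B₁ : ℝ) ≤ m := by exact_mod_cast hB₁m
  have hm : (0 : ℝ) < m := hk.trans_le hkm
  have h1 : 0 < 1 - β := by linarith
  have h0 : 0 ≤ gammaWeight m B₁ β := by
    have : 0 ≤ (m : ℝ) - B₁ := by linarith
    unfold gammaWeight; positivity
  refine ⟨h0, ?_, ?_⟩
  · have hle : gammaWeight m B₁ β ≤ 2 * (m / B₁) := by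
      have : ((m : ℝ) - B₁) / (B₁ * (1 - β)) ≤ 2 * (((m : ℝ) - B₁) / B₁) := by
        rw [div_le_iff₀ (by positivity)]
        have : 2 * (((m : ℝ) - B₁) / B₁) * (B₁ * (1 - β)) = ((m : ℝ) - B₁) * (2 * (1 - β)) := by
          field_simp
        rw [this]
        nlinarith
      have e : 2 * (((m : ℝ) - B₁) / B₁) = 2 * (m / B₁) - 2 := by field_simp
      unfold gammaWeight
      linarith
    calc (B₁ / m : ℝ) * gammaWeight m B₁ β ^ 2 ≤ (B₁ / m : ℝ) * (2 * (m / B₁)) ^ 2 := by gcongr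
      _ = _ := by field_simp; norm_num
  · unfold gammaWeight; field_simp

/-- The mean square of the correction term, relative to the squared displacement. -/
noncomputable def jacobianBound (Cg σ : ℝ) : ℝ := 2 * Cg ^ 2 + 2 * σ ^ 2

theorem jacobianBound_nonneg (Cg σ : ℝ) : 0 ≤ jacobianBound Cg σ := by
  unfold jacobianBound; positivity

/-- Displacement factor in the recursion for the inner error. -/
noncomputable def innerDrift (Cf Lg Cg σ : ℝ) : ℝ :=
  2 * Lg ^ 2 * (Cf * Cg) ^ 2 + 12 * jacobianBound Cg σ + 4 * Cg ^ 2

/-- Displacement factor in the bound for the increment of the inner estimators. -/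
noncomputable def innerMove (Cg σ : ℝ) : ℝ := 16 * jacobianBound Cg σ + 4 * Cg ^ 2

/-- The centred part of the update of an inner estimator. -/
noncomputable def innerNoise (Q : Problem d p m B₂ S) (e : InnerEstimator) (β γ : ℝ) (w w' : Euc d)
    (i : Fin m) (b : Fin B₂ → S) : Euc p :=
  β • (Q.G i w' b - Q.g i w') + γ • correction Q e i w w' b + (-(1 - β)) • (Q.g i w' - Q.g i w)

theorem Problem.Assumptions.memLp_value_sub (hQ : Q.Assumptions Lf Cf Lg Cg σ) (w : Euc d)
    (i : Fin m) (c : Euc p) : MemLp (fun b => Q.G i w b - c) 2 (Q.P i) := by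
  have := hQ.isProbabilityMeasure i
  exact ((hQ.oracle i).memLp_value w).sub (memLp_const _)

theorem Problem.Assumptions.memLp_innerNoise (hQ : Q.Assumptions Lf Cf Lg Cg σ)
    (e : InnerEstimator) (β γ : ℝ) (w w' : Euc d) (i : Fin m) :
    MemLp (innerNoise Q e β γ w w' i) 2 (Q.P i) := by
  have := hQ.isProbabilityMeasure i
  exact (((hQ.memLp_value_sub w' i _).const_smul β).add
    ((hQ.memLp_correction e i w w').const_smul γ)).add (memLp_const _)

theorem Problem.Assumptions.integral_innerNoise (hQ : Q.Assumptions Lf Cf Lg Cg σ)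
    (e : InnerEstimator) (β γ : ℝ) (w w' : Euc d) (i : Fin m) :
    ∫ b, innerNoise Q e β γ w w' i b ∂(Q.P i)
      = γ • ∫ b, correction Q e i w w' b ∂(Q.P i) - (1 - β) • (Q.g i w' - Q.g i w) := by
  have := hQ.isProbabilityMeasure i
  have O := hQ.oracle i
  have e1 : Integrable (fun b => β • (Q.G i w' b - Q.g i w')) (Q.P i) :=
    ((hQ.memLp_value_sub w' i _).integrable one_le_two).smul β
  have e2 : Integrable (fun b => γ • correction Q e i w w' b) (Q.P i) :=
    ((hQ.memLp_correction e i w w').integrable one_le_two).smul γ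
  have e3 : Integrable (fun b => β • (Q.G i w' b - Q.g i w') + γ • correction Q e i w w' b)
    (Q.P i) := e1.add e2
  unfold innerNoise
  rw [integral_add e3 (integrable_const _), integral_add e1 e2, integral_smul,
    integral_smul, integral_sub ((O.memLp_value w').integrable one_le_two) (integrable_const _),
    O.unbiased_value]
  simp only [integral_const, probReal_univ, one_smul, sub_self, smul_zero, zero_add]
  module

theorem Problem.Assumptions.norm_inner_sub_sq_le (hQ : Q.Assumptions Lf Cf Lg Cg σ)
    (w w' : Euc d) (i : Fin m) : ‖Q.g i w' - Q.g i w‖ ^ 2 ≤ Cg ^ 2 * ‖w' - w‖ ^ 2 := by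
  rw [← mul_pow]; exact pow_le_pow_left₀ (norm_nonneg _) ((hQ.inner i).lipschitz w' w) 2

theorem norm_smul_sq {E : Type*} [SeminormedAddCommGroup E] [NormedSpace ℝ E] (c : ℝ) (x : E) :
    ‖c • x‖ ^ 2 = c ^ 2 * ‖x‖ ^ 2 := by
  rw [norm_smul, mul_pow, Real.norm_eq_abs, sq_abs]

theorem Problem.Assumptions.integral_innerNoise_sq_le (hQ : Q.Assumptions Lf Cf Lg Cg σ)
    (hCg : 0 ≤ Cg) (hB₂ : 1 ≤ B₂) (e : InnerEstimator) {β : ℝ} (hβ0 : 0 ≤ β) (hβ : β ≤ 1)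
    (γ : ℝ) (w w' : Euc d) (i : Fin m) :
    ∫ b, ‖innerNoise Q e β γ w w' i b‖ ^ 2 ∂(Q.P i)
      ≤ 3 * (β ^ 2 * (σ ^ 2 / B₂) + γ ^ 2 * (jacobianBound Cg σ * ‖w' - w‖ ^ 2)
        + Cg ^ 2 * ‖w' - w‖ ^ 2) := by
  have := hQ.isProbabilityMeasure i
  have i1 : Integrable (fun b => β ^ 2 * ‖Q.G i w' b - Q.g i w'‖ ^ 2) (Q.P i) :=
    ((hQ.memLp_value_sub w' i _).integrable_norm_pow two_ne_zero).const_mul _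
  have i2 : Integrable (fun b => γ ^ 2 * ‖correction Q e i w w' b‖ ^ 2) (Q.P i) :=
    ((hQ.memLp_correction e i w w').integrable_norm_pow two_ne_zero).const_mul _
  have i12 : Integrable (fun b => β ^ 2 * ‖Q.G i w' b - Q.g i w'‖ ^ 2
    + γ ^ 2 * ‖correction Q e i w w' b‖ ^ 2) (Q.P i) := i1.add i2
  have hyD := hQ.norm_inner_sub_sq_le w w' i
  calc ∫ b, ‖innerNoise Q e β γ w w' i b‖ ^ 2 ∂(Q.P i)
      ≤ ∫ b, 3 * (β ^ 2 * ‖Q.G i w' b - Q.g i w'‖ ^ 2 + γ ^ 2 * ‖correction Q e i w w' b‖ ^ 2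
          + Cg ^ 2 * ‖w' - w‖ ^ 2) ∂(Q.P i) := by
        refine integral_mono ((hQ.memLp_innerNoise e β γ w w' i).integrable_norm_pow two_ne_zero)
          ((i12.add (integrable_const _)).const_mul 3) fun b => ?_
        refine (norm_add_add_sq_le _ _ _).trans ?_
        rw [norm_smul_sq, norm_smul_sq, norm_smul_sq]
        have : (-(1 - β)) ^ 2 * ‖Q.g i w' - Q.g i w‖ ^ 2 ≤ 1 * ‖Q.g i w' - Q.g i w‖ ^ 2 := by
          gcongr; nlinarith
        linarith
    _ = 3 * (β ^ 2 * ∫ b, ‖Q.G i w' b - Q.g i w'‖ ^ 2 ∂(Q.P i)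
          + γ ^ 2 * ∫ b, ‖correction Q e i w w' b‖ ^ 2 ∂(Q.P i) + Cg ^ 2 * ‖w' - w‖ ^ 2) := by
        rw [integral_const_mul, integral_add i12 (integrable_const _), integral_add i1 i2,
          integral_const_mul, integral_const_mul]
        simp
    _ ≤ _ := by
        gcongr
        · exact (hQ.oracle i).variance_value w'
        · exact hQ.integral_correction_sq_le hCg hB₂ e i w w'

/-- The cross terms with the old error cancel by the choice of `γ`, up to the bias `r` of the
correction. Here `X = ‖x‖²`, `Y = ‖y‖²`, `xy = ⟪x, y⟫`, `xr = ⟪x, r⟫`. -/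
theorem innerError_scalar {q β γ X Y xy xr ρ N J c s R D : ℝ} (hq0 : 0 < q) (hq1 : q ≤ 1)
    (hβ0 : 0 < β) (hβ : β ≤ 1 / 2) (hγ0 : 0 ≤ γ) (hγ2 : q * γ ^ 2 ≤ 4 * (1 / q))
    (hγ : q * (1 - β) * γ = (1 - q) + q * (1 - β) ^ 2) (hX : 0 ≤ X) (hρ : 0 ≤ ρ)
    (hD : 0 ≤ D) (hJ : 0 ≤ J) (hc : 0 ≤ c)
    (hxr : xr ^ 2 ≤ X * ρ) (hρR : ρ ≤ R * β * D) (hY : Y ≤ c * D) (hY0 : 0 ≤ Y)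
    (hN : N ≤ 3 * (β ^ 2 * s + γ ^ 2 * (J * D) + c * D)) :
    q * ((1 - β) ^ 2 * X + 2 * ((1 - β) * (γ * (xy + xr) - (1 - β) * xy)) + N)
      + (1 - q) * (X - 2 * xy + Y)
    ≤ (1 - q * β) * X + 3 * q * β ^ 2 * s + (2 * R + 12 * J + 4 * c) * (1 / q) * D := by
  have hq1' : q ≤ 1 / q := by rw [le_div_iff₀ hq0]; nlinarith
  have hq2' : 1 - q ≤ 1 / q - q := by
    have : 1 ≤ 1 / q := by rw [le_div_iff₀ hq0]; linarith
    linarith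
  have hpos : 0 < q * β := by positivity
  -- Young's inequality with weight qβ/2, so that the bias costs only a quarter of the 2qβ
  -- contraction available before the β² loss.
  have hxr2 : 2 * xr ≤ q * β / 2 * X + 2 / (q * β) * ρ := by
    refine le_of_sq_le_sq ?_ (by positivity)
    have e : (q * β / 2 * X + 2 / (q * β) * ρ) ^ 2
        = (q * β / 2 * X - 2 / (q * β) * ρ) ^ 2 + 4 * (X * ρ) := by field_simp; ring
    rw [e]
    nlinarith [sq_nonneg (q * β / 2 * X - 2 / (q * β) * ρ)]
  have hr' : 2 / (q * β) * ρ ≤ 2 * R * (1 / q) * D := by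
    calc 2 / (q * β) * ρ ≤ 2 / (q * β) * (R * β * D) := by gcongr
      _ = _ := by field_simp
  have h1β : 0 ≤ 1 - β := by linarith
  have hc1 : q * (1 - β) * γ ≤ 1 := by rw [hγ]; nlinarith
  have hc0 : 0 ≤ q * (1 - β) * γ := by positivity
  have hcross : q * (1 - β) * γ * (2 * xr) ≤ q * β / 2 * X + 2 * R * (1 / q) * D := by
    have h1 : 0 ≤ q * β / 2 * X + 2 / (q * β) * ρ := by positivity
    calc _ ≤ q * (1 - β) * γ * (q * β / 2 * X + 2 / (q * β) * ρ) := by gcongr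
      _ ≤ 1 * (q * β / 2 * X + 2 / (q * β) * ρ) := by gcongr
      _ ≤ _ := by linarith
  have hs2 := mul_le_mul_of_nonneg_left hN hq0.le
  have hγD : q * γ ^ 2 * (J * D) ≤ 4 * (1 / q) * (J * D) := by gcongr
  have hy1 : q * (c * D) ≤ 1 / q * (c * D) := by gcongr
  have hy2 : (1 - q) * Y ≤ (1 / q - q) * (c * D) :=
    mul_le_mul hq2' hY hY0 (by linarith)
  -- The coefficient is 1 − 2qβ + qβ² + qβ/2, and β ≤ 1/2 leaves exactly the contraction 1 − qβ.
  have hx2 : q * ((1 - β) ^ 2 * X) + (1 - q) * X + q * β / 2 * X ≤ (1 - q * β) * X := by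
    have h0 : 0 ≤ q * β * (1 / 2 - β) := mul_nonneg hpos.le (by linarith)
    have h1 : q * (1 - β) ^ 2 + (1 - q) + q * β / 2 ≤ 1 - q * β := by nlinarith
    have := mul_le_mul_of_nonneg_right h1 hX
    linarith
  -- All multiples of ⟪x, y⟫ cancel by the identity for γ; only the product with the bias survives.
  have hid : q * ((1 - β) ^ 2 * X + 2 * ((1 - β) * (γ * (xy + xr) - (1 - β) * xy)) + N)
      + (1 - q) * (X - 2 * xy + Y)
      = q * ((1 - β) ^ 2 * X) + (1 - q) * X + (1 - q) * Y
        + q * (1 - β) * γ * (2 * xr) + q * N := by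
    linear_combination (2 * xy) * hγ
  rw [hid]
  have hP0 : 0 ≤ 1 / q * (c * D) := by positivity
  linarith

/-- Average over the two cases: a sampled block has error (1 − β)x plus noise whose mean is γ(y + r)
− (1 − β)y, an unsampled one has error x − y. Here x is the old error, y the increment of g and r
the bias of the correction. `innerError_scalar` then does the bookkeeping. -/
theorem Problem.Assumptions.integral_innerError_le (hQ : Q.Assumptions Lf Cf Lg Cg σ)
    (hLg : 0 ≤ Lg) (hCg : 0 ≤ Cg) (hB₁ : 1 ≤ B₁) (hB₁m : B₁ ≤ m) (hB₂ : 1 ≤ B₂)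
    (hP : ∀ i, π.map (fun ξ => ξ i) = Q.P i) (e : InnerEstimator) {η β : ℝ}
    (hβ0 : 0 < β) (hβ : β ≤ 1 / 2) (hηβ : η ^ 2 ≤ β) (w w' : Euc d)
    (hw : ‖w' - w‖ ≤ η * (Cf * Cg)) (u : Fin m → Euc p) (i : Fin m) :
    (∀ s, Integrable (fun ξ => ‖updateU Q e B₁ β s ξ w w' u i - Q.g i w'‖ ^ 2) π) ∧
    ∫ y, ‖updateU Q e B₁ β y.1 y.2 w w' u i - Q.g i w'‖ ^ 2 ∂(noiseLaw B₁ π)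
      ≤ (1 - B₁ / m * β) * ‖u i - Q.g i w‖ ^ 2 + 3 * (B₁ / m) * β ^ 2 * (σ ^ 2 / B₂)
        + innerDrift Cf Lg Cg σ * (m / B₁) * ‖w' - w‖ ^ 2 := by
  have := hQ.isProbabilityMeasure i
  obtain ⟨hγ0, hγ2, hγ⟩ := gammaWeight_bounds hB₁ hB₁m hβ0.le hβ
  have hk : (0 : ℝ) < B₁ := by positivity
  have hkm : (B₁ : ℝ) ≤ m := by exact_mod_cast hB₁m
  have hm : (0 : ℝ) < m := hk.trans_le hkm
  have hnm := hQ.memLp_innerNoise e β (gammaWeight m B₁ β) w w' i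
  have hax : MemLp (fun b => (1 - β) • (u i - Q.g i w)
    + innerNoise Q e β (gammaWeight m B₁ β) w w' i b) 2 (Q.P i) := memLp_const_add hnm _
  have heq : ∀ q : Finset (Fin m) × (Fin m → Fin B₂ → S),
      ‖updateU Q e B₁ β q.1 q.2 w w' u i - Q.g i w'‖ ^ 2
        = if i ∈ q.1 then ‖(1 - β) • (u i - Q.g i w)
            + innerNoise Q e β (gammaWeight m B₁ β) w w' i (q.2 i)‖ ^ 2
          else ‖(u i - Q.g i w) - (Q.g i w' - Q.g i w)‖ ^ 2 := by
    intro q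
    unfold updateU innerNoise
    split_ifs
    · congr 2
      simp only [smul_sub, sub_smul, one_smul, neg_smul]
      abel
    · congr 2; abel
  have hφ := hax.integrable_norm_pow two_ne_zero
  refine ⟨fun s => ?_, ?_⟩
  · have h1 := integrable_ite_eval hP hφ (‖(u i - Q.g i w) - (Q.g i w' - Q.g i w)‖ ^ 2) s
    exact h1.congr (Filter.Eventually.of_forall fun ξ => (heq (s, ξ)).symm)
  rw [integral_congr_ae (Filter.Eventually.of_forall heq),
    integral_noiseLaw_ite hB₁m hP hφ, integral_norm_const_add_sq hnm, hQ.integral_innerNoise]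
  have hN := hQ.integral_innerNoise_sq_le hCg hB₂ e hβ0.le (by linarith) (gammaWeight m B₁ β) w w' i
  have hr := hQ.norm_integral_correction_sub_le hLg e i w w'
  have hyD := hQ.norm_inner_sub_sq_le w w' i
  generalize ∫ b, ‖innerNoise Q e β (gammaWeight m B₁ β) w w' i b‖ ^ 2 ∂(Q.P i) = N at hN ⊢
  generalize ∫ b, correction Q e i w w' b ∂(Q.P i) = μδ at hr ⊢
  generalize Q.g i w' - Q.g i w = y at hr hyD ⊢
  generalize u i - Q.g i w = x at ⊢
  generalize gammaWeight m B₁ β = γ at hγ0 hγ2 hγ hN ⊢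
  obtain ⟨r, rfl⟩ : ∃ r, μδ = y + r := ⟨μδ - y, by abel⟩
  rw [add_sub_cancel_left] at hr
  -- One factor ‖w' − w‖² of the quartic bias is traded for β(Cf Cg)², by the bound on the direction
  -- and η² ≤ β. This β compensates the 1/β of Young's inequality.
  have hrD : ‖r‖ ^ 2 ≤ Lg ^ 2 * (Cf * Cg) ^ 2 * β * ‖w' - w‖ ^ 2 := by
    have h2 : ‖w' - w‖ ^ 2 ≤ β * (Cf * Cg) ^ 2 := by
      calc ‖w' - w‖ ^ 2 ≤ (η * (Cf * Cg)) ^ 2 := pow_le_pow_left₀ (norm_nonneg _) hw 2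
        _ = η ^ 2 * (Cf * Cg) ^ 2 := by ring
        _ ≤ _ := by gcongr
    calc ‖r‖ ^ 2 ≤ (Lg * ‖w' - w‖ ^ 2) ^ 2 := pow_le_pow_left₀ (norm_nonneg _) hr 2
      _ = Lg ^ 2 * ‖w' - w‖ ^ 2 * ‖w' - w‖ ^ 2 := by ring
      _ ≤ Lg ^ 2 * (β * (Cf * Cg) ^ 2) * ‖w' - w‖ ^ 2 := by gcongr
      _ = _ := by ring
  have hq0 : (0 : ℝ) < B₁ / m := by positivity
  have hq1 : (B₁ / m : ℝ) ≤ 1 := (div_le_one hm).2 hkm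
  have hqinv : (m / B₁ : ℝ) = 1 / (B₁ / m) := by field_simp
  have hxr : Inner.inner ℝ x r ^ 2 ≤ ‖x‖ ^ 2 * ‖r‖ ^ 2 := by
    rw [← mul_pow, ← sq_abs]
    exact pow_le_pow_left₀ (abs_nonneg _) (abs_real_inner_le_norm x r) 2
  rw [hqinv] at hγ2 ⊢
  have key := innerError_scalar (xy := Inner.inner ℝ x y) hq0 hq1 hβ0 hβ hγ0 hγ2 hγ (sq_nonneg ‖x‖)
    (sq_nonneg ‖r‖) (sq_nonneg ‖w' - w‖) (jacobianBound_nonneg Cg σ) (sq_nonneg Cg) hxr hrD hyD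
    (sq_nonneg _) hN
  rw [norm_smul_sq, norm_sub_sq_real x y, real_inner_smul_left, inner_sub_right,
    real_inner_smul_right, real_inner_smul_right, inner_add_right]
  unfold innerDrift
  linarith

/-- An unsampled block does not move, so everything carries the factor q. The old error enters with
β² only, which later makes its contribution negligible against the contraction qβ. -/
theorem Problem.Assumptions.integral_innerMove_le (hQ : Q.Assumptions Lf Cf Lg Cg σ)
    (hCg : 0 ≤ Cg) (hB₁ : 1 ≤ B₁) (hB₁m : B₁ ≤ m) (hB₂ : 1 ≤ B₂)
    (hP : ∀ i, π.map (fun ξ => ξ i) = Q.P i) (e : InnerEstimator) {β : ℝ}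
    (hβ0 : 0 < β) (hβ : β ≤ 1 / 2) (w w' : Euc d) (u : Fin m → Euc p) (i : Fin m) :
    (∀ s, Integrable (fun ξ => ‖updateU Q e B₁ β s ξ w w' u i - u i‖ ^ 2) π) ∧
    ∫ y, ‖updateU Q e B₁ β y.1 y.2 w w' u i - u i‖ ^ 2 ∂(noiseLaw B₁ π)
      ≤ 4 * (B₁ / m) * β ^ 2 * ‖u i - Q.g i w‖ ^ 2 + 4 * (B₁ / m) * β ^ 2 * (σ ^ 2 / B₂)
        + innerMove Cg σ * (m / B₁) * ‖w' - w‖ ^ 2 := by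
  have := hQ.isProbabilityMeasure i
  obtain ⟨hγ0, hγ2, -⟩ := gammaWeight_bounds hB₁ hB₁m hβ0.le hβ
  have hk : (0 : ℝ) < B₁ := by positivity
  have hkm : (B₁ : ℝ) ≤ m := by exact_mod_cast hB₁m
  have hm : (0 : ℝ) < m := hk.trans_le hkm
  have hG := hQ.memLp_value_sub w' i
  have hδ := hQ.memLp_correction e i w w'
  have hyD := hQ.norm_inner_sub_sq_le w w' i
  have hV := (hQ.oracle i).variance_value w'
  have hC := hQ.integral_correction_sq_le hCg hB₂ e i w w'
  have hX : MemLp (fun b => β • (Q.G i w' b - u i)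
      + gammaWeight m B₁ β • correction Q e i w w' b) 2 (Q.P i) :=
    ((hG (u i)).const_smul β).add (hδ.const_smul (gammaWeight m B₁ β))
  have hφ := hX.integrable_norm_pow two_ne_zero
  have heq : ∀ q : Finset (Fin m) × (Fin m → Fin B₂ → S),
      ‖updateU Q e B₁ β q.1 q.2 w w' u i - u i‖ ^ 2
        = if i ∈ q.1 then ‖β • (Q.G i w' (q.2 i) - u i)
            + gammaWeight m B₁ β • correction Q e i w w' (q.2 i)‖ ^ 2 else 0 := by
    intro q
    unfold updateU
    split_ifs
    · congr 2
      simp only [smul_sub, sub_smul, one_smul]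
      abel
    · simp
  refine ⟨fun s => ?_, ?_⟩
  · exact (integrable_ite_eval hP hφ 0 s).congr
      (Filter.Eventually.of_forall fun ξ => (heq (s, ξ)).symm)
  rw [integral_congr_ae (Filter.Eventually.of_forall heq), integral_noiseLaw_ite hB₁m hP hφ,
    mul_zero, add_zero]
  generalize gammaWeight m B₁ β = γ at *
  have i1 := (((hG (Q.g i w')).integrable_norm_pow two_ne_zero).const_mul (β ^ 2))
  have i2 := ((hδ.integrable_norm_pow two_ne_zero).const_mul (γ ^ 2))
  have hle : ∫ b, ‖β • (Q.G i w' b - u i) + γ • correction Q e i w w' b‖ ^ 2 ∂(Q.P i)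
      ≤ 4 * (β ^ 2 * (σ ^ 2 / B₂) + γ ^ 2 * (jacobianBound Cg σ * ‖w' - w‖ ^ 2)
        + β ^ 2 * ‖Q.g i w' - Q.g i w‖ ^ 2 + β ^ 2 * ‖u i - Q.g i w‖ ^ 2) := by
    have i12 : Integrable (fun b => β ^ 2 * ‖Q.G i w' b - Q.g i w'‖ ^ 2
      + γ ^ 2 * ‖correction Q e i w w' b‖ ^ 2) (Q.P i) := i1.add i2
    have i3 := integrable_const (μ := Q.P i)
      (β ^ 2 * ‖Q.g i w' - Q.g i w‖ ^ 2 + β ^ 2 * ‖u i - Q.g i w‖ ^ 2)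
    calc _ ≤ ∫ b, 4 * (β ^ 2 * ‖Q.G i w' b - Q.g i w'‖ ^ 2
            + γ ^ 2 * ‖correction Q e i w w' b‖ ^ 2
            + (β ^ 2 * ‖Q.g i w' - Q.g i w‖ ^ 2 + β ^ 2 * ‖u i - Q.g i w‖ ^ 2)) ∂(Q.P i) := by
          refine integral_mono hφ ((i12.add i3).const_mul 4) fun b => ?_
          have he : β • (Q.G i w' b - u i) + γ • correction Q e i w w' b
              = β • (Q.G i w' b - Q.g i w') + γ • correction Q e i w w' b
                + β • (Q.g i w' - Q.g i w) + (-β) • (u i - Q.g i w) := by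
            simp only [smul_sub, neg_smul]; abel
          have h := norm_add_add_add_sq_le (β • (Q.G i w' b - Q.g i w'))
            (γ • correction Q e i w w' b) (β • (Q.g i w' - Q.g i w)) ((-β) • (u i - Q.g i w))
          rw [← he, norm_smul_sq β, norm_smul_sq γ, norm_smul_sq β, norm_smul_sq (-β), neg_sq] at h
          simp only
          linarith
      _ = 4 * (β ^ 2 * ∫ b, ‖Q.G i w' b - Q.g i w'‖ ^ 2 ∂(Q.P i)
            + γ ^ 2 * ∫ b, ‖correction Q e i w w' b‖ ^ 2 ∂(Q.P i)
            + (β ^ 2 * ‖Q.g i w' - Q.g i w‖ ^ 2 + β ^ 2 * ‖u i - Q.g i w‖ ^ 2)) := by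
          rw [integral_const_mul, integral_add i12 i3, integral_add i1 i2,
            integral_const_mul, integral_const_mul]
          simp
      _ ≤ _ := by
          have h1 := mul_le_mul_of_nonneg_left hV (sq_nonneg β)
          have h2 := mul_le_mul_of_nonneg_left hC (sq_nonneg γ)
          unfold jacobianBound
          linarith
  have hq0 : (0 : ℝ) < B₁ / m := by positivity
  have hq1 : (B₁ / m : ℝ) ≤ m / B₁ := by
    rw [div_le_div_iff₀ hm hk]; nlinarith
  refine (mul_le_mul_of_nonneg_left hle hq0.le).trans ?_
  have hJ := jacobianBound_nonneg Cg σ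
  have h1 : (B₁ / m : ℝ) * γ ^ 2 * (jacobianBound Cg σ * ‖w' - w‖ ^ 2)
      ≤ 4 * (m / B₁) * (jacobianBound Cg σ * ‖w' - w‖ ^ 2) := by gcongr
  have hβ2 : β ^ 2 ≤ 1 := by nlinarith
  have h2 : (B₁ / m : ℝ) * (β ^ 2 * ‖Q.g i w' - Q.g i w‖ ^ 2)
      ≤ m / B₁ * (1 * (Cg ^ 2 * ‖w' - w‖ ^ 2)) := by gcongr
  unfold innerMove
  linarith

end innerStep

/-! ### One step of the gradient estimator -/

section outerStep

variable {d p m B₁ B₂ : ℕ} {S : Type*} [MeasurableSpace S] {Q : Problem d p m B₂ S}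
  {Lf Cf Lg Cg σ : ℝ} {π : Measure (Fin m → Fin B₂ → S)}

/-- The stochastic gradient of one block, with the inner value replaced by `u`. -/
noncomputable def blockGrad (Q : Problem d p m B₂ S) (w : Euc d) (u : Fin m → Euc p) (i : Fin m)
    (b : Fin B₂ → S) : Euc d :=
  ContinuousLinearMap.adjoint (Q.J i w b) (gradient (Q.f i) (u i))

theorem norm_adjoint_apply_le {E F : Type*} [NormedAddCommGroup E] [InnerProductSpace ℝ E]
    [CompleteSpace E] [NormedAddCommGroup F] [InnerProductSpace ℝ F] [CompleteSpace F]
    (A : E →L[ℝ] F) (h : F) : ‖ContinuousLinearMap.adjoint A h‖ ≤ ‖A‖ * ‖h‖ := by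
  simpa using norm_adjoint_sub_le A 0 h 0

theorem memLp_adjoint_apply {T : Type*} [MeasurableSpace T] {P : Measure T}
    {A : T → Euc d →L[ℝ] Euc p} (hA : MemLp A 2 P) (h : Euc p) :
    MemLp (fun b => ContinuousLinearMap.adjoint (A b) h) 2 P := by
  refine hA.of_le_mul (c := ‖h‖) ?_ (Filter.Eventually.of_forall fun b => ?_)
  · have hc : Continuous fun A : Euc d →L[ℝ] Euc p => ContinuousLinearMap.adjoint A h :=
      (ContinuousLinearMap.apply ℝ (Euc d) h).continuous.comp
        ContinuousLinearMap.adjoint.continuous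
    exact hc.comp_aestronglyMeasurable hA.1
  · rw [mul_comm]; exact norm_adjoint_apply_le _ _

theorem integral_adjoint_apply {T : Type*} [MeasurableSpace T] {P : Measure T}
    [IsProbabilityMeasure P] {A : T → Euc d →L[ℝ] Euc p} (hA : MemLp A 2 P) (h : Euc p) :
    ∫ b, ContinuousLinearMap.adjoint (A b) h ∂P
      = ContinuousLinearMap.adjoint (∫ b, A b ∂P) h := by
  have hA1 := hA.integrable one_le_two
  refine ext_inner_left ℝ fun x => ?_
  rw [← integral_inner ((memLp_adjoint_apply hA h).integrable one_le_two),
    ContinuousLinearMap.adjoint_inner_right, ContinuousLinearMap.integral_apply hA1]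
  simp_rw [ContinuousLinearMap.adjoint_inner_right]
  rw [real_inner_comm, ← integral_inner (hA1.apply_continuousLinearMap x)]
  simp_rw [real_inner_comm]

theorem Problem.Assumptions.memLp_blockGrad (hQ : Q.Assumptions Lf Cf Lg Cg σ)
    (w : Euc d) (u : Fin m → Euc p) (i : Fin m) : MemLp (blockGrad Q w u i) 2 (Q.P i) :=
  memLp_adjoint_apply ((hQ.oracle i).memLp_jacobian w) _

theorem Problem.Assumptions.integral_blockGrad (hQ : Q.Assumptions Lf Cf Lg Cg σ)
    (w : Euc d) (u : Fin m → Euc p) (i : Fin m) : ∫ b, blockGrad Q w u i b ∂(Q.P i)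
      = ContinuousLinearMap.adjoint (fderiv ℝ (Q.g i) w) (gradient (Q.f i) (u i)) := by
  have := hQ.isProbabilityMeasure i
  unfold blockGrad
  rw [integral_adjoint_apply ((hQ.oracle i).memLp_jacobian w), (hQ.oracle i).unbiased_jacobian]

/-- At frozen w and u only the Jacobian is random, and it is applied to a vector of norm at most Cf.
-/
theorem Problem.Assumptions.integral_blockGrad_sub_mean_sq_le (hQ : Q.Assumptions Lf Cf Lg Cg σ)
    (hCf : 0 ≤ Cf) (w : Euc d) (u : Fin m → Euc p) (i : Fin m) :
    ∫ b, ‖blockGrad Q w u i b - ∫ c, blockGrad Q w u i c ∂(Q.P i)‖ ^ 2 ∂(Q.P i)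
      ≤ Cf ^ 2 * (σ ^ 2 / B₂) := by
  have := hQ.isProbabilityMeasure i
  have hJ : MemLp (fun b => Q.J i w b - fderiv ℝ (Q.g i) w) 2 (Q.P i) :=
    ((hQ.oracle i).memLp_jacobian w).sub (memLp_const _)
  have hd := ((hQ.memLp_blockGrad w u i).sub
    (memLp_const (∫ c, blockGrad Q w u i c ∂(Q.P i)))).integrable_norm_pow two_ne_zero
  calc _ ≤ ∫ b, Cf ^ 2 * ‖Q.J i w b - fderiv ℝ (Q.g i) w‖ ^ 2 ∂(Q.P i) := by
        refine integral_mono hd ((hJ.integrable_norm_pow two_ne_zero).const_mul _) fun b => ?_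
        simp only
        rw [hQ.integral_blockGrad, blockGrad, ← mul_pow, mul_comm]
        refine pow_le_pow_left₀ (norm_nonneg _) ?_ 2
        refine (norm_adjoint_sub_le _ _ _ _).trans ?_
        rw [sub_self, norm_zero, mul_zero, add_zero]
        gcongr
        exact (hQ.outer i).norm_gradient_le hCf _
    _ ≤ _ := by
        rw [integral_const_mul]
        gcongr
        exact (hQ.oracle i).variance_jacobian w

/-- The product difference is split so that the Jacobian increment meets the bounded gradient, and
the gradient increment meets one Jacobian at a fixed point. The latter is bounded only in mean
square, which suffices because the increment of u is frozen. -/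
theorem Problem.Assumptions.integral_blockGrad_sub_sq_le (hQ : Q.Assumptions Lf Cf Lg Cg σ)
    (hCf : 0 ≤ Cf) (hCg : 0 ≤ Cg) (hB₂ : 1 ≤ B₂)
    (w w' : Euc d) (u u' : Fin m → Euc p) (i : Fin m) :
    ∫ b, ‖blockGrad Q w' u i b - blockGrad Q w u' i b‖ ^ 2 ∂(Q.P i)
      ≤ 2 * Cf ^ 2 * Lg ^ 2 * ‖w' - w‖ ^ 2
        + 2 * Lf ^ 2 * jacobianBound Cg σ * ‖u i - u' i‖ ^ 2 := by
  have := hQ.isProbabilityMeasure i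
  have O := hQ.oracle i
  have hd := ((hQ.memLp_blockGrad w' u i).sub
    (hQ.memLp_blockGrad w u' i)).integrable_norm_pow two_ne_zero
  have hJ : MemLp (fun b => Q.J i w' b - Q.J i w b) 2 (Q.P i) :=
    (O.memLp_jacobian w').sub (O.memLp_jacobian w)
  have i1 : Integrable (fun b => 2 * Cf ^ 2 * ‖Q.J i w' b - Q.J i w b‖ ^ 2) (Q.P i) :=
    (hJ.integrable_norm_pow two_ne_zero).const_mul _
  have i2 : Integrable (fun b => 2 * Lf ^ 2 * ‖u i - u' i‖ ^ 2 * ‖Q.J i w b‖ ^ 2) (Q.P i) :=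
    ((O.memLp_jacobian w).integrable_norm_pow two_ne_zero).const_mul _
  calc _ ≤ ∫ b, (2 * Cf ^ 2 * ‖Q.J i w' b - Q.J i w b‖ ^ 2
          + 2 * Lf ^ 2 * ‖u i - u' i‖ ^ 2 * ‖Q.J i w b‖ ^ 2) ∂(Q.P i) := by
        refine integral_mono hd (i1.add i2) fun b => ?_
        simp only
        have h1 := norm_adjoint_sub_le (Q.J i w' b) (Q.J i w b) (gradient (Q.f i) (u i))
          (gradient (Q.f i) (u' i))
        have h2 : ‖Q.J i w' b - Q.J i w b‖ * ‖gradient (Q.f i) (u i)‖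
            ≤ ‖Q.J i w' b - Q.J i w b‖ * Cf := by
          gcongr; exact (hQ.outer i).norm_gradient_le hCf _
        have h3 : ‖Q.J i w b‖ * ‖gradient (Q.f i) (u i) - gradient (Q.f i) (u' i)‖
            ≤ ‖Q.J i w b‖ * (Lf * ‖u i - u' i‖) := by
          gcongr; exact (hQ.outer i).smooth _ _
        refine (pow_le_pow_left₀ (norm_nonneg _) (h1.trans (add_le_add h2 h3)) 2).trans ?_
        nlinarith [sq_nonneg (‖Q.J i w' b - Q.J i w b‖ * Cf - ‖Q.J i w b‖ * (Lf * ‖u i - u' i‖))]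
    _ = 2 * Cf ^ 2 * ∫ b, ‖Q.J i w' b - Q.J i w b‖ ^ 2 ∂(Q.P i)
          + 2 * Lf ^ 2 * ‖u i - u' i‖ ^ 2 * ∫ b, ‖Q.J i w b‖ ^ 2 ∂(Q.P i) := by
        rw [integral_add i1 i2, integral_const_mul, integral_const_mul]
    _ ≤ _ := by
        have h1 := mul_le_mul_of_nonneg_left (O.meanLipschitz_jacobian w' w)
          (by positivity : 0 ≤ 2 * Cf ^ 2)
        have h2 := mul_le_mul_of_nonneg_left (hQ.integral_jacobian_sq_le hCg hB₂ i w)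
          (by positivity : 0 ≤ 2 * Lf ^ 2 * ‖u i - u' i‖ ^ 2)
        unfold jacobianBound
        linarith

theorem aestronglyMeasurable_projBall_add {T : Type*} [MeasurableSpace T] {ν : Measure T}
    {X Y : T → Euc d} (hX : AEStronglyMeasurable X ν) (hY : AEStronglyMeasurable Y ν) (r a b : ℝ)
    (z : Euc d) : AEStronglyMeasurable (fun q => projBall r (z + a • X q + b • Y q)) ν := by
  have h : AEMeasurable (fun q => z + a • X q + b • Y q) ν :=
    ((hX.aemeasurable.const_smul a).const_add z).add (hY.aemeasurable.const_smul b)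
  exact ((measurable_projBall r).comp_aemeasurable h).aestronglyMeasurable

/-- The added noise has mean zero, so its cross term with a vanishes and the contraction of ‖a‖²
keeps constant 1. Only the two noises are separated crudely. -/
theorem memLp_combination_and_integral_le {T E : Type*} [MeasurableSpace T] [NormedAddCommGroup E]
    [InnerProductSpace ℝ E] [CompleteSpace E] {ν : Measure T} [IsProbabilityMeasure ν]
    {v δ : T → E} (hv : MemLp v 2 ν) (hδ : MemLp δ 2 ν) {vm δm : E} (hvm : ∫ q, v q ∂ν = vm)
    (hδm : ∫ q, δ q ∂ν = δm) {α : ℝ} (hα0 : 0 ≤ α) (hα1 : α ≤ 1) (a : E) :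
    Integrable (fun q => ‖a + (α • (v q - vm) + (1 - α) • (δ q - δm))‖ ^ 2) ν ∧
    ∫ q, ‖a + (α • (v q - vm) + (1 - α) • (δ q - δm))‖ ^ 2 ∂ν
      ≤ ‖a‖ ^ 2 + 2 * (α ^ 2 * ∫ q, ‖v q - vm‖ ^ 2 ∂ν) + 2 * ∫ q, ‖δ q - δm‖ ^ 2 ∂ν := by
  have hvc : MemLp (fun q => v q - vm) 2 ν := hv.sub (memLp_const _)
  have hδc : MemLp (fun q => δ q - δm) 2 ν := hδ.sub (memLp_const _)
  have hvα : MemLp (fun q => α • (v q - vm)) 2 ν := hvc.const_smul α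
  have hδα : MemLp (fun q => (1 - α) • (δ q - δm)) 2 ν := hδc.const_smul (1 - α)
  have hN : MemLp (fun q => α • (v q - vm) + (1 - α) • (δ q - δm)) 2 ν := hvα.add hδα
  have hN0 : ∫ q, (α • (v q - vm) + (1 - α) • (δ q - δm)) ∂ν = 0 := by
    rw [integral_add (hvα.integrable one_le_two) (hδα.integrable one_le_two), integral_smul,
      integral_smul, integral_sub (hv.integrable one_le_two) (integrable_const _),
      integral_sub (hδ.integrable one_le_two) (integrable_const _), hvm, hδm]
    simp
  have i1 : Integrable (fun q => 2 * (α ^ 2 * ‖v q - vm‖ ^ 2)) ν :=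
    ((hvc.integrable_norm_pow two_ne_zero).const_mul (α ^ 2)).const_mul 2
  have i2 : Integrable (fun q => 2 * ‖δ q - δm‖ ^ 2) ν :=
    (hδc.integrable_norm_pow two_ne_zero).const_mul 2
  have hNsq : ∫ q, ‖α • (v q - vm) + (1 - α) • (δ q - δm)‖ ^ 2 ∂ν
      ≤ 2 * (α ^ 2 * ∫ q, ‖v q - vm‖ ^ 2 ∂ν) + 2 * ∫ q, ‖δ q - δm‖ ^ 2 ∂ν := by
    rw [← integral_const_mul, ← integral_const_mul, ← integral_const_mul, ← integral_add i1 i2]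
    refine integral_mono (hN.integrable_norm_pow two_ne_zero) (i1.add i2) fun q => ?_
    refine (norm_add_sq_le _ _).trans ?_
    rw [norm_smul_sq, norm_smul_sq]
    have h1 : (1 - α) ^ 2 ≤ 1 := by nlinarith
    have h2 := mul_le_mul_of_nonneg_right h1 (sq_nonneg ‖δ q - δm‖)
    linarith
  refine ⟨(memLp_const_add hN a).integrable_norm_pow two_ne_zero, ?_⟩
  rw [integral_norm_const_add_sq hN, hN0, inner_zero_right, mul_zero, add_zero]
  linarith


/-- Noise factor in the recursion for the error of the gradient estimator. -/
noncomputable def outerNoise (Cf Cg σ : ℝ) : ℝ := 2 * Cf ^ 2 * σ ^ 2 + 2 * (Cf * Cg) ^ 2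

/-- Displacement factor in the recursion for the error of the gradient estimator. -/
noncomputable def outerDrift (Cf Lg : ℝ) : ℝ := 4 * Cf ^ 2 * Lg ^ 2

/-- Factor of the movement of the inner estimators in the same recursion. -/
noncomputable def outerMove (Lf Cg σ : ℝ) : ℝ := 4 * Lf ^ 2 * jacobianBound Cg σ

/-- Before projection the new error is (1 − α) times the old one plus α times the centred minibatch
gradient plus 1 − α times the centred gradient difference. This requires comparing z with the
formula at the inner estimates used in the minibatch, one step behind. The centred difference is
bounded by its full second moment, hence by the displacement and the inner increment. -/
theorem Problem.Assumptions.integral_outerError_le [IsProbabilityMeasure π]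
    (hQ : Q.Assumptions Lf Cf Lg Cg σ)
    (hCf : 0 ≤ Cf) (hCg : 0 ≤ Cg) (hB₁ : 1 ≤ B₁) (hB₁m : B₁ ≤ m)
    (hB₂ : 1 ≤ B₂) (hP : ∀ i, π.map (fun ξ => ξ i) = Q.P i) {α : ℝ} (hα0 : 0 ≤ α) (hα1 : α ≤ 1)
    (w w' : Euc d) (u u' : Fin m → Euc p) (z : Euc d) :
    (∀ s, Integrable (fun ξ =>
      ‖updateZ Q B₁ (Cf * Cg) α s ξ w w' u u' z - fullGrad Q w' u‖ ^ 2) π) ∧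
    ∫ y, ‖updateZ Q B₁ (Cf * Cg) α y.1 y.2 w w' u u' z - fullGrad Q w' u‖ ^ 2 ∂(noiseLaw B₁ π)
      ≤ (1 - α) * ‖z - fullGrad Q w u'‖ ^ 2
        + 2 * α ^ 2 * (outerNoise Cf Cg σ * (1 / B₁ + 1 / B₂))
        + outerDrift Cf Lg * ‖w' - w‖ ^ 2
        + outerMove Lf Cg σ * (1 / m * ∑ i, ‖u i - u' i‖ ^ 2) := by
  have hPr := hQ.isProbabilityMeasure
  have hm0 : 0 < m := hB₁.trans hB₁m
  have hm : (0 : ℝ) < m := by exact_mod_cast hm0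
  have hR : 0 ≤ Cf * Cg := mul_nonneg hCf hCg
  have hρ := isProbabilityMeasure_blockLaw hB₁m
  have hφ := fun i => hQ.memLp_blockGrad w' u i
  have hφ' := fun i => hQ.memLp_blockGrad w u' i
  have hψ : ∀ i, MemLp (fun b => blockGrad Q w' u i b - blockGrad Q w u' i b) 2 (Q.P i) :=
    fun i => (hφ i).sub (hφ' i)
  have hv := memLp_noiseLaw_average (k := B₁) (π := π) hB₁m hP hφ
  have hδ := memLp_noiseLaw_average (k := B₁) (π := π) hB₁m hP hψ
  have hvm : ∫ q, (1 / (B₁ : ℝ)) • ∑ i ∈ q.1, blockGrad Q w' u i (q.2 i) ∂(noiseLaw B₁ π)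
      = fullGrad Q w' u := by
    rw [integral_noiseLaw_average hB₁ hB₁m hP fun i => (hφ i).integrable one_le_two]
    simp_rw [hQ.integral_blockGrad]; rfl
  have hδm : ∫ q, (1 / (B₁ : ℝ)) • ∑ i ∈ q.1,
      (blockGrad Q w' u i (q.2 i) - blockGrad Q w u' i (q.2 i)) ∂(noiseLaw B₁ π)
      = fullGrad Q w' u - fullGrad Q w u' := by
    rw [integral_noiseLaw_average hB₁ hB₁m hP
      (φ := fun i b => blockGrad Q w' u i b - blockGrad Q w u' i b)
      fun i => (hψ i).integrable one_le_two]
    simp_rw [fun i => integral_sub ((hφ i).integrable one_le_two)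
      ((hφ' i).integrable one_le_two), hQ.integral_blockGrad]
    rw [Finset.sum_sub_distrib, smul_sub]; rfl
  have hbatch : ∀ q : Finset (Fin m) × (Fin m → Fin B₂ → S),
      updateZ Q B₁ (Cf * Cg) α q.1 q.2 w w' u u' z = projBall (Cf * Cg) ((1 - α) • z
        + α • ((1 / (B₁ : ℝ)) • ∑ i ∈ q.1, blockGrad Q w' u i (q.2 i))
        + (1 - α) • ((1 / (B₁ : ℝ)) • ∑ i ∈ q.1,
          (blockGrad Q w' u i (q.2 i) - blockGrad Q w u' i (q.2 i)))) := by
    intro q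
    rw [Finset.sum_sub_distrib, smul_sub]; rfl
  have hvar := integral_noiseLaw_variance_le (k := B₁) (π := π) hB₁ hB₁m hP hφ
    (V := Cf ^ 2 * (σ ^ 2 / B₂)) (M := (Cf * Cg) ^ 2)
    (fun i => hQ.integral_blockGrad_sub_mean_sq_le hCf w' u i) (fun i => by
      rw [hQ.integral_blockGrad]
      refine pow_le_pow_left₀ (norm_nonneg _) ((norm_adjoint_apply_le _ _).trans ?_) 2
      rw [mul_comm]
      exact mul_le_mul ((hQ.outer i).norm_gradient_le hCf _) ((hQ.inner i).norm_fderiv_le hCg _)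
        (norm_nonneg _) hCf)
  have hdiff := integral_norm_sub_mean_sq_le hδ
  have hdiff2 := integral_noiseLaw_average_sq_le (k := B₁) (π := π) hB₁ hB₁m hP hψ
  rw [hδm] at hdiff
  replace hdiff := hdiff.trans hdiff2
  rw [← integral_noiseLaw_average hB₁ hB₁m hP fun i => (hφ i).integrable one_le_two, hvm] at hvar
  have hG' := hQ.norm_fullGrad_le hm0 hCf hCg w' u
  have hsec : ∀ s : Finset (Fin m), AEStronglyMeasurable (fun ξ =>
      updateZ Q B₁ (Cf * Cg) α s ξ w w' u u' z) π := by
    intro s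
    simp_rw [fun ξ => hbatch (s, ξ)]
    have h1 := (memLp_average (k := B₁) (π := π) hP hφ s).1
    have h2 := (memLp_average (k := B₁) (π := π) hP hψ s).1
    exact aestronglyMeasurable_projBall_add h1 h2 _ _ _ _
  have hint : ∀ s : Finset (Fin m), Integrable (fun ξ =>
      ‖updateZ Q B₁ (Cf * Cg) α s ξ w w' u u' z - fullGrad Q w' u‖ ^ 2) π := by
    intro s
    refine Integrable.of_bound
      (((hsec s).sub aestronglyMeasurable_const).norm.pow 2) ((2 * (Cf * Cg)) ^ 2)
      (Filter.Eventually.of_forall fun ξ => ?_)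
    rw [Real.norm_eq_abs, abs_of_nonneg (sq_nonneg _)]
    refine pow_le_pow_left₀ (norm_nonneg _) ((norm_sub_le _ _).trans ?_) 2
    have : ‖updateZ Q B₁ (Cf * Cg) α s ξ w w' u u' z‖ ≤ Cf * Cg := norm_projBall_le hR _
    linarith
  refine ⟨hint, ?_⟩
  obtain ⟨hAi, hA⟩ := memLp_combination_and_integral_le hv hδ hvm hδm hα0 hα1
    ((1 - α) • (z - fullGrad Q w u'))
  rw [norm_smul_sq] at hA
  have hle := integral_mono (integrable_noiseLaw (h := fun y =>
    ‖updateZ Q B₁ (Cf * Cg) α y.1 y.2 w w' u u' z - fullGrad Q w' u‖ ^ 2) hB₁m hint) hAi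
    fun q => by
      refine pow_le_pow_left₀ (norm_nonneg _) ?_ 2
      rw [hbatch]
      refine (norm_projBall_sub_le hR _ _ hG').trans (le_of_eq ?_)
      congr 1
      module
  have hα2 : (1 - α) ^ 2 * ‖z - fullGrad Q w u'‖ ^ 2 ≤ (1 - α) * ‖z - fullGrad Q w u'‖ ^ 2 := by
    gcongr; nlinarith
  have hsum : 1 / (m : ℝ) * ∑ i, ∫ b, ‖blockGrad Q w' u i b - blockGrad Q w u' i b‖ ^ 2 ∂(Q.P i)
      ≤ 2 * Cf ^ 2 * Lg ^ 2 * ‖w' - w‖ ^ 2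
        + 2 * Lf ^ 2 * jacobianBound Cg σ * (1 / m * ∑ i, ‖u i - u' i‖ ^ 2) := by
    calc _ ≤ 1 / (m : ℝ) * ∑ i : Fin m, (2 * Cf ^ 2 * Lg ^ 2 * ‖w' - w‖ ^ 2
          + 2 * Lf ^ 2 * jacobianBound Cg σ * ‖u i - u' i‖ ^ 2) := by
          gcongr with i
          exact hQ.integral_blockGrad_sub_sq_le hCf hCg hB₂ w w' u u' i
      _ = _ := by
          rw [Finset.sum_add_distrib, Finset.sum_const, Finset.card_univ, Fintype.card_fin,
            nsmul_eq_mul, ← Finset.mul_sum, mul_add, ← mul_assoc (1 / (m : ℝ)) (m : ℝ),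
            one_div_mul_cancel hm.ne', one_mul]
          ring
  have hvar2 : 2 * (Cf ^ 2 * (σ ^ 2 / B₂)) + 2 * (1 / B₁ * (Cf * Cg) ^ 2)
      ≤ outerNoise Cf Cg σ * (1 / B₁ + 1 / B₂) := by
    unfold outerNoise
    have h1 : 0 ≤ Cf ^ 2 * σ ^ 2 * (1 / (B₁ : ℝ)) := by positivity
    have h2 : 0 ≤ (Cf * Cg) ^ 2 * (1 / (B₂ : ℝ)) := by positivity
    have h3 : Cf ^ 2 * (σ ^ 2 / B₂) = Cf ^ 2 * σ ^ 2 * (1 / (B₂ : ℝ)) := by ring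
    rw [h3]; linarith
  have hvar3 := mul_le_mul_of_nonneg_left (hvar.trans hvar2) (sq_nonneg α)
  unfold outerDrift outerMove
  linarith

end outerStep

/-! ### Measurability of the updates -/

section measurability

variable {d p m B₁ B₂ : ℕ} {S : Type*} [MeasurableSpace S] {Q : Problem d p m B₂ S}
  {Lf Cf Lg Cg σ : ℝ} {A : Type*} {mA : MeasurableSpace A}

theorem measurableSet_mem_block {X : A → Finset (Fin m)} (hX : Measurable X) (i : Fin m) :
    MeasurableSet {a | i ∈ X a} :=
  hX (MeasurableSet.of_discrete (s := {s : Finset (Fin m) | i ∈ s}))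

theorem Problem.Assumptions.measurable_value (hQ : Q.Assumptions Lf Cf Lg Cg σ) {w : A → Euc d}
    {ξ : A → Fin m → Fin B₂ → S} (hw : Measurable w) (hξ : Measurable ξ) (i : Fin m) :
    Measurable fun a => Q.G i (w a) (ξ a i) :=
  (hQ.oracle i).measurable_value.comp (hw.prodMk ((measurable_pi_apply i).comp hξ))

theorem Problem.Assumptions.measurable_jacobian (hQ : Q.Assumptions Lf Cf Lg Cg σ)
    {w : A → Euc d} {ξ : A → Fin m → Fin B₂ → S} (hw : Measurable w) (hξ : Measurable ξ)
    (i : Fin m) : Measurable fun a => Q.J i (w a) (ξ a i) :=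
  (hQ.oracle i).measurable_jacobian.comp (hw.prodMk ((measurable_pi_apply i).comp hξ))

theorem measurable_clm_apply {n k : ℕ} {L : A → Euc n →L[ℝ] Euc k} {x : A → Euc n}
    (hL : Measurable L) (hx : Measurable x) : Measurable fun a => L a (x a) :=
  ContinuousLinearMap.measurable_apply₂.comp (hL.prodMk hx)

theorem Problem.Assumptions.measurable_updateU (hQ : Q.Assumptions Lf Cf Lg Cg σ)
    (e : InnerEstimator) (β : ℝ) {X : A → Finset (Fin m)} {ξ : A → Fin m → Fin B₂ → S}
    {w w' : A → Euc d} {u : A → Fin m → Euc p} (hX : Measurable X) (hξ : Measurable ξ)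
    (hw : Measurable w) (hw' : Measurable w') (hu : Measurable u) :
    Measurable fun a => updateU Q e B₁ β (X a) (ξ a) (w a) (w' a) (u a) := by
  rw [measurable_pi_iff]
  intro i
  have hui : Measurable fun a => u a i := (measurable_pi_apply i).comp hu
  have hc : Measurable fun a => correction Q e i (w a) (w' a) (ξ a i) := by
    cases e
    · exact (hQ.measurable_value hw' hξ i).sub (hQ.measurable_value hw hξ i)
    · exact measurable_clm_apply (hQ.measurable_jacobian hw' hξ i) (hw'.sub hw)
  refine Measurable.ite (measurableSet_mem_block hX i) ?_ hui
  exact ((hui.const_smul (1 - β)).add ((hQ.measurable_value hw' hξ i).const_smul β)).add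
    (hc.const_smul (gammaWeight m B₁ β))

theorem Problem.Assumptions.measurable_gradient (hQ : Q.Assumptions Lf Cf Lg Cg σ) (hLf : 0 ≤ Lf)
    {u : A → Fin m → Euc p} (hu : Measurable u) (i : Fin m) :
    Measurable fun a => gradient (Q.f i) (u a i) :=
  ((hQ.outer i).continuous_gradient hLf).measurable.comp ((measurable_pi_apply i).comp hu)

theorem measurable_adjoint {L : A → Euc d →L[ℝ] Euc p} (hL : Measurable L) :
    Measurable fun a => ContinuousLinearMap.adjoint (L a) :=
  ContinuousLinearMap.adjoint.continuous.measurable.comp hL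

theorem Problem.Assumptions.measurable_batchGrad (hQ : Q.Assumptions Lf Cf Lg Cg σ)
    (hLf : 0 ≤ Lf) {X : A → Finset (Fin m)} {ξ : A → Fin m → Fin B₂ → S}
    {w : A → Euc d} {u : A → Fin m → Euc p} (hX : Measurable X) (hξ : Measurable ξ)
    (hw : Measurable w) (hu : Measurable u) :
    Measurable fun a => batchGrad Q B₁ (X a) (ξ a) (w a) (u a) := by
  have h : ∀ a, batchGrad Q B₁ (X a) (ξ a) (w a) (u a) = (1 / (B₁ : ℝ)) • ∑ i,
      if i ∈ X a then
        ContinuousLinearMap.adjoint (Q.J i (w a) (ξ a i)) (gradient (Q.f i) (u a i)) else 0 := by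
    intro a
    rw [batchGrad, Finset.sum_ite_mem, Finset.univ_inter]
  simp_rw [h]
  suffices hs : ∀ i ∈ Finset.univ, Measurable fun a => if i ∈ X a then
      ContinuousLinearMap.adjoint (Q.J i (w a) (ξ a i)) (gradient (Q.f i) (u a i)) else 0 from
    (Finset.measurable_fun_sum _ hs).const_smul (1 / (B₁ : ℝ))
  intro i _
  exact Measurable.ite (measurableSet_mem_block hX i)
    (measurable_clm_apply (measurable_adjoint (hQ.measurable_jacobian hw hξ i))
      (hQ.measurable_gradient hLf hu i)) measurable_const

theorem Problem.Assumptions.measurable_updateZ (hQ : Q.Assumptions Lf Cf Lg Cg σ)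
    (hLf : 0 ≤ Lf) (r α : ℝ) {X : A → Finset (Fin m)} {ξ : A → Fin m → Fin B₂ → S}
    {w w' z : A → Euc d} {u u' : A → Fin m → Euc p} (hX : Measurable X) (hξ : Measurable ξ)
    (hw : Measurable w) (hw' : Measurable w') (hu : Measurable u) (hu' : Measurable u')
    (hz : Measurable z) :
    Measurable fun a => updateZ Q B₁ r α (X a) (ξ a) (w a) (w' a) (u a) (u' a) (z a) := by
  have h1 := hQ.measurable_batchGrad (B₁ := B₁) hLf hX hξ hw' hu
  have h2 := hQ.measurable_batchGrad (B₁ := B₁) hLf hX hξ hw hu'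
  exact (measurable_projBall r).comp
    (((hz.const_smul (1 - α)).add (h1.const_smul α)).add ((h1.sub h2).const_smul (1 - α)))

theorem Problem.Assumptions.measurable_fullGrad (hQ : Q.Assumptions Lf Cf Lg Cg σ)
    (hLf : 0 ≤ Lf) (hLg : 0 ≤ Lg) {w : A → Euc d} {u : A → Fin m → Euc p} (hw : Measurable w)
    (hu : Measurable u) : Measurable fun a => fullGrad Q (w a) (u a) := by
  suffices hs : ∀ i ∈ Finset.univ, Measurable fun a =>
      ContinuousLinearMap.adjoint (fderiv ℝ (Q.g i) (w a)) (gradient (Q.f i) (u a i)) from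
    (Finset.measurable_fun_sum _ hs).const_smul (1 / (m : ℝ))
  intro i _
  exact measurable_clm_apply
    (measurable_adjoint (((hQ.inner i).continuous_fderiv hLg).measurable.comp hw))
    (hQ.measurable_gradient hLf hu i)

theorem Problem.Assumptions.measurable_innerMap (hQ : Q.Assumptions Lf Cf Lg Cg σ)
    {w : A → Euc d} (hw : Measurable w) (i : Fin m) : Measurable fun a => Q.g i (w a) :=
  (hQ.inner i).differentiable.continuous.measurable.comp hw

end measurability

/-! ### The trajectory and conditioning on the past -/

section process

variable {d p m B₁ B₂ : ℕ} {S : Type*} [MeasurableSpace S] {Ω : Type*}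

/-- The state of the method at time `t`, as a random variable. -/
noncomputable def process (Q : Problem d p m B₂ S) (e : InnerEstimator) (B₁ : ℕ) (r : ℝ)
    (η α β : ℕ → ℝ) (B : ℕ → Ω → Finset (Fin m)) (ξ : ℕ → Ω → Fin m → Fin B₂ → S)
    (w₁ : Euc d) (u₁ : Ω → Fin m → Euc p) (z₁ : Ω → Euc d) (t : ℕ) (ω : Ω) : State d p m :=
  run Q e B₁ r η α β (fun k => B k ω) (fun k => ξ k ω) w₁ (u₁ ω) (z₁ ω) t

theorem process_succ (Q : Problem d p m B₂ S) (e : InnerEstimator) (r : ℝ) (η α β : ℕ → ℝ)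
    (B : ℕ → Ω → Finset (Fin m)) (ξ : ℕ → Ω → Fin m → Fin B₂ → S) (w₁ : Euc d)
    (u₁ : Ω → Fin m → Euc p) (z₁ : Ω → Euc d) {t : ℕ} (ht : 1 ≤ t) (ω : Ω) :
    process Q e B₁ r η α β B ξ w₁ u₁ z₁ (t + 1) ω
      = step Q e B₁ r (η t) (α (t + 1)) (β (t + 1)) (B (t + 1) ω) (ξ (t + 1) ω)
        (process Q e B₁ r η α β B ξ w₁ u₁ z₁ t ω) := by
  obtain ⟨s, rfl⟩ := Nat.exists_eq_add_of_le' ht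
  rfl

variable [mΩ : MeasurableSpace Ω]

/-- All standing assumptions: on the problem, on the randomness, on the start and on the batch
sizes. -/
structure Setting (Q : Problem d p m B₂ S) (Lf Cf Lg Cg σ Δ D : ℝ) (B₁ : ℕ) (μ : Measure Ω)
    (ℱ : Filtration ℕ mΩ) (B : ℕ → Ω → Finset (Fin m)) (ξ : ℕ → Ω → Fin m → Fin B₂ → S)
    (w₁ : Euc d) (u₁ : Ω → Fin m → Euc p) (z₁ : Ω → Euc d) : Prop where
  hLf : 0 ≤ Lf
  hCf : 0 ≤ Cf
  hLg : 0 ≤ Lg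
  hCg : 0 ≤ Cg
  hB₁ : 1 ≤ B₁
  hB₁m : B₁ ≤ m
  hB₂ : 1 ≤ B₂
  problem : Q.Assumptions Lf Cf Lg Cg σ
  sampling : Sampling Q B₁ μ ℱ B ξ
  init : Initialization Q μ ℱ (Cf * Cg) Δ D w₁ u₁ z₁

/-- The parameter ranges in which one step of the method is analysed. -/
structure StepRange (η α β : ℕ → ℝ) : Prop where
  η_pos : ∀ t, 1 ≤ t → 0 < η t
  α_nonneg : ∀ t, 1 ≤ t → 0 ≤ α (t + 1)
  α_le : ∀ t, 1 ≤ t → α (t + 1) ≤ 1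
  β_pos : ∀ t, 1 ≤ t → 0 < β (t + 1)
  β_le : ∀ t, 1 ≤ t → β (t + 1) ≤ 1 / 2
  sq_le : ∀ t, 1 ≤ t → η t ^ 2 ≤ β (t + 1)

variable {Q : Problem d p m B₂ S} {Lf Cf Lg Cg σ Δ D : ℝ} {μ : Measure Ω}
  {ℱ : Filtration ℕ mΩ} {B : ℕ → Ω → Finset (Fin m)} {ξ : ℕ → Ω → Fin m → Fin B₂ → S}
  {w₁ : Euc d} {u₁ : Ω → Fin m → Euc p} {z₁ : Ω → Euc d}

namespace Setting

theorem measurable_blocks (h : Setting Q Lf Cf Lg Cg σ Δ D B₁ μ ℱ B ξ w₁ u₁ z₁) {t : ℕ}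
    (ht : 2 ≤ t) : Measurable[ℱ t] (B t) :=
  measurable_fst.comp (h.sampling.adapted t ht)

theorem measurable_batches (h : Setting Q Lf Cf Lg Cg σ Δ D B₁ μ ℱ B ξ w₁ u₁ z₁) {t : ℕ}
    (ht : 2 ≤ t) : Measurable[ℱ t] (ξ t) :=
  measurable_snd.comp (h.sampling.adapted t ht)

/-- The state at time t uses draws up to time t only, so it is independent of the blocks and batches
at time t + 1. -/
theorem measurable_process (h : Setting Q Lf Cf Lg Cg σ Δ D B₁ μ ℱ B ξ w₁ u₁ z₁)
    (e : InnerEstimator) (η α β : ℕ → ℝ) {t : ℕ} (ht : 1 ≤ t) :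
    Measurable[ℱ t] (fun ω => (process Q e B₁ (Cf * Cg) η α β B ξ w₁ u₁ z₁ t ω).w) ∧
    Measurable[ℱ t] (fun ω => (process Q e B₁ (Cf * Cg) η α β B ξ w₁ u₁ z₁ t ω).u) ∧
    Measurable[ℱ t] (fun ω => (process Q e B₁ (Cf * Cg) η α β B ξ w₁ u₁ z₁ t ω).uPrev) ∧
    Measurable[ℱ t] (fun ω => (process Q e B₁ (Cf * Cg) η α β B ξ w₁ u₁ z₁ t ω).z) := by
  induction t, ht using Nat.le_induction with
  | base =>
    exact ⟨measurable_const, h.init.measurable_u, h.init.measurable_u, h.init.measurable_z⟩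
  | succ t ht ih =>
    obtain ⟨hw, hu, hu', hz⟩ := ih
    have hle : ℱ t ≤ ℱ (t + 1) := ℱ.mono (Nat.le_succ t)
    replace hw := hw.mono hle le_rfl
    replace hu := hu.mono hle le_rfl
    replace hu' := hu'.mono hle le_rfl
    replace hz := hz.mono hle le_rfl
    have hB := h.measurable_blocks (t := t + 1) (by omega)
    have hξ := h.measurable_batches (t := t + 1) (by omega)
    simp_rw [process_succ Q e _ η α β B ξ w₁ u₁ z₁ ht]
    have hw' := hw.sub (hz.const_smul (η t))
    exact ⟨hw', h.problem.measurable_updateU e _ hB hξ hw hw' hu, hu,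
      h.problem.measurable_updateZ h.hLf _ _ hB hξ hw hw' hu hu' hz⟩

theorem norm_z_le (h : Setting Q Lf Cf Lg Cg σ Δ D B₁ μ ℱ B ξ w₁ u₁ z₁)
    (e : InnerEstimator) (η α β : ℕ → ℝ) {t : ℕ} (ht : 1 ≤ t) (ω : Ω) :
    ‖(process Q e B₁ (Cf * Cg) η α β B ξ w₁ u₁ z₁ t ω).z‖ ≤ Cf * Cg := by
  induction t, ht using Nat.le_induction with
  | base => exact h.init.norm_z ω
  | succ t ht ih =>
    rw [process_succ Q e _ η α β B ξ w₁ u₁ z₁ ht]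
    exact norm_projBall_le (mul_nonneg h.hCf h.hCg) _

theorem map_batches_eval [IsProbabilityMeasure μ]
    (h : Setting Q Lf Cf Lg Cg σ Δ D B₁ μ ℱ B ξ w₁ u₁ z₁) {t : ℕ} (ht : 2 ≤ t) (i : Fin m) :
    (μ.map (ξ t)).map (fun x => x i) = Q.P i := by
  rw [Measure.map_map (measurable_pi_apply i) ((h.measurable_batches ht).mono (ℱ.le t) le_rfl)]
  exact h.sampling.law_batch t ht i

theorem map_noise [IsProbabilityMeasure μ]
    (h : Setting Q Lf Cf Lg Cg σ Δ D B₁ μ ℱ B ξ w₁ u₁ z₁) {t : ℕ} (ht : 2 ≤ t) :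
    μ.map (fun ω => (B t ω, ξ t ω)) = noiseLaw B₁ (μ.map (ξ t)) := by
  rw [(indepFun_iff_map_prod_eq_prod_map_map
    ((h.measurable_blocks ht).mono (ℱ.le t) le_rfl).aemeasurable
    ((h.measurable_batches ht).mono (ℱ.le t) le_rfl).aemeasurable).1
    (h.sampling.indep_blocks t ht), h.sampling.law_blocks t ht]

theorem isProbabilityMeasure_batches [IsProbabilityMeasure μ]
    (h : Setting Q Lf Cf Lg Cg σ Δ D B₁ μ ℱ B ξ w₁ u₁ z₁) {t : ℕ} (ht : 2 ≤ t) :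
    IsProbabilityMeasure (μ.map (ξ t)) :=
  Measure.isProbabilityMeasure_map ((h.measurable_batches ht).mono (ℱ.le t) le_rfl).aemeasurable

/-- Conditioning on the past: a bound for the expectation over fresh blocks and batches at every
fixed state gives a bound for the expectation over everything. -/
theorem integrable_and_integral_le [IsProbabilityMeasure μ]
    (h : Setting Q Lf Cf Lg Cg σ Δ D B₁ μ ℱ B ξ w₁ u₁ z₁) {t : ℕ} (ht : 1 ≤ t)
    {E : Type*} [MeasurableSpace E] {X : Ω → E} (hX : Measurable[ℱ t] X)
    {φ : E × (Finset (Fin m) × (Fin m → Fin B₂ → S)) → ℝ} (hφ : Measurable φ)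
    (h0 : ∀ q, 0 ≤ φ q) {b : Ω → ℝ} (hb : Integrable b μ)
    (hle : ∀ ω, (∀ s, Integrable (fun x => φ (X ω, (s, x))) (μ.map (ξ (t + 1)))) ∧
      ∫ y, φ (X ω, y) ∂(noiseLaw B₁ (μ.map (ξ (t + 1)))) ≤ b ω) :
    Integrable (fun ω => φ (X ω, (B (t + 1) ω, ξ (t + 1) ω))) μ ∧
      ∫ ω, φ (X ω, (B (t + 1) ω, ξ (t + 1) ω)) ∂μ ≤ ∫ ω, b ω ∂μ := by
  have ht2 : 2 ≤ t + 1 := by omega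
  have := h.isProbabilityMeasure_batches ht2
  have hN : Measurable fun ω => (B (t + 1) ω, ξ (t + 1) ω) :=
    (h.sampling.adapted (t + 1) ht2).mono (ℱ.le _) le_rfl
  have hind : IndepFun X (fun ω => (B (t + 1) ω, ξ (t + 1) ω)) μ := by
    rw [IndepFun_iff_Indep]
    refine indep_of_indep_of_le_left (h.sampling.indep_past (t + 1) ht2).symm ?_
    exact hX.comap_le
  refine integrable_and_integral_le_of_indepFun (hX.mono (ℱ.le t) le_rfl) hN hind hφ h0 hb ?_
  intro ω
  rw [h.map_noise ht2]
  exact ⟨integrable_noiseLaw h.hB₁m (hle ω).1, (hle ω).2⟩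

end Setting

end process

/-! ### Error recursions in expectation -/

namespace Setting

variable {d p m B₁ B₂ : ℕ} {S : Type*} [MeasurableSpace S] {Ω : Type*} [mΩ : MeasurableSpace Ω]
  {Q : Problem d p m B₂ S} {Lf Cf Lg Cg σ Δ D : ℝ} {μ : Measure Ω}
  {ℱ : Filtration ℕ mΩ} {B : ℕ → Ω → Finset (Fin m)} {ξ : ℕ → Ω → Fin m → Fin B₂ → S}
  {w₁ : Euc d} {u₁ : Ω → Fin m → Euc p} {z₁ : Ω → Euc d}

/-- The random trajectory of the method in a given setting. -/
noncomputable def traj (_h : Setting Q Lf Cf Lg Cg σ Δ D B₁ μ ℱ B ξ w₁ u₁ z₁)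
    (e : InnerEstimator) (η α β : ℕ → ℝ) (t : ℕ) (ω : Ω) : State d p m :=
  process Q e B₁ (Cf * Cg) η α β B ξ w₁ u₁ z₁ t ω

theorem traj_succ (h : Setting Q Lf Cf Lg Cg σ Δ D B₁ μ ℱ B ξ w₁ u₁ z₁)
    (e : InnerEstimator) (η α β : ℕ → ℝ) {t : ℕ} (ht : 1 ≤ t) (ω : Ω) :
    h.traj e η α β (t + 1) ω = step Q e B₁ (Cf * Cg) (η t) (α (t + 1)) (β (t + 1)) (B (t + 1) ω)
      (ξ (t + 1) ω) (h.traj e η α β t ω) :=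
  process_succ Q e _ η α β B ξ w₁ u₁ z₁ ht ω

/-- The components of the state, as a point of a product space. -/
noncomputable def coords (h : Setting Q Lf Cf Lg Cg σ Δ D B₁ μ ℱ B ξ w₁ u₁ z₁)
    (e : InnerEstimator) (η α β : ℕ → ℝ) (t : ℕ) (ω : Ω) :
    Euc d × (Fin m → Euc p) × (Fin m → Euc p) × Euc d :=
  ((h.traj e η α β t ω).w, (h.traj e η α β t ω).u, (h.traj e η α β t ω).uPrev,
    (h.traj e η α β t ω).z)

variable (h : Setting Q Lf Cf Lg Cg σ Δ D B₁ μ ℱ B ξ w₁ u₁ z₁) (e : InnerEstimator)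
  {η α β : ℕ → ℝ} {t : ℕ}

theorem measurable_coords (ht : 1 ≤ t) : Measurable[ℱ t] (h.coords e η α β t) := by
  obtain ⟨hw, hu, hu', hz⟩ := h.measurable_process e η α β ht
  exact hw.prodMk (hu.prodMk (hu'.prodMk hz))

theorem measurable_w (ht : 1 ≤ t) : Measurable fun ω => (h.traj e η α β t ω).w :=
  (h.measurable_process e η α β ht).1.mono (ℱ.le t) le_rfl

theorem measurable_uPrev (ht : 1 ≤ t) : Measurable fun ω => (h.traj e η α β t ω).uPrev :=
  (h.measurable_process e η α β ht).2.2.1.mono (ℱ.le t) le_rfl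

theorem measurable_z (ht : 1 ≤ t) : Measurable fun ω => (h.traj e η α β t ω).z :=
  (h.measurable_process e η α β ht).2.2.2.mono (ℱ.le t) le_rfl

theorem norm_traj_z_le (ht : 1 ≤ t) (ω : Ω) : ‖(h.traj e η α β t ω).z‖ ≤ Cf * Cg :=
  h.norm_z_le e η α β ht ω

theorem pos_m (h : Setting Q Lf Cf Lg Cg σ Δ D B₁ μ ℱ B ξ w₁ u₁ z₁) : 0 < m :=
  h.hB₁.trans h.hB₁m

theorem integrable_sq_of_bound [IsProbabilityMeasure μ] {x : Ω → Euc d} (hx : Measurable x)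
    {R : ℝ} (hR : ∀ ω, ‖x ω‖ ≤ R) : Integrable (fun ω => ‖x ω‖ ^ 2) μ := by
  refine Integrable.of_bound (hx.norm.pow_const 2).aestronglyMeasurable (R ^ 2)
    (Filter.Eventually.of_forall fun ω => ?_)
  rw [Real.norm_eq_abs, abs_of_nonneg (sq_nonneg _)]
  exact pow_le_pow_left₀ (norm_nonneg _) (hR ω) 2

theorem integrable_z_sq [IsProbabilityMeasure μ] (ht : 1 ≤ t) :
    Integrable (fun ω => ‖(h.traj e η α β t ω).z‖ ^ 2) μ :=
  integrable_sq_of_bound (h.measurable_z e ht) (h.norm_traj_z_le e ht)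

theorem integrable_outerErr [IsProbabilityMeasure μ] (ht : 1 ≤ t) : Integrable (fun ω =>
    ‖(h.traj e η α β t ω).z - fullGrad Q (h.traj e η α β t ω).w (h.traj e η α β t ω).uPrev‖ ^ 2)
    μ := by
  refine integrable_sq_of_bound (R := 2 * (Cf * Cg)) ((h.measurable_z e ht).sub
    (h.problem.measurable_fullGrad h.hLf h.hLg (h.measurable_w e ht) (h.measurable_uPrev e ht)))
    fun ω => (norm_sub_le _ _).trans ?_
  have h1 := h.norm_traj_z_le e (η := η) (α := α) (β := β) ht ω
  have h2 := h.problem.norm_fullGrad_le h.pos_m h.hCf h.hCg (h.traj e η α β t ω).w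
    (h.traj e η α β t ω).uPrev
  linarith

theorem norm_gradient_le (h : Setting Q Lf Cf Lg Cg σ Δ D B₁ μ ℱ B ξ w₁ u₁ z₁)
    (w : Euc d) : ‖gradient Q.F w‖ ≤ Cf * Cg := by
  rw [h.problem.gradient_eq]
  exact h.problem.norm_fullGrad_le h.pos_m h.hCf h.hCg _ _

theorem measurable_gradient_w (ht : 1 ≤ t) :
    Measurable fun ω => gradient Q.F (h.traj e η α β t ω).w := by
  simp_rw [h.problem.gradient_eq]
  exact h.problem.measurable_fullGrad h.hLf h.hLg (h.measurable_w e ht)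
    (measurable_pi_iff.2 fun i => h.problem.measurable_innerMap (h.measurable_w e ht) i)

theorem integrable_gradient_sq [IsProbabilityMeasure μ] (ht : 1 ≤ t) :
    Integrable (fun ω => ‖gradient Q.F (h.traj e η α β t ω).w‖ ^ 2) μ :=
  integrable_sq_of_bound (h.measurable_gradient_w e ht) fun _ => h.norm_gradient_le _

theorem integrable_track_sq [IsProbabilityMeasure μ] (ht : 1 ≤ t) : Integrable (fun ω =>
    ‖(h.traj e η α β t ω).z - gradient Q.F (h.traj e η α β t ω).w‖ ^ 2) μ := by
  refine integrable_sq_of_bound (R := 2 * (Cf * Cg))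
    ((h.measurable_z e ht).sub (h.measurable_gradient_w e ht)) fun ω => (norm_sub_le _ _).trans ?_
  have h1 := h.norm_traj_z_le e (η := η) (α := α) (β := β) ht ω
  have h2 := h.norm_gradient_le (h.traj e η α β t ω).w
  linarith

theorem norm_move_sq (z w : Euc d) (c : ℝ) : ‖w - c • z - w‖ ^ 2 = c ^ 2 * ‖z‖ ^ 2 := by
  rw [sub_sub_cancel_left, norm_neg, norm_smul_sq]

/-- Integrability at t + 1 comes with the bound, because the inner estimates, unlike z, are not
bounded: square integrability has to be carried along inductively from the start. -/
theorem integral_innerErr_succ_le [IsProbabilityMeasure μ] (hr : StepRange η α β) (ht : 1 ≤ t)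
    (i : Fin m) (hi : Integrable (fun ω =>
      ‖(h.traj e η α β t ω).u i - Q.g i (h.traj e η α β t ω).w‖ ^ 2) μ) :
    Integrable (fun ω =>
      ‖(h.traj e η α β (t + 1) ω).u i - Q.g i (h.traj e η α β (t + 1) ω).w‖ ^ 2) μ ∧
    ∫ ω, ‖(h.traj e η α β (t + 1) ω).u i - Q.g i (h.traj e η α β (t + 1) ω).w‖ ^ 2 ∂μ
      ≤ (1 - B₁ / m * β (t + 1)) *
          ∫ ω, ‖(h.traj e η α β t ω).u i - Q.g i (h.traj e η α β t ω).w‖ ^ 2 ∂μ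
        + 3 * (B₁ / m) * β (t + 1) ^ 2 * (σ ^ 2 / B₂)
        + innerDrift Cf Lg Cg σ * (m / B₁) *
          (η t ^ 2 * ∫ ω, ‖(h.traj e η α β t ω).z‖ ^ 2 ∂μ) := by
  have ht2 : 2 ≤ t + 1 := by omega
  have hprob := h.isProbabilityMeasure_batches ht2
  have i1 := hi.const_mul (1 - B₁ / m * β (t + 1))
  have i2 := integrable_const (μ := μ) (3 * (B₁ / m) * β (t + 1) ^ 2 * (σ ^ 2 / B₂))
  have i3 := ((h.integrable_z_sq e (η := η) (α := α) (β := β) ht).const_mul (η t ^ 2)).const_mul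
    (innerDrift Cf Lg Cg σ * (m / B₁))
  have i12 : Integrable (fun ω => (1 - B₁ / m * β (t + 1)) *
      ‖(h.traj e η α β t ω).u i - Q.g i (h.traj e η α β t ω).w‖ ^ 2
    + 3 * (B₁ / m) * β (t + 1) ^ 2 * (σ ^ 2 / B₂)) μ := i1.add i2
  have hw : Measurable fun q : (Euc d × (Fin m → Euc p) × (Fin m → Euc p) × Euc d) ×
      (Finset (Fin m) × (Fin m → Fin B₂ → S)) => q.1.1 - η t • q.1.2.2.2 :=
    measurable_fst.fst.sub (measurable_fst.snd.snd.snd.const_smul (η t))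
  have hm : Measurable fun q : (Euc d × (Fin m → Euc p) × (Fin m → Euc p) × Euc d) ×
      (Finset (Fin m) × (Fin m → Fin B₂ → S)) =>
      ‖updateU Q e B₁ (β (t + 1)) q.2.1 q.2.2 q.1.1 (q.1.1 - η t • q.1.2.2.2) q.1.2.1 i
        - Q.g i (q.1.1 - η t • q.1.2.2.2)‖ ^ 2 :=
    ((((measurable_pi_apply i).comp (h.problem.measurable_updateU e _ measurable_snd.fst
      measurable_snd.snd measurable_fst.fst hw measurable_fst.snd.fst))).sub
      (h.problem.measurable_innerMap hw i)).norm.pow_const 2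
  have key := h.integrable_and_integral_le ht (h.measurable_coords e (η := η) (α := α) (β := β) ht)
    hm (fun q => sq_nonneg _) (i12.add i3) fun ω => by
      have h1 := h.problem.integral_innerError_le h.hLg h.hCg h.hB₁ h.hB₁m h.hB₂
        (h.map_batches_eval ht2) e (hr.β_pos t ht) (hr.β_le t ht) (hr.sq_le t ht)
        (h.traj e η α β t ω).w ((h.traj e η α β t ω).w - η t • (h.traj e η α β t ω).z) (by
          rw [sub_sub_cancel_left, norm_neg, norm_smul, Real.norm_eq_abs,
            abs_of_pos (hr.η_pos t ht)]
          exact mul_le_mul_of_nonneg_left (h.norm_traj_z_le e ht ω) (hr.η_pos t ht).le)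
        (h.traj e η α β t ω).u i
      rw [norm_move_sq] at h1
      exact h1
  simp_rw [h.traj_succ e η α β ht]
  refine ⟨key.1, key.2.trans (le_of_eq ?_)⟩
  rw [integral_add' i12 i3, integral_add i1 i2]
  simp only [integral_const_mul, integral_const, probReal_univ, one_smul]

theorem integral_innerMove_succ_le [IsProbabilityMeasure μ] (hr : StepRange η α β) (ht : 1 ≤ t)
    (i : Fin m) (hi : Integrable (fun ω =>
      ‖(h.traj e η α β t ω).u i - Q.g i (h.traj e η α β t ω).w‖ ^ 2) μ) :
    Integrable (fun ω =>
      ‖(h.traj e η α β (t + 1) ω).u i - (h.traj e η α β (t + 1) ω).uPrev i‖ ^ 2) μ ∧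
    ∫ ω, ‖(h.traj e η α β (t + 1) ω).u i - (h.traj e η α β (t + 1) ω).uPrev i‖ ^ 2 ∂μ
      ≤ 4 * (B₁ / m) * β (t + 1) ^ 2 *
          ∫ ω, ‖(h.traj e η α β t ω).u i - Q.g i (h.traj e η α β t ω).w‖ ^ 2 ∂μ
        + 4 * (B₁ / m) * β (t + 1) ^ 2 * (σ ^ 2 / B₂)
        + innerMove Cg σ * (m / B₁) * (η t ^ 2 * ∫ ω, ‖(h.traj e η α β t ω).z‖ ^ 2 ∂μ) := by
  have ht2 : 2 ≤ t + 1 := by omega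
  have hprob := h.isProbabilityMeasure_batches ht2
  have i1 := hi.const_mul (4 * (B₁ / m) * β (t + 1) ^ 2)
  have i2 := integrable_const (μ := μ) (4 * (B₁ / m) * β (t + 1) ^ 2 * (σ ^ 2 / B₂))
  have i3 := ((h.integrable_z_sq e (η := η) (α := α) (β := β) ht).const_mul (η t ^ 2)).const_mul
    (innerMove Cg σ * (m / B₁))
  have i12 : Integrable (fun ω => 4 * (B₁ / m) * β (t + 1) ^ 2 *
      ‖(h.traj e η α β t ω).u i - Q.g i (h.traj e η α β t ω).w‖ ^ 2
    + 4 * (B₁ / m) * β (t + 1) ^ 2 * (σ ^ 2 / B₂)) μ := i1.add i2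
  have hw : Measurable fun q : (Euc d × (Fin m → Euc p) × (Fin m → Euc p) × Euc d) ×
      (Finset (Fin m) × (Fin m → Fin B₂ → S)) => q.1.1 - η t • q.1.2.2.2 :=
    measurable_fst.fst.sub (measurable_fst.snd.snd.snd.const_smul (η t))
  have hm : Measurable fun q : (Euc d × (Fin m → Euc p) × (Fin m → Euc p) × Euc d) ×
      (Finset (Fin m) × (Fin m → Fin B₂ → S)) =>
      ‖updateU Q e B₁ (β (t + 1)) q.2.1 q.2.2 q.1.1 (q.1.1 - η t • q.1.2.2.2) q.1.2.1 i
        - q.1.2.1 i‖ ^ 2 :=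
    ((((measurable_pi_apply i).comp (h.problem.measurable_updateU e _ measurable_snd.fst
      measurable_snd.snd measurable_fst.fst hw measurable_fst.snd.fst))).sub
      ((measurable_pi_apply i).comp measurable_fst.snd.fst)).norm.pow_const 2
  have key := h.integrable_and_integral_le ht (h.measurable_coords e (η := η) (α := α) (β := β) ht)
    hm (fun q => sq_nonneg _) (i12.add i3) fun ω => by
      have h1 := h.problem.integral_innerMove_le h.hCg h.hB₁ h.hB₁m h.hB₂
        (h.map_batches_eval ht2) e (hr.β_pos t ht) (hr.β_le t ht)
        (h.traj e η α β t ω).w ((h.traj e η α β t ω).w - η t • (h.traj e η α β t ω).z)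
        (h.traj e η α β t ω).u i
      rw [norm_move_sq] at h1
      exact h1
  simp_rw [h.traj_succ e η α β ht]
  refine ⟨key.1, key.2.trans (le_of_eq ?_)⟩
  rw [integral_add' i12 i3, integral_add i1 i2]
  simp only [integral_const_mul, integral_const, probReal_univ, one_smul]

theorem integral_outerErr_succ_le [IsProbabilityMeasure μ] (hr : StepRange η α β) (ht : 1 ≤ t)
    (hi : ∀ i, Integrable (fun ω =>
      ‖(h.traj e η α β t ω).u i - (h.traj e η α β t ω).uPrev i‖ ^ 2) μ) :
    ∫ ω, ‖(h.traj e η α β (t + 1) ω).z - fullGrad Q (h.traj e η α β (t + 1) ω).w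
        (h.traj e η α β (t + 1) ω).uPrev‖ ^ 2 ∂μ
      ≤ (1 - α (t + 1)) * ∫ ω, ‖(h.traj e η α β t ω).z - fullGrad Q (h.traj e η α β t ω).w
          (h.traj e η α β t ω).uPrev‖ ^ 2 ∂μ
        + 2 * α (t + 1) ^ 2 * (outerNoise Cf Cg σ * (1 / B₁ + 1 / B₂))
        + outerDrift Cf Lg * (η t ^ 2 * ∫ ω, ‖(h.traj e η α β t ω).z‖ ^ 2 ∂μ)
        + outerMove Lf Cg σ * (1 / m * ∑ i,
          ∫ ω, ‖(h.traj e η α β t ω).u i - (h.traj e η α β t ω).uPrev i‖ ^ 2 ∂μ) := by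
  have ht2 : 2 ≤ t + 1 := by omega
  have hprob := h.isProbabilityMeasure_batches ht2
  have i1 := (h.integrable_outerErr e (η := η) (α := α) (β := β) ht).const_mul (1 - α (t + 1))
  have i2 := integrable_const (μ := μ)
    (2 * α (t + 1) ^ 2 * (outerNoise Cf Cg σ * (1 / B₁ + 1 / B₂)))
  have i3 := ((h.integrable_z_sq e (η := η) (α := α) (β := β) ht).const_mul (η t ^ 2)).const_mul
    (outerDrift Cf Lg)
  have i4 := ((integrable_finsetSum Finset.univ fun i _ => hi i).const_mul (1 / (m : ℝ))).const_mul
    (outerMove Lf Cg σ)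
  have i12 := i1.add i2
  have i123 := i12.add i3
  have hw : Measurable fun q : (Euc d × (Fin m → Euc p) × (Fin m → Euc p) × Euc d) ×
      (Finset (Fin m) × (Fin m → Fin B₂ → S)) => q.1.1 - η t • q.1.2.2.2 :=
    measurable_fst.fst.sub (measurable_fst.snd.snd.snd.const_smul (η t))
  have hm : Measurable fun q : (Euc d × (Fin m → Euc p) × (Fin m → Euc p) × Euc d) ×
      (Finset (Fin m) × (Fin m → Fin B₂ → S)) =>
      ‖updateZ Q B₁ (Cf * Cg) (α (t + 1)) q.2.1 q.2.2 q.1.1 (q.1.1 - η t • q.1.2.2.2) q.1.2.1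
        q.1.2.2.1 q.1.2.2.2 - fullGrad Q (q.1.1 - η t • q.1.2.2.2) q.1.2.1‖ ^ 2 :=
    ((h.problem.measurable_updateZ h.hLf _ _ measurable_snd.fst
      measurable_snd.snd measurable_fst.fst hw measurable_fst.snd.fst measurable_fst.snd.snd.fst
      measurable_fst.snd.snd.snd).sub
      (h.problem.measurable_fullGrad h.hLf h.hLg hw measurable_fst.snd.fst)).norm.pow_const 2
  have key := h.integrable_and_integral_le ht (h.measurable_coords e (η := η) (α := α) (β := β) ht)
    hm (fun q => sq_nonneg _) (i123.add i4) fun ω => by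
      have h1 := h.problem.integral_outerError_le h.hCf h.hCg h.hB₁ h.hB₁m h.hB₂
        (h.map_batches_eval ht2) (hr.α_nonneg t ht) (hr.α_le t ht)
        (h.traj e η α β t ω).w ((h.traj e η α β t ω).w - η t • (h.traj e η α β t ω).z)
        (h.traj e η α β t ω).u (h.traj e η α β t ω).uPrev (h.traj e η α β t ω).z
      rw [norm_move_sq] at h1
      exact h1
  simp_rw [h.traj_succ e η α β ht]
  refine key.2.trans (le_of_eq ?_)
  rw [integral_add' i123 i4, integral_add' i12 i3, integral_add' i1 i2]
  simp only [integral_const_mul, integral_const, probReal_univ, one_smul,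
    integral_finsetSum _ fun i _ => hi i]

end Setting

/-! ### Averaged recursions and summed descent -/

namespace Setting

variable {d p m B₁ B₂ : ℕ} {S : Type*} [MeasurableSpace S] {Ω : Type*} [mΩ : MeasurableSpace Ω]
  {Q : Problem d p m B₂ S} {Lf Cf Lg Cg σ Δ D : ℝ} {μ : Measure Ω}
  {ℱ : Filtration ℕ mΩ} {B : ℕ → Ω → Finset (Fin m)} {ξ : ℕ → Ω → Fin m → Fin B₂ → S}
  {w₁ : Euc d} {u₁ : Ω → Fin m → Euc p} {z₁ : Ω → Euc d}
  (h : Setting Q Lf Cf Lg Cg σ Δ D B₁ μ ℱ B ξ w₁ u₁ z₁) (e : InnerEstimator)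
  (η α β : ℕ → ℝ)

/-- Average mean square error of the inner estimators. -/
noncomputable def innerErr (t : ℕ) : ℝ := 1 / (m : ℝ) * ∑ i,
  ∫ ω, ‖(h.traj e η α β t ω).u i - Q.g i (h.traj e η α β t ω).w‖ ^ 2 ∂μ

/-- Average mean square increment of the inner estimators. -/
noncomputable def innerInc (t : ℕ) : ℝ := 1 / (m : ℝ) * ∑ i,
  ∫ ω, ‖(h.traj e η α β t ω).u i - (h.traj e η α β t ω).uPrev i‖ ^ 2 ∂μ

/-- Mean square error of the gradient estimator, relative to its conditional target. -/
noncomputable def outerErr (t : ℕ) : ℝ :=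
  ∫ ω, ‖(h.traj e η α β t ω).z - fullGrad Q (h.traj e η α β t ω).w
    (h.traj e η α β t ω).uPrev‖ ^ 2 ∂μ

/-- Mean square length of the search direction. -/
noncomputable def dirSq (t : ℕ) : ℝ := ∫ ω, ‖(h.traj e η α β t ω).z‖ ^ 2 ∂μ

/-- Mean square error of the search direction as an estimate of the gradient. -/
noncomputable def trackErr (t : ℕ) : ℝ :=
  ∫ ω, ‖(h.traj e η α β t ω).z - gradient Q.F (h.traj e η α β t ω).w‖ ^ 2 ∂μ

/-- Mean square norm of the gradient of the objective. -/
noncomputable def gradSq (t : ℕ) : ℝ := ∫ ω, ‖gradient Q.F (h.traj e η α β t ω).w‖ ^ 2 ∂μ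

theorem innerErr_nonneg (t : ℕ) : 0 ≤ h.innerErr e η α β t :=
  mul_nonneg (by positivity) (Finset.sum_nonneg fun _ _ => integral_nonneg fun _ => sq_nonneg _)

theorem innerInc_nonneg (t : ℕ) : 0 ≤ h.innerInc e η α β t :=
  mul_nonneg (by positivity) (Finset.sum_nonneg fun _ _ => integral_nonneg fun _ => sq_nonneg _)

theorem outerErr_nonneg (t : ℕ) : 0 ≤ h.outerErr e η α β t := integral_nonneg fun _ => sq_nonneg _

theorem dirSq_nonneg (t : ℕ) : 0 ≤ h.dirSq e η α β t := integral_nonneg fun _ => sq_nonneg _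

theorem innerErr_one_le : h.innerErr e η α β 1 ≤ D := h.init.error_u

/-- This is the convention u₀ = u₁; it removes the increment from the initial potential. -/
theorem innerInc_one : h.innerInc e η α β 1 = 0 := by
  have h1 : ∀ ω i, (h.traj e η α β 1 ω).u i - (h.traj e η α β 1 ω).uPrev i = 0 :=
    fun ω i => sub_self _
  simp [innerInc, h1]

theorem outerErr_one_le [IsProbabilityMeasure μ] : h.outerErr e η α β 1 ≤ (2 * (Cf * Cg)) ^ 2 := by
  have h1 : ∀ ω, ‖(h.traj e η α β 1 ω).z - fullGrad Q (h.traj e η α β 1 ω).w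
      (h.traj e η α β 1 ω).uPrev‖ ^ 2 ≤ (2 * (Cf * Cg)) ^ 2 := by
    intro ω
    refine pow_le_pow_left₀ (norm_nonneg _) ((norm_sub_le _ _).trans ?_) 2
    have h1 := h.norm_traj_z_le e (η := η) (α := α) (β := β) le_rfl ω
    have h2 := h.problem.norm_fullGrad_le h.pos_m h.hCf h.hCg (h.traj e η α β 1 ω).w
      (h.traj e η α β 1 ω).uPrev
    linarith
  calc h.outerErr e η α β 1 ≤ ∫ _ω, (2 * (Cf * Cg)) ^ 2 ∂μ :=
        integral_mono (h.integrable_outerErr e le_rfl) (integrable_const _) h1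
    _ = _ := by simp

variable {η α β}

theorem integrable_innerErr [IsProbabilityMeasure μ] (hr : StepRange η α β) {t : ℕ} (ht : 1 ≤ t)
    (i : Fin m) : Integrable (fun ω =>
      ‖(h.traj e η α β t ω).u i - Q.g i (h.traj e η α β t ω).w‖ ^ 2) μ := by
  induction t, ht using Nat.le_induction with
  | base => exact ((h.init.memLp_u i).sub (memLp_const (Q.g i w₁))).integrable_norm_pow two_ne_zero
  | succ t ht ih => exact (h.integral_innerErr_succ_le e hr ht i ih).1

theorem integrable_innerInc [IsProbabilityMeasure μ] (hr : StepRange η α β) {t : ℕ} (ht : 1 ≤ t)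
    (i : Fin m) : Integrable (fun ω =>
      ‖(h.traj e η α β t ω).u i - (h.traj e η α β t ω).uPrev i‖ ^ 2) μ := by
  rcases Nat.eq_or_lt_of_le ht with rfl | ht'
  · have h1 : ∀ ω, (h.traj e η α β 1 ω).u i - (h.traj e η α β 1 ω).uPrev i = 0 :=
      fun ω => sub_self _
    simp [h1]
  · obtain ⟨s, rfl⟩ := Nat.exists_eq_add_of_le' ht'
    have hs : 1 ≤ s + 1 := by omega
    exact (h.integral_innerMove_succ_le e hr hs i (h.integrable_innerErr e hr hs i)).1

theorem average_const (h : Setting Q Lf Cf Lg Cg σ Δ D B₁ μ ℱ B ξ w₁ u₁ z₁) (a b : ℝ)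
    (x : Fin m → ℝ) : 1 / (m : ℝ) * ∑ i, (a * x i + b) = a * (1 / (m : ℝ) * ∑ i, x i) + b := by
  have hm : (0 : ℝ) < m := by exact_mod_cast h.pos_m
  rw [Finset.sum_add_distrib, Finset.sum_const, Finset.card_univ, Fintype.card_fin,
    nsmul_eq_mul, ← Finset.mul_sum, mul_add, ← mul_assoc (1 / (m : ℝ)) (m : ℝ),
    one_div_mul_cancel hm.ne', one_mul]
  ring

theorem innerErr_succ_le [IsProbabilityMeasure μ] (hr : StepRange η α β) {t : ℕ} (ht : 1 ≤ t) :
    h.innerErr e η α β (t + 1) ≤ (1 - B₁ / m * β (t + 1)) * h.innerErr e η α β t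
      + 3 * (B₁ / m) * β (t + 1) ^ 2 * (σ ^ 2 / B₂)
      + innerDrift Cf Lg Cg σ * (m / B₁) * (η t ^ 2 * h.dirSq e η α β t) := by
  rw [innerErr, innerErr, add_assoc, ← h.average_const]
  refine mul_le_mul_of_nonneg_left (Finset.sum_le_sum fun i _ => ?_) (by positivity)
  rw [← add_assoc]
  exact (h.integral_innerErr_succ_le e hr ht i (h.integrable_innerErr e hr ht i)).2

theorem innerInc_succ_le [IsProbabilityMeasure μ] (hr : StepRange η α β) {t : ℕ} (ht : 1 ≤ t) :
    h.innerInc e η α β (t + 1) ≤ 4 * (B₁ / m) * β (t + 1) ^ 2 * h.innerErr e η α β t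
      + 4 * (B₁ / m) * β (t + 1) ^ 2 * (σ ^ 2 / B₂)
      + innerMove Cg σ * (m / B₁) * (η t ^ 2 * h.dirSq e η α β t) := by
  rw [innerErr, innerInc, add_assoc, ← h.average_const]
  refine mul_le_mul_of_nonneg_left (Finset.sum_le_sum fun i _ => ?_) (by positivity)
  rw [← add_assoc]
  exact (h.integral_innerMove_succ_le e hr ht i (h.integrable_innerErr e hr ht i)).2

theorem outerErr_succ_le [IsProbabilityMeasure μ] (hr : StepRange η α β) {t : ℕ} (ht : 1 ≤ t) :
    h.outerErr e η α β (t + 1) ≤ (1 - α (t + 1)) * h.outerErr e η α β t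
      + 2 * α (t + 1) ^ 2 * (outerNoise Cf Cg σ * (1 / B₁ + 1 / B₂))
      + outerDrift Cf Lg * (η t ^ 2 * h.dirSq e η α β t)
      + outerMove Lf Cg σ * h.innerInc e η α β t :=
  h.integral_outerErr_succ_le e hr ht (h.integrable_innerInc e hr ht)

/-- Pass through the formula at u_{t−1}, the target of the outer error. The rest is the effect of
u_{t−1} − g(w_t), which is the inner error at time t minus the last increment. -/
theorem trackErr_le [IsProbabilityMeasure μ] (hr : StepRange η α β) {t : ℕ} (ht : 1 ≤ t) :
    h.trackErr e η α β t ≤ 2 * h.outerErr e η α β t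
      + 4 * Cg ^ 2 * Lf ^ 2 * (h.innerErr e η α β t + h.innerInc e η α β t) := by
  have iZ := (h.integrable_outerErr e (η := η) (α := α) (β := β) ht).const_mul 2
  have iU := integrable_finsetSum Finset.univ fun i _ => h.integrable_innerErr e hr ht i
  have iV := integrable_finsetSum Finset.univ fun i _ => h.integrable_innerInc e hr ht i
  have iS := (((iU.add iV).const_mul (1 / (m : ℝ))).const_mul (4 * Cg ^ 2 * Lf ^ 2))
  have hle : h.trackErr e η α β t ≤ _ :=
    integral_mono (h.integrable_track_sq e ht) (iZ.add iS) fun ω => by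
      set s := h.traj e η α β t ω
      have h1 := norm_add_sq_le (s.z - fullGrad Q s.w s.uPrev)
        (fullGrad Q s.w s.uPrev - gradient Q.F s.w)
      rw [sub_add_sub_cancel] at h1
      have h2 := h.problem.norm_fullGrad_sub_sq_le h.hCg s.w s.uPrev (fun i => Q.g i s.w)
      rw [← h.problem.gradient_eq] at h2
      have h3 : ∑ i, ‖s.uPrev i - Q.g i s.w‖ ^ 2
          ≤ 2 * (∑ i, ‖s.u i - Q.g i s.w‖ ^ 2 + ∑ i, ‖s.u i - s.uPrev i‖ ^ 2) := by
        rw [← Finset.sum_add_distrib, Finset.mul_sum]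
        refine Finset.sum_le_sum fun i _ => ?_
        have h4 := norm_sub_sq_le (s.u i - Q.g i s.w) (s.u i - s.uPrev i)
        rw [sub_sub_sub_cancel_left] at h4
        linarith
      have h5 : Cg ^ 2 * Lf ^ 2 * (1 / (m : ℝ) * ∑ i, ‖s.uPrev i - Q.g i s.w‖ ^ 2)
          ≤ Cg ^ 2 * Lf ^ 2 * (1 / (m : ℝ) * (2 * (∑ i, ‖s.u i - Q.g i s.w‖ ^ 2
            + ∑ i, ‖s.u i - s.uPrev i‖ ^ 2))) := by gcongr
      simp only [Pi.add_apply]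
      linarith
  refine hle.trans (le_of_eq ?_)
  rw [integral_add' iZ iS, integral_const_mul, integral_const_mul, integral_const_mul,
    integral_add' iU iV, integral_finsetSum _ fun i _ => h.integrable_innerErr e hr ht i,
    integral_finsetSum _ fun i _ => h.integrable_innerInc e hr ht i]
  unfold outerErr innerErr innerInc
  ring

theorem sum_descent_le [IsProbabilityMeasure μ] (hr : StepRange η α β)
    (hL : ∀ t, 1 ≤ t → η t * (Cf * Lg + Cg ^ 2 * Lf) ≤ 1 / 4) (T : ℕ) :
    ∑ t ∈ Finset.Icc 1 T, (η t / 2 * h.gradSq e η α β t + η t / 4 * h.dirSq e η α β t)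
      ≤ Δ + ∑ t ∈ Finset.Icc 1 T, η t / 2 * h.trackErr e η α β t := by
  -- The telescoping is done along each trajectory, and expectations are taken only after F(w_{T+1})
  -- has been bounded below. No integrability of F along the iterates is required.
  have hpath : ∀ ω, ∑ t ∈ Finset.Icc 1 T, (η t / 2 * ‖gradient Q.F (h.traj e η α β t ω).w‖ ^ 2
      + η t / 4 * ‖(h.traj e η α β t ω).z‖ ^ 2) + (Q.F (h.traj e η α β (T + 1) ω).w - Q.F w₁)
      ≤ ∑ t ∈ Finset.Icc 1 T, η t / 2 *
        ‖(h.traj e η α β t ω).z - gradient Q.F (h.traj e η α β t ω).w‖ ^ 2 := by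
    intro ω
    induction T with
    | zero =>
      have h1 : (h.traj e η α β (0 + 1) ω).w = w₁ := rfl
      simp only [h1, sub_self, Finset.Icc_eq_empty_of_lt zero_lt_one, Finset.sum_empty, add_zero,
        le_refl]
    | succ T ih =>
      rw [Finset.sum_Icc_succ_top (by omega), Finset.sum_Icc_succ_top (by omega)]
      have hT : 1 ≤ T + 1 := by omega
      have h1 := h.problem.descent h.pos_m h.hLf h.hCf h.hLg h.hCg
        (h.traj e η α β (T + 1) ω).w (h.traj e η α β (T + 1) ω).z (hr.η_pos _ hT) (hL _ hT)
      have h2 : (h.traj e η α β (T + 1 + 1) ω).w = (h.traj e η α β (T + 1) ω).w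
          - η (T + 1) • (h.traj e η α β (T + 1) ω).z := by rw [h.traj_succ e η α β hT]; rfl
      rw [h2]
      linarith
  have hF : ∀ w, Q.F w₁ - Δ ≤ Q.F w := fun w => by
    have h1 := h.init.gap
    have h2 := ciInf_le h.init.bddBelow w
    linarith
  have iG : ∀ t ∈ Finset.Icc 1 T, Integrable (fun ω =>
      η t / 2 * ‖gradient Q.F (h.traj e η α β t ω).w‖ ^ 2) μ := fun t ht =>
    (h.integrable_gradient_sq e (Finset.mem_Icc.1 ht).1).const_mul _
  have iN : ∀ t ∈ Finset.Icc 1 T, Integrable (fun ω =>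
      η t / 4 * ‖(h.traj e η α β t ω).z‖ ^ 2) μ := fun t ht =>
    (h.integrable_z_sq e (Finset.mem_Icc.1 ht).1).const_mul _
  have iR : ∀ t ∈ Finset.Icc 1 T, Integrable (fun ω =>
      η t / 2 * ‖(h.traj e η α β t ω).z - gradient Q.F (h.traj e η α β t ω).w‖ ^ 2) μ :=
    fun t ht => (h.integrable_track_sq e (Finset.mem_Icc.1 ht).1).const_mul _
  have iGN : ∀ t ∈ Finset.Icc 1 T, Integrable (fun ω =>
      η t / 2 * ‖gradient Q.F (h.traj e η α β t ω).w‖ ^ 2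
        + η t / 4 * ‖(h.traj e η α β t ω).z‖ ^ 2) μ := fun t ht => (iG t ht).add (iN t ht)
  have iL := integrable_finsetSum (Finset.Icc 1 T) iGN
  have iRs := (integrable_const (μ := μ) Δ).add (integrable_finsetSum (Finset.Icc 1 T) iR)
  have hmono := integral_mono iL iRs fun ω => by
    have h1 := hpath ω
    have h2 := hF (h.traj e η α β (T + 1) ω).w
    simp only [Pi.add_apply]
    linarith
  rw [integral_add' (integrable_const _) (integrable_finsetSum _ iR),
    integral_finsetSum _ iGN, integral_finsetSum _ iR] at hmono
  have e1 : ∀ t ∈ Finset.Icc 1 T, η t / 2 * h.gradSq e η α β t + η t / 4 * h.dirSq e η α β t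
      = ∫ ω, (η t / 2 * ‖gradient Q.F (h.traj e η α β t ω).w‖ ^ 2
        + η t / 4 * ‖(h.traj e η α β t ω).z‖ ^ 2) ∂μ := fun t ht => by
    rw [integral_add (iG t ht) (iN t ht), integral_const_mul, integral_const_mul]; rfl
  rw [Finset.sum_congr rfl e1]
  refine hmono.trans (le_of_eq ?_)
  simp only [integral_const_mul, integral_const, probReal_univ, one_smul]
  rfl

end Setting

/-! ### The potential argument -/

section potential

/-- Constants of the potential argument. `K₁, K₂, K₃` are the noise, displacement and movement
factors of the outer error, `K₄` and `K₅` the displacement factors of the inner error and of the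
inner increment, `K₆` the weight of the inner error in the tracking error. -/
structure PotentialConstants (K₂ K₃ K₄ K₅ K₆ A cα cβ κ : ℝ) : Prop where
  K₂_nonneg : 0 ≤ K₂
  K₃_nonneg : 0 ≤ K₃
  K₄_nonneg : 0 ≤ K₄
  K₅_nonneg : 0 ≤ K₅
  K₆_nonneg : 0 ≤ K₆
  A_pos : 0 < A
  A_le : A * (K₂ + K₄ + (2 * K₃ + 1) * K₅) ≤ 1 / 8
  cα_eq : cα = 1 + 1 / A
  cβ_eq : cβ = 2 + K₆ / A
  κ_pos : 0 < κ
  κ_le : κ ≤ 1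
  κα : κ ^ 2 * cα ≤ 1
  κβ : κ ^ 2 * (16 * (2 * K₃ + 1) * cβ) ≤ 1
  κ₆ : κ ^ 2 * K₆ ≤ 2 * A

/-- The constants are chosen in the order A, then cα and cβ, then κ. The momentum constants may blow
up as A shrinks; a small κ repairs every side condition this creates. -/
theorem exists_potentialConstants {K₂ K₃ K₄ K₅ K₆ L : ℝ} (h2 : 0 ≤ K₂) (h3 : 0 ≤ K₃)
    (h4 : 0 ≤ K₄) (h5 : 0 ≤ K₅) (h6 : 0 ≤ K₆) (hL : 0 ≤ L) :
    ∃ A cα cβ κ, PotentialConstants K₂ K₃ K₄ K₅ K₆ A cα cβ κ ∧ κ * L ≤ 1 / 4 := by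
  set A : ℝ := 1 / (8 * (1 + (K₂ + K₄ + (2 * K₃ + 1) * K₅))) with hA
  have hA0 : 0 < A := by positivity
  set cα : ℝ := 1 + 1 / A with hcα
  set cβ : ℝ := 2 + K₆ / A with hcβ
  have hcα0 : 0 < cα := by positivity
  have hcβ0 : 0 < cβ := by positivity
  -- The reciprocal of κ: a sum of everything that κ or κ² must beat. The leading 1 gives κ ≤ 1, so
  -- that κ² may be estimated by κ.
  set X : ℝ := 1 + cα + 16 * (2 * K₃ + 1) * cβ + K₆ / (2 * A) + 4 * L with hX
  have hX1 : 1 ≤ X := by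
    have : 0 ≤ cα + 16 * (2 * K₃ + 1) * cβ + K₆ / (2 * A) + 4 * L := by positivity
    linarith
  have hX0 : 0 < X := by linarith
  have hκ1 : 1 / X ≤ 1 := by rw [div_le_one hX0]; exact hX1
  have hsq : ∀ y, 0 ≤ y → y ≤ X → (1 / X) ^ 2 * y ≤ 1 := by
    intro y _ hy
    calc (1 / X) ^ 2 * y ≤ (1 / X) ^ 2 * X := by gcongr
      _ = 1 / X := by field_simp
      _ ≤ 1 := hκ1
  have p1 : 0 ≤ 16 * (2 * K₃ + 1) * cβ := by positivity
  have p2 : 0 ≤ K₆ / (2 * A) := by positivity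
  refine ⟨A, cα, cβ, 1 / X, ⟨h2, h3, h4, h5, h6, hA0, ?_, hcα, hcβ, by positivity, hκ1,
    hsq _ hcα0.le (by linarith), hsq _ p1 (by linarith), ?_⟩, ?_⟩
  · rw [hA, one_div_mul_eq_div, div_le_iff₀ (by positivity)]
    linarith
  · have h := hsq _ p2 (by linarith)
    have e : (1 / X) ^ 2 * K₆ = (1 / X) ^ 2 * (K₆ / (2 * A)) * (2 * A) := by field_simp
    rw [e]
    nlinarith
  · rw [one_div_mul_eq_div, div_le_iff₀ hX0]
    linarith

variable {K₂ K₃ K₄ K₅ K₆ A cα cβ κ : ℝ}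

/-- Noise factor of the potential argument. -/
noncomputable def potentialNoise (K₁ K₃ A cα cβ σ : ℝ) : ℝ :=
  A * (8 * cα ^ 2 * K₁ + 6 * cβ ^ 2 * σ ^ 2 + 8 * (2 * K₃ + 1) * cβ ^ 2 * σ ^ 2)

/-- Every loss is matched with a gain. The contraction of Z pays for the growth of the weight and
for 2Z in the tracking error; that of U does the same with half of it, the other half paying for U
inside V'. In the weight 2K₃ + 1 of V, the part 2K₃ pays for V in Z' and the 1 for V in the tracking
error. The displacement terms are small through A. -/
theorem PotentialConstants.step (hc : PotentialConstants K₂ K₃ K₄ K₅ K₆ A cα cβ κ)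
    {K₁ q s η α β lam lam' Z U V N Z' U' V' R b σ : ℝ} (hK₁ : 0 ≤ K₁) (hq : 0 < q) (hq1 : q ≤ 1)
    (hs : 0 < s) (hη : 0 < η) (hηκ : η ≤ κ * q) (hα : α = cα * (η ^ 2 / q))
    (hβ : β = cβ * (η ^ 2 / q ^ 2)) (hlam : lam = q / η) (hlam' : 0 ≤ lam')
    (hll : lam' ≤ lam + η) (hZ : 0 ≤ Z) (hU : 0 ≤ U) (hV : 0 ≤ V) (hN : 0 ≤ N)
    (hb : b ≤ 2 / (q * s))
    (hZ' : Z' ≤ (1 - α) * Z + 2 * α ^ 2 * (K₁ * b) + K₂ * (η ^ 2 * N) + K₃ * V)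
    (hU' : U' ≤ (1 - q * β) * U + 3 * q * β ^ 2 * (σ ^ 2 / s) + K₄ * (1 / q) * (η ^ 2 * N))
    (hV' : V' ≤ 4 * q * β ^ 2 * U + 4 * q * β ^ 2 * (σ ^ 2 / s) + K₅ * (1 / q) * (η ^ 2 * N))
    (hR : R ≤ 2 * Z + K₆ * (U + V)) :
    A * lam' * (Z' + U' + (2 * K₃ + 1) * V') + η / 2 * R
      ≤ A * lam * (Z + U + (2 * K₃ + 1) * V) + η / 4 * N
        + potentialNoise K₁ K₃ A cα cβ σ * (η ^ 3 / (q ^ 2 * s)) := by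
  obtain ⟨h2, h3, h4, h5, h6, hA, hA8, hcα, hcβ, hκ0, hκ1, hκα, hκβ, hκ6⟩ := hc
  set c : ℝ := 2 * K₃ + 1 with hcdef
  have hc1 : 1 ≤ c := by linarith
  have hcα0 : 0 < cα := by rw [hcα]; positivity
  have hcβ2 : 2 ≤ cβ := by
    have : 0 ≤ K₆ / A := by positivity
    linarith
  have hqq : q ^ 2 ≤ q := by rw [pow_two]; exact mul_le_of_le_one_left hq.le hq1
  have hη2 : η ^ 2 ≤ κ ^ 2 * q ^ 2 := by rw [← mul_pow]; gcongr
  have hlam0 : 0 < lam := by rw [hlam]; positivity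
  have hηq : η ^ 2 ≤ q := by
    calc η ^ 2 ≤ κ ^ 2 * q ^ 2 := hη2
      _ ≤ 1 ^ 2 * q ^ 2 := by gcongr
      _ = q ^ 2 := by ring
      _ ≤ q := hqq
  have hηlam : η ≤ lam := by rw [hlam, le_div_iff₀ hη, ← pow_two]; exact hηq
  have hll2 : lam' ≤ 2 * lam := by linarith
  have hα0 : 0 ≤ α := by rw [hα]; positivity
  have hα1 : α ≤ 1 := by
    rw [hα, ← mul_div_assoc, div_le_one hq]
    calc cα * η ^ 2 ≤ cα * (κ ^ 2 * q ^ 2) := by gcongr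
      _ = κ ^ 2 * cα * q ^ 2 := by ring
      _ ≤ 1 * q ^ 2 := by gcongr
      _ = q ^ 2 := by ring
      _ ≤ q := hqq
  have hβ0 : 0 ≤ β := by rw [hβ]; positivity
  have hβc : 16 * c * β ≤ 1 := by
    rw [hβ]
    have h7 : η ^ 2 / q ^ 2 ≤ κ ^ 2 := by rw [div_le_iff₀ (by positivity)]; exact hη2
    calc 16 * c * (cβ * (η ^ 2 / q ^ 2)) ≤ 16 * c * (cβ * κ ^ 2) := by gcongr
      _ = κ ^ 2 * (16 * c * cβ) := by ring
      _ ≤ 1 := hκβ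
  have hβ1 : q * β ≤ 1 := by
    have h7 : β ≤ 1 := by
      have : 1 * β ≤ 16 * c * β := mul_le_mul_of_nonneg_right (by linarith) hβ0
      linarith
    exact mul_le_one₀ hq1 hβ0 h7
  -- The weight q/η is chosen so that both decay rates become constant multiples of η.
  have elα : lam * α = cα * η := by rw [hlam, hα]; field_simp
  have elβ : lam * (q * β) = cβ * η := by rw [hlam, hβ]; field_simp
  have elη : lam * η ^ 2 = q * η := by rw [hlam]; field_simp
  set E : ℝ := η ^ 3 / (q ^ 2 * s) with hE
  -- Both noise sources scale as η³/(q²s); the leading 2 comes from lam' ≤ 2 lam.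
  have eE1 : 2 * lam * (2 * α ^ 2 * (K₁ * (2 / (q * s)))) = 8 * cα ^ 2 * K₁ * E := by
    rw [hlam, hα, hE]; field_simp; ring
  have eE2 : lam * (q * β ^ 2 * (σ ^ 2 / s)) = cβ ^ 2 * σ ^ 2 * E := by
    rw [hlam, hβ, hE]; field_simp
  have hlα : (lam + η) * (1 - α) ≤ lam + η - cα * η := by
    have h7 : 0 ≤ η * α := by positivity
    linarith
  have hlβ : (lam + η) * (1 - q * β) ≤ lam + η - cβ * η := by
    have h7 : 0 ≤ η * (q * β) := by positivity
    linarith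
  have bZ : lam' * Z' ≤ (lam + η - cα * η) * Z + 8 * cα ^ 2 * K₁ * E + 2 * K₂ * (η * N)
      + 2 * lam * (K₃ * V) := by
    have h7 : 2 * α ^ 2 * (K₁ * b) ≤ 2 * α ^ 2 * (K₁ * (2 / (q * s))) := by gcongr
    have h8 : lam' * Z' ≤ lam' * ((1 - α) * Z + (2 * α ^ 2 * (K₁ * (2 / (q * s)))
        + K₂ * (η ^ 2 * N) + K₃ * V)) := mul_le_mul_of_nonneg_left (by linarith) hlam'
    have h9 : lam' * ((1 - α) * Z) ≤ (lam + η - cα * η) * Z := by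
      calc lam' * ((1 - α) * Z) ≤ (lam + η) * ((1 - α) * Z) :=
            mul_le_mul_of_nonneg_right hll (mul_nonneg (by linarith) hZ)
        _ = (lam + η) * (1 - α) * Z := by ring
        _ ≤ _ := mul_le_mul_of_nonneg_right hlα hZ
    have h10 : lam' * (2 * α ^ 2 * (K₁ * (2 / (q * s))) + K₂ * (η ^ 2 * N) + K₃ * V)
        ≤ 2 * lam * (2 * α ^ 2 * (K₁ * (2 / (q * s))) + K₂ * (η ^ 2 * N) + K₃ * V) :=
      mul_le_mul_of_nonneg_right hll2 (by positivity)
    have h11 : 2 * lam * (K₂ * (η ^ 2 * N)) ≤ 2 * K₂ * (η * N) := by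
      calc 2 * lam * (K₂ * (η ^ 2 * N)) = 2 * K₂ * N * (lam * η ^ 2) := by ring
        _ = 2 * K₂ * N * (q * η) := by rw [elη]
        _ ≤ 2 * K₂ * N * (1 * η) := by gcongr
        _ = _ := by ring
    linarith
  have bU : lam' * U' ≤ (lam + η - cβ * η) * U + 6 * (cβ ^ 2 * σ ^ 2 * E) + 2 * K₄ * (η * N) := by
    have h8 : lam' * U' ≤ lam' * ((1 - q * β) * U + (3 * (q * β ^ 2 * (σ ^ 2 / s))
        + K₄ * (1 / q) * (η ^ 2 * N))) := mul_le_mul_of_nonneg_left (by linarith) hlam'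
    have h9 : lam' * ((1 - q * β) * U) ≤ (lam + η - cβ * η) * U := by
      calc lam' * ((1 - q * β) * U) ≤ (lam + η) * ((1 - q * β) * U) :=
            mul_le_mul_of_nonneg_right hll (mul_nonneg (by linarith) hU)
        _ = (lam + η) * (1 - q * β) * U := by ring
        _ ≤ _ := mul_le_mul_of_nonneg_right hlβ hU
    have h10 : lam' * (3 * (q * β ^ 2 * (σ ^ 2 / s)) + K₄ * (1 / q) * (η ^ 2 * N))
        ≤ 2 * lam * (3 * (q * β ^ 2 * (σ ^ 2 / s)) + K₄ * (1 / q) * (η ^ 2 * N)) :=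
      mul_le_mul_of_nonneg_right hll2 (by positivity)
    have h11 : 2 * lam * (K₄ * (1 / q) * (η ^ 2 * N)) = 2 * K₄ * (η * N) := by
      calc _ = 2 * K₄ * (1 / q) * N * (lam * η ^ 2) := by ring
        _ = 2 * K₄ * (1 / q) * N * (q * η) := by rw [elη]
        _ = _ := by field_simp
    linarith
  have bV : lam' * V' ≤ 8 * (cβ * η) * β * U + 8 * (cβ ^ 2 * σ ^ 2 * E) + 2 * K₅ * (η * N) := by
    have h8 : lam' * V' ≤ lam' * (4 * q * β ^ 2 * U + 4 * (q * β ^ 2 * (σ ^ 2 / s))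
        + K₅ * (1 / q) * (η ^ 2 * N)) := mul_le_mul_of_nonneg_left (by linarith) hlam'
    have h10 : lam' * (4 * q * β ^ 2 * U + 4 * (q * β ^ 2 * (σ ^ 2 / s))
          + K₅ * (1 / q) * (η ^ 2 * N))
        ≤ 2 * lam * (4 * q * β ^ 2 * U + 4 * (q * β ^ 2 * (σ ^ 2 / s))
          + K₅ * (1 / q) * (η ^ 2 * N)) := mul_le_mul_of_nonneg_right hll2 (by positivity)
    have h11 : 2 * lam * (K₅ * (1 / q) * (η ^ 2 * N)) = 2 * K₅ * (η * N) := by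
      calc _ = 2 * K₅ * (1 / q) * N * (lam * η ^ 2) := by ring
        _ = 2 * K₅ * (1 / q) * N * (q * η) := by rw [elη]
        _ = _ := by field_simp
    have h12 : 2 * lam * (4 * q * β ^ 2 * U) = 8 * (cβ * η) * β * U := by rw [← elβ]; ring
    linarith
  -- The constraint on κ makes β small enough that V' spends at most half of the gain from the
  -- contraction of U.
  have hUc : c * (8 * (cβ * η) * β * U) ≤ cβ * η / 2 * U := by
    calc c * (8 * (cβ * η) * β * U) = 16 * c * β * (cβ * η / 2 * U) := by ring
      _ ≤ 1 * (cβ * η / 2 * U) := mul_le_mul_of_nonneg_right hβc (by positivity)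
      _ = _ := one_mul _
  have hV6 : η * K₆ ≤ 2 * A * lam := by
    rw [hlam, ← mul_div_assoc, le_div_iff₀ hη]
    calc η * K₆ * η = K₆ * η ^ 2 := by ring
      _ ≤ K₆ * (κ ^ 2 * q ^ 2) := by gcongr
      _ = κ ^ 2 * K₆ * q ^ 2 := by ring
      _ ≤ 2 * A * q ^ 2 := by gcongr
      _ ≤ 2 * A * q := by gcongr
  -- After paying A for the growth of the weight, these leave exactly the coefficients 1 and, with
  -- the half spent on V', K₆/2 needed by the tracking error.
  have hAα : A * cα = A + 1 := by rw [hcα]; field_simp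
  have hAβ : A * cβ = 2 * A + K₆ := by rw [hcβ]; field_simp
  have hbV := mul_le_mul_of_nonneg_left bV (by linarith : 0 ≤ c)
  have hsum : lam' * (Z' + U' + c * V') ≤ (lam + η - cα * η) * Z + (lam + η - cβ * η / 2) * U
      + 2 * lam * (K₃ * V) + 2 * (K₂ + K₄ + c * K₅) * (η * N)
      + (8 * cα ^ 2 * K₁ + 6 * cβ ^ 2 * σ ^ 2 + 8 * c * cβ ^ 2 * σ ^ 2) * E := by
    linarith
  have hA' := mul_le_mul_of_nonneg_left hsum hA.le
  have hNη : A * (2 * (K₂ + K₄ + c * K₅) * (η * N)) ≤ η / 4 * N := by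
    have h7 := mul_le_mul_of_nonneg_right hA8 (by positivity : 0 ≤ 2 * (η * N))
    linarith
  have hRη := mul_le_mul_of_nonneg_left hR (by positivity : 0 ≤ η / 2)
  have eZ : A * ((lam + η - cα * η) * Z) = A * lam * Z - η * Z := by
    linear_combination (-(η * Z)) * hAα
  have eU : A * ((lam + η - cβ * η / 2) * U) = A * lam * U - η / 2 * (K₆ * U) := by
    linear_combination (-(η / 2 * U)) * hAβ
  have hVV := mul_le_mul_of_nonneg_right hV6 hV
  have eV : A * lam * (c * V) = A * (2 * lam * (K₃ * V)) + A * lam * V := by rw [hcdef]; ring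
  unfold potentialNoise
  rw [← hcdef]
  linarith

end potential

/-- The instance of the potential constants that belongs to the problem class. -/
abbrev MethodConstants (Lf Cf Lg Cg σ A cα cβ κ : ℝ) : Prop :=
  PotentialConstants (outerDrift Cf Lg) (outerMove Lf Cg σ) (innerDrift Cf Lg Cg σ)
    (innerMove Cg σ) (4 * Cg ^ 2 * Lf ^ 2) A cα cβ κ

theorem exists_methodConstants {Lf Cf Lg Cg : ℝ} (σ : ℝ) (hLf : 0 ≤ Lf) (hCf : 0 ≤ Cf)
    (hLg : 0 ≤ Lg) : ∃ A cα cβ κ, MethodConstants Lf Cf Lg Cg σ A cα cβ κ ∧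
      κ * (Cf * Lg + Cg ^ 2 * Lf) ≤ 1 / 4 := by
  have hJ := jacobianBound_nonneg Cg σ
  refine exists_potentialConstants ?_ ?_ ?_ ?_ ?_ ?_
  · unfold outerDrift; positivity
  · unfold outerMove; positivity
  · unfold innerDrift; positivity
  · unfold innerMove; positivity
  · positivity
  · positivity

/-- Step sizes for which the potential argument applies: they are at most of order `q = B₁ / m`
and do not decrease too fast. -/
structure AdmissibleSteps (κ q : ℝ) (η : ℕ → ℝ) : Prop where
  pos : ∀ t, 1 ≤ t → 0 < η t
  le : ∀ t, 1 ≤ t → η t ≤ κ * q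
  slow : ∀ t, 1 ≤ t → q / η (t + 1) ≤ q / η t + η t

/-- Steps at most κq give α ≤ κ²cα q and β ≤ κ²cβ, and the constraints on κ apply. The bound η² ≤ β
needs only cβ ≥ 1 and B₁ ≤ m. -/
theorem PotentialConstants.stepRange {K₂ K₃ K₄ K₅ K₆ A cα cβ κ : ℝ}
    (hc : PotentialConstants K₂ K₃ K₄ K₅ K₆ A cα cβ κ) {m B₁ : ℕ} (hB₁ : 1 ≤ B₁) (hB₁m : B₁ ≤ m)
    {η α β : ℕ → ℝ} (hη : AdmissibleSteps κ (B₁ / m) η) (hαβ : Coupled cα cβ m B₁ η α β) :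
    StepRange η α β := by
  obtain ⟨h2, h3, h4, h5, h6, hA, hA8, hcα, hcβ, hκ0, hκ1, hκα, hκβ, hκ6⟩ := hc
  have hk : (0 : ℝ) < B₁ := by positivity
  have hkm : (B₁ : ℝ) ≤ m := by exact_mod_cast hB₁m
  have hm : (0 : ℝ) < m := hk.trans_le hkm
  have hcα0 : 0 < cα := by rw [hcα]; positivity
  have hcβ2 : 2 ≤ cβ := by
    have : 0 ≤ K₆ / A := by positivity
    linarith
  have hsq : ∀ t, 1 ≤ t → η t ^ 2 ≤ κ ^ 2 * (B₁ / m : ℝ) ^ 2 := fun t ht => by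
    rw [← mul_pow]; exact pow_le_pow_left₀ (hη.pos t ht).le (hη.le t ht) 2
  refine ⟨hη.pos, fun t ht => ?_, fun t ht => ?_, fun t ht => ?_, fun t ht => ?_, fun t ht => ?_⟩
  · rw [(hαβ t ht).1]; have := hη.pos t ht; positivity
  · rw [(hαβ t ht).1]
    calc cα * (m * η t ^ 2 / B₁) ≤ cα * (m * (κ ^ 2 * (B₁ / m : ℝ) ^ 2) / B₁) := by
          gcongr; exact hsq t ht
      _ = κ ^ 2 * cα * (B₁ / m) := by field_simp
      _ ≤ 1 * 1 := mul_le_mul hκα ((div_le_one hm).2 hkm) (by positivity) zero_le_one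
      _ = 1 := one_mul 1
  · rw [(hαβ t ht).2]; have := hη.pos t ht; positivity
  · rw [(hαβ t ht).2]
    have h1 : cβ * ((m : ℝ) ^ 2 * η t ^ 2 / (B₁ : ℝ) ^ 2) ≤ κ ^ 2 * cβ := by
      calc cβ * ((m : ℝ) ^ 2 * η t ^ 2 / (B₁ : ℝ) ^ 2)
          ≤ cβ * ((m : ℝ) ^ 2 * (κ ^ 2 * (B₁ / m : ℝ) ^ 2) / (B₁ : ℝ) ^ 2) := by
            gcongr; exact hsq t ht
        _ = _ := by field_simp
    have h7 : 0 ≤ κ ^ 2 * cβ := by positivity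
    have h8 : 0 ≤ K₃ * (κ ^ 2 * cβ) := by positivity
    linarith
  · rw [(hαβ t ht).2]
    have h1 : η t ^ 2 ≤ (m : ℝ) ^ 2 * η t ^ 2 / (B₁ : ℝ) ^ 2 := by
      rw [le_div_iff₀ (by positivity), mul_comm]
      gcongr
    have h7 : 0 ≤ (m : ℝ) ^ 2 * η t ^ 2 / (B₁ : ℝ) ^ 2 := by positivity
    have h8 := mul_le_mul_of_nonneg_right hcβ2 h7
    linarith

/-! ### Summing the potential -/

namespace Setting

variable {d p m B₁ B₂ : ℕ} {S : Type*} [MeasurableSpace S] {Ω : Type*} [mΩ : MeasurableSpace Ω]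
  {Q : Problem d p m B₂ S} {Lf Cf Lg Cg σ Δ D : ℝ} {μ : Measure Ω}
  {ℱ : Filtration ℕ mΩ} {B : ℕ → Ω → Finset (Fin m)} {ξ : ℕ → Ω → Fin m → Fin B₂ → S}
  {w₁ : Euc d} {u₁ : Ω → Fin m → Euc p} {z₁ : Ω → Euc d}

/-- The block sampling noise 1/B₁ is at most m/(B₁B₂) precisely when B₂ ≤ m. This is where the
formal statement's restriction on the batch size enters. -/
theorem inv_add_inv_le (h : Setting Q Lf Cf Lg Cg σ Δ D B₁ μ ℱ B ξ w₁ u₁ z₁) (hB₂m : B₂ ≤ m) :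
    1 / (B₁ : ℝ) + 1 / B₂ ≤ 2 / ((B₁ / m) * B₂) := by
  have hk : (0 : ℝ) < B₁ := by have := h.hB₁; positivity
  have hkm : (B₁ : ℝ) ≤ m := by exact_mod_cast h.hB₁m
  have hm : (0 : ℝ) < m := hk.trans_le hkm
  have hs : (0 : ℝ) < B₂ := by have := h.hB₂; positivity
  have hsm : (B₂ : ℝ) ≤ m := by exact_mod_cast hB₂m
  have h1 : 1 / (B₁ : ℝ) ≤ 1 / ((B₁ / m) * B₂) := by
    refine one_div_le_one_div_of_le (by positivity) ?_
    rw [div_mul_eq_mul_div, div_le_iff₀ hm]; gcongr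
  have h2 : 1 / (B₂ : ℝ) ≤ 1 / ((B₁ / m) * B₂) := by
    refine one_div_le_one_div_of_le (by positivity) ?_
    exact mul_le_of_le_one_left hs.le ((div_le_one hm).2 hkm)
  have h3 : 2 / ((B₁ / m : ℝ) * B₂) = 1 / ((B₁ / m) * B₂) + 1 / ((B₁ / m) * B₂) := by ring
  rw [h3]; exact add_le_add h1 h2

variable {A cα cβ κ : ℝ} {η α β : ℕ → ℝ}

/-- Telescoping the potential and adding the summed descent cancels both the tracking errors and the
η/4 E‖z‖² terms. The final potential is nonnegative and is discarded. -/
theorem sum_gradSq_le [IsProbabilityMeasure μ]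
    (h : Setting Q Lf Cf Lg Cg σ Δ D B₁ μ ℱ B ξ w₁ u₁ z₁) (hB₂m : B₂ ≤ m)
    (hc : MethodConstants Lf Cf Lg Cg σ A cα cβ κ)
    (hκL : κ * (Cf * Lg + Cg ^ 2 * Lf) ≤ 1 / 4) (e : InnerEstimator)
    (hη : AdmissibleSteps κ (B₁ / m) η) (hαβ : Coupled cα cβ m B₁ η α β) (T : ℕ) :
    ∑ t ∈ Finset.Icc 1 T, η t / 2 * h.gradSq e η α β t
      ≤ Δ + A * (B₁ / m / η 1) * ((2 * (Cf * Cg)) ^ 2 + D)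
        + potentialNoise (outerNoise Cf Cg σ) (outerMove Lf Cg σ) A cα cβ σ *
          ∑ t ∈ Finset.Icc 1 T, η t ^ 3 / ((B₁ / m : ℝ) ^ 2 * B₂) := by
  have hk : (0 : ℝ) < B₁ := by have := h.hB₁; positivity
  have hkm : (B₁ : ℝ) ≤ m := by exact_mod_cast h.hB₁m
  have hm : (0 : ℝ) < m := hk.trans_le hkm
  have hs : (0 : ℝ) < B₂ := by have := h.hB₂; positivity
  have hr := hc.stepRange h.hB₁ h.hB₁m hη hαβ
  have hq0 : (0 : ℝ) < B₁ / m := by positivity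
  have hq1 : (B₁ / m : ℝ) ≤ 1 := (div_le_one hm).2 hkm
  have hqinv : (m / B₁ : ℝ) = 1 / (B₁ / m) := by field_simp
  have hL : ∀ t, 1 ≤ t → η t * (Cf * Lg + Cg ^ 2 * Lf) ≤ 1 / 4 := fun t ht => by
    have hL0 : 0 ≤ Cf * Lg + Cg ^ 2 * Lf := by
      have := h.hCf; have := h.hLg; have := h.hLf; positivity
    have h1 : η t ≤ κ := (hη.le t ht).trans (mul_le_of_le_one_right hc.κ_pos.le hq1)
    exact (mul_le_mul_of_nonneg_right h1 hL0).trans hκL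
  have hK₁ : 0 ≤ outerNoise Cf Cg σ := by unfold outerNoise; positivity
  set Ψ : ℕ → ℝ := fun t => A * (B₁ / m / η t) * (h.outerErr e η α β t + h.innerErr e η α β t
    + (2 * outerMove Lf Cg σ + 1) * h.innerInc e η α β t) with hΨ
  have hstep : ∀ t, 1 ≤ t → Ψ (t + 1) + η t / 2 * h.trackErr e η α β t
      ≤ Ψ t + η t / 4 * h.dirSq e η α β t
        + potentialNoise (outerNoise Cf Cg σ) (outerMove Lf Cg σ) A cα cβ σ *
          (η t ^ 3 / ((B₁ / m : ℝ) ^ 2 * B₂)) := by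
    intro t ht
    have h1 := h.innerErr_succ_le e hr ht
    have h2 := h.innerInc_succ_le e hr ht
    rw [hqinv] at h1 h2
    refine PotentialConstants.step hc (α := α (t + 1)) (β := β (t + 1)) hK₁ hq0 hq1 hs
      (hη.pos t ht) (hη.le t ht) ?_ ?_ rfl ?_
      (hη.slow t ht) (h.outerErr_nonneg e η α β t) (h.innerErr_nonneg e η α β t)
      (h.innerInc_nonneg e η α β t) (h.dirSq_nonneg e η α β t) (h.inv_add_inv_le hB₂m)
      (h.outerErr_succ_le e hr ht) h1 h2 (h.trackErr_le e hr ht)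
    · rw [(hαβ t ht).1]; field_simp
    · rw [(hαβ t ht).2]; field_simp
    · have := hη.pos (t + 1) (by omega); positivity
  have htel : Ψ (T + 1) + ∑ t ∈ Finset.Icc 1 T, η t / 2 * h.trackErr e η α β t
      ≤ Ψ 1 + ∑ t ∈ Finset.Icc 1 T, η t / 4 * h.dirSq e η α β t
        + potentialNoise (outerNoise Cf Cg σ) (outerMove Lf Cg σ) A cα cβ σ *
          ∑ t ∈ Finset.Icc 1 T, η t ^ 3 / ((B₁ / m : ℝ) ^ 2 * B₂) := by
    induction T with
    | zero => simp
    | succ T ih =>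
      have hT := hstep (T + 1) (by omega)
      rw [Finset.sum_Icc_succ_top (by omega), Finset.sum_Icc_succ_top (by omega),
        Finset.sum_Icc_succ_top (by omega)]
      linarith
  have hdesc := h.sum_descent_le e hr hL T
  rw [Finset.sum_add_distrib] at hdesc
  have hA := hc.A_pos
  have hΨT : 0 ≤ Ψ (T + 1) := by
    have := hη.pos (T + 1) (by omega)
    have h1 := h.outerErr_nonneg e η α β (T + 1)
    have h2 := h.innerErr_nonneg e η α β (T + 1)
    have h3 := h.innerInc_nonneg e η α β (T + 1)
    have h4 := hc.K₃_nonneg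
    simp only [hΨ]
    positivity
  have hΨ1 : Ψ 1 ≤ A * (B₁ / m / η 1) * ((2 * (Cf * Cg)) ^ 2 + D) := by
    have := hη.pos 1 le_rfl
    simp only [hΨ, h.innerInc_one, mul_zero, add_zero]
    gcongr
    · exact h.outerErr_one_le e η α β
    · exact h.innerErr_one_le e η α β
  linarith

end Setting

theorem sq_integral_le_integral_sq {α : Type*} [MeasurableSpace α] {ν : Measure α}
    [IsProbabilityMeasure ν] {X : α → ℝ} (hX : Integrable X ν)
    (hX2 : Integrable (fun a => X a ^ 2) ν) : (∫ a, X a ∂ν) ^ 2 ≤ ∫ a, X a ^ 2 ∂ν := by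
  set c := ∫ a, X a ∂ν with hc
  have h0 : 0 ≤ ∫ a, (X a ^ 2 - 2 * c * X a + c ^ 2) ∂ν :=
    integral_nonneg fun a => by
      have : X a ^ 2 - 2 * c * X a + c ^ 2 = (X a - c) ^ 2 := by ring
      simp only [this]; exact sq_nonneg _
  have h1 : Integrable (fun a => 2 * c * X a) ν := hX.const_mul _
  have h2 : Integrable (fun a => X a ^ 2 - 2 * c * X a) ν := hX2.sub h1
  rw [integral_add h2 (integrable_const _), integral_sub hX2 h1, integral_const_mul, ← hc,
    integral_const, probReal_univ, one_smul] at h0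
  linarith

/-! ### The uniformly chosen output -/

namespace Setting

variable {d p m B₁ B₂ : ℕ} {S : Type*} [MeasurableSpace S] {Ω : Type*} [mΩ : MeasurableSpace Ω]
  {Q : Problem d p m B₂ S} {Lf Cf Lg Cg σ Δ D : ℝ} {μ : Measure Ω}
  {ℱ : Filtration ℕ mΩ} {B : ℕ → Ω → Finset (Fin m)} {ξ : ℕ → Ω → Fin m → Fin B₂ → S}
  {w₁ : Euc d} {u₁ : Ω → Fin m → Euc p} {z₁ : Ω → Euc d}

/-- Jensen on the product space, then the integral over the uniform index is an average. -/
theorem sq_outputGradNorm_le [IsProbabilityMeasure μ]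
    (h : Setting Q Lf Cf Lg Cg σ Δ D B₁ μ ℱ B ξ w₁ u₁ z₁) (e : InnerEstimator) (η α β : ℕ → ℝ)
    {T : ℕ} (hT : 1 ≤ T) :
    outputGradNorm μ Q.F (iterate Q e B₁ (Cf * Cg) η α β B ξ w₁ u₁ z₁) T ^ 2
      ≤ (1 / (T : ℝ)) * ∑ t ∈ Finset.Icc 1 T, h.gradSq e η α β t := by
  have hprob : IsProbabilityMeasure (uniformOn (Set.Icc 1 T)) :=
    isProbabilityMeasure_uniformOn (Set.finite_Icc 1 T) (Set.nonempty_Icc.2 hT)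
  have hmeas : Measurable fun x : Ω × ℕ => ‖gradient Q.F (h.traj e η α β x.2 x.1).w‖ := by
    refine measurable_from_prod_countable_left fun t => ?_
    rcases t.eq_zero_or_pos with rfl | ht
    · exact (measurable_const : Measurable fun _ : Ω => ‖gradient Q.F w₁‖)
    · exact (h.measurable_gradient_w e ht).norm
  have hbound : ∀ x : Ω × ℕ, ‖gradient Q.F (h.traj e η α β x.2 x.1).w‖ ≤ Cf * Cg :=
    fun x => h.norm_gradient_le _
  have h1 : Integrable (fun x : Ω × ℕ => ‖gradient Q.F (h.traj e η α β x.2 x.1).w‖)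
      (μ.prod (uniformOn (Set.Icc 1 T))) := by
    refine Integrable.of_bound hmeas.aestronglyMeasurable (Cf * Cg)
      (Filter.Eventually.of_forall fun x => ?_)
    rw [norm_norm]; exact hbound x
  have h2 : Integrable (fun x : Ω × ℕ => ‖gradient Q.F (h.traj e η α β x.2 x.1).w‖ ^ 2)
      (μ.prod (uniformOn (Set.Icc 1 T))) := by
    refine Integrable.of_bound (hmeas.pow_const 2).aestronglyMeasurable ((Cf * Cg) ^ 2)
      (Filter.Eventually.of_forall fun x => ?_)
    rw [norm_pow, norm_norm]; exact pow_le_pow_left₀ (norm_nonneg _) (hbound x) 2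
  refine (sq_integral_le_integral_sq h1 h2).trans_eq ?_
  rw [integral_prod_symm _ h2, ← Finset.coe_Icc, integral_uniformOn_finset, Nat.card_Icc,
    Nat.add_sub_cancel, smul_eq_mul]
  rfl

end Setting

variable {Lf Cf Lg Cg σ Δ D A cα cβ κ : ℝ} {m B₁ B₂ : ℕ} {η α β : ℕ → ℝ}

theorem potentialNoise_nonneg {K₁ K₃ : ℝ} (hA : 0 ≤ A) (hK₁ : 0 ≤ K₁) (hK₃ : 0 ≤ K₃) :
    0 ≤ potentialNoise K₁ K₃ A cα cβ σ := by
  unfold potentialNoise; positivity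

theorem outerNoise_nonneg (Cf Cg σ : ℝ) : 0 ≤ outerNoise Cf Cg σ := by
  unfold outerNoise; positivity

/-- The convergence guarantee for admissible steps, in terms of a lower bound `L` for the steps, a
bound `H` for the initial weight and a bound `N` for the accumulated noise. -/
theorem guarantee_of_le (hLf : 0 ≤ Lf) (hCf : 0 ≤ Cf) (hLg : 0 ≤ Lg) (hCg : 0 ≤ Cg)
    (hB₁ : 1 ≤ B₁) (hB₁m : B₁ ≤ m) (hB₂ : 1 ≤ B₂) (hB₂m : B₂ ≤ m)
    (hc : MethodConstants Lf Cf Lg Cg σ A cα cβ κ)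
    (hκL : κ * (Cf * Lg + Cg ^ 2 * Lf) ≤ 1 / 4) (hη : AdmissibleSteps κ (B₁ / m) η)
    (hαβ : Coupled cα cβ m B₁ η α β) {T : ℕ} (hT : 1 ≤ T) {L H N δ : ℝ} (hL : 0 < L)
    (hLη : ∀ t, 1 ≤ t → t ≤ T → L ≤ η t) (hH : B₁ / m / η 1 ≤ H)
    (hN : ∑ t ∈ Finset.Icc 1 T, η t ^ 3 / ((B₁ / m : ℝ) ^ 2 * B₂) ≤ N) (hδ : 0 ≤ δ)
    (hfin : 2 * (|Δ| + A * H * ((2 * (Cf * Cg)) ^ 2 + |D|)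
      + potentialNoise (outerNoise Cf Cg σ) (outerMove Lf Cg σ) A cα cβ σ * N)
      ≤ δ ^ 2 * (T * L)) :
    Guarantee.{u, v} Lf Cf Lg Cg σ Δ D m B₁ B₂ η α β T δ := by
  intro d p S _ Q hQ Ω _ μ _ ℱ B ξ hsamp w₁ u₁ z₁ hinit e
  have h : Setting Q Lf Cf Lg Cg σ Δ D B₁ μ ℱ B ξ w₁ u₁ z₁ :=
    ⟨hLf, hCf, hLg, hCg, hB₁, hB₁m, hB₂, hQ, hsamp, hinit⟩
  have hT0 : (0 : ℝ) < T := by positivity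
  have hsum := h.sum_gradSq_le hB₂m hc hκL e hη hαβ T
  have hnoise := potentialNoise_nonneg (σ := σ) (cα := cα) (cβ := cβ) hc.A_pos.le
    (outerNoise_nonneg Cf Cg σ) hc.K₃_nonneg
  have hlow : L / 2 * ∑ t ∈ Finset.Icc 1 T, h.gradSq e η α β t
      ≤ ∑ t ∈ Finset.Icc 1 T, η t / 2 * h.gradSq e η α β t := by
    rw [Finset.mul_sum]
    refine Finset.sum_le_sum fun t ht => ?_
    obtain ⟨h1, h2⟩ := Finset.mem_Icc.1 ht
    have hg : 0 ≤ h.gradSq e η α β t := integral_nonneg fun _ => sq_nonneg _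
    have := hLη t h1 h2
    gcongr
  have hA := hc.A_pos
  have hq0 : (0 : ℝ) ≤ B₁ / m / η 1 := by have := hη.pos 1 le_rfl; positivity
  have hinitial : A * (B₁ / m / η 1) * ((2 * (Cf * Cg)) ^ 2 + D)
      ≤ A * H * ((2 * (Cf * Cg)) ^ 2 + |D|) := by
    calc A * (B₁ / m / η 1) * ((2 * (Cf * Cg)) ^ 2 + D)
        ≤ A * (B₁ / m / η 1) * ((2 * (Cf * Cg)) ^ 2 + |D|) := by gcongr; exact le_abs_self D
      _ ≤ A * H * ((2 * (Cf * Cg)) ^ 2 + |D|) := by gcongr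
  have hN' := mul_le_mul_of_nonneg_left hN hnoise
  have hΔ := le_abs_self Δ
  refine le_of_sq_le_sq ((h.sq_outputGradNorm_le e η α β hT).trans ?_) hδ
  rw [one_div_mul_eq_div, div_le_iff₀ hT0]
  have : L * ∑ t ∈ Finset.Icc 1 T, h.gradSq e η α β t ≤ L * (δ ^ 2 * T) := by linarith
  exact le_of_mul_le_mul_left this hL

/-! ### Step size sequences -/

section schedule

variable {m B₁ B₂ : ℕ} {κ q s a x y X Y : ℝ}

theorem stepProfile_pos (hB₁ : 1 ≤ B₁) (hm : 1 ≤ m) (hB₂ : 1 ≤ B₂) (ha : 0 < a) (t : ℕ) :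
    0 < stepProfile 1 a m B₁ B₂ t := by
  unfold stepProfile; positivity

theorem stepProfile_pow_three (hB₂ : 1 ≤ B₂) (ha : 0 < a) (t : ℕ) :
    stepProfile 1 a m B₁ B₂ t ^ 3 = (B₁ / m : ℝ) ^ 2 * B₂ / (a + t) := by
  have h1 : ((B₁ : ℝ) * √(B₂ : ℝ) / m) ^ (2 / 3 * (3 : ℕ) : ℝ) = ((B₁ : ℝ) * √(B₂ : ℝ) / m) ^ 2 := by
    rw [← Real.rpow_natCast]; norm_num
  have h2 : (a + t : ℝ) ^ (-(1 / 3) * (3 : ℕ) : ℝ) = (a + t)⁻¹ := by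
    rw [← Real.rpow_neg_one]; norm_num
  rw [stepProfile, one_mul, mul_pow, ← Real.rpow_natCast _ 3, ← Real.rpow_natCast _ 3,
    ← Real.rpow_mul (by positivity), ← Real.rpow_mul (by positivity), h1, h2, div_pow, mul_pow,
    Real.sq_sqrt (by positivity)]
  ring

/-- An increment bound for reciprocals whose cubes grow by `1 / (q² s)`. -/
theorem slow_of_pow_three (hq : 0 < q) (hs : 1 ≤ s) (hκ1 : κ ≤ 1) (hx : 0 < x)
    (hy : 0 < y) (hxq : x ≤ κ * q) (h : 1 / y ^ 3 - 1 / x ^ 3 = 1 / (q ^ 2 * s)) :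
    q / y ≤ q / x + x := by
  obtain ⟨X, hX, rfl⟩ : ∃ X, 0 < X ∧ x = 1 / X := ⟨1 / x, by positivity, by simp⟩
  obtain ⟨Y, hY, rfl⟩ : ∃ Y, 0 < Y ∧ y = 1 / Y := ⟨1 / y, by positivity, by simp⟩
  have hs0 : 0 < s := by linarith
  have hXq : 1 ≤ q * X := by
    have h1 : 1 ≤ κ * q * X := (div_le_iff₀ hX).1 hxq
    have h2 : κ * (q * X) ≤ 1 * (q * X) := by gcongr
    linarith
  have h3 : Y ^ 3 - X ^ 3 = 1 / (q ^ 2 * s) := by simpa using h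
  have h4 : (q ^ 2 * s) * (Y ^ 3 - X ^ 3) = 1 := by rw [h3]; field_simp
  have hXY : X ≤ Y := by
    refine le_of_pow_le_pow_left₀ three_ne_zero hY.le ?_
    have : 0 < 1 / (q ^ 2 * s) := by positivity
    linarith
  -- With X = 1/x and Y = 1/y, the increment of the cube controls that of the reciprocal; q X ≥ 1
  -- then supplies the missing power of q.
  have h5 : X ^ 2 * (Y - X) ≤ Y ^ 3 - X ^ 3 := by
    have : Y ^ 3 - X ^ 3 - X ^ 2 * (Y - X) = (Y - X) * (Y ^ 2 + X * Y) := by ring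
    have h6 : 0 ≤ (Y - X) * (Y ^ 2 + X * Y) := mul_nonneg (by linarith) (by positivity)
    linarith
  have h6 : q ^ 2 * (X ^ 2 * (Y - X)) ≤ 1 := by
    have h7 : 0 ≤ X ^ 2 * (Y - X) := mul_nonneg (by positivity) (by linarith)
    calc q ^ 2 * (X ^ 2 * (Y - X)) ≤ q ^ 2 * s * (X ^ 2 * (Y - X)) := by
          gcongr; exact le_mul_of_one_le_right (by positivity) hs
      _ ≤ q ^ 2 * s * (Y ^ 3 - X ^ 3) := by gcongr
      _ = 1 := h4
  have h7 : q * (Y - X) * X ≤ 1 := by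
    have h8 : 0 ≤ q * (Y - X) * X := mul_nonneg (mul_nonneg hq.le (by linarith)) hX.le
    calc q * (Y - X) * X ≤ q * (Y - X) * X * (q * X) := le_mul_of_one_le_right h8 hXq
      _ = q ^ 2 * (X ^ 2 * (Y - X)) := by ring
      _ ≤ 1 := h6
  have h8 : q * (Y - X) ≤ 1 / X := (le_div_iff₀ hX).2 h7
  rw [div_div_eq_mul_div, div_div_eq_mul_div, div_one, div_one]
  linarith

/-- An increment bound for reciprocals whose squares grow by `1 / (a κ² q²)`. -/
theorem slow_of_sq (hq : 0 < q) (ha : 0 < a) (hκ : 0 < κ) (hs : 1 ≤ a * κ ^ 2 * q) (hx : 0 < x)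
    (hy : 0 < y) (h : 1 / y ^ 2 - 1 / x ^ 2 = 1 / (a * κ ^ 2 * q ^ 2)) :
    q / y ≤ q / x + x := by
  obtain ⟨X, hX, rfl⟩ : ∃ X, 0 < X ∧ x = 1 / X := ⟨1 / x, by positivity, by simp⟩
  obtain ⟨Y, hY, rfl⟩ : ∃ Y, 0 < Y ∧ y = 1 / Y := ⟨1 / y, by positivity, by simp⟩
  have h3 : Y ^ 2 - X ^ 2 = 1 / (a * κ ^ 2 * q ^ 2) := by simpa using h
  have hXY : X ≤ Y := by
    refine le_of_sq_le_sq ?_ hY.le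
    have : 0 < 1 / (a * κ ^ 2 * q ^ 2) := by positivity
    linarith
  have h4 : (a * κ ^ 2 * q) * (q * (Y ^ 2 - X ^ 2)) = 1 := by rw [h3]; field_simp
  have h5 : X * (Y - X) ≤ Y ^ 2 - X ^ 2 := by
    have : Y ^ 2 - X ^ 2 - X * (Y - X) = (Y - X) * Y := by ring
    have h6 : 0 ≤ (Y - X) * Y := mul_nonneg (by linarith) hY.le
    linarith
  have h7 : q * (Y - X) * X ≤ 1 := by
    calc q * (Y - X) * X = q * (X * (Y - X)) := by ring
      _ ≤ q * (Y ^ 2 - X ^ 2) := by gcongr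
      _ ≤ (a * κ ^ 2 * q) * (q * (Y ^ 2 - X ^ 2)) := by
          refine le_mul_of_one_le_left (mul_nonneg hq.le ?_) hs
          rw [h3]; positivity
      _ = 1 := h4
  have h8 : q * (Y - X) ≤ 1 / X := (le_div_iff₀ hX).2 h7
  rw [div_div_eq_mul_div, div_div_eq_mul_div, div_one, div_one]
  linarith

theorem one_div_le_log_sub_log (ha : 0 < a) (t : ℕ) :
    1 / (a + (t + 1 : ℕ)) ≤ Real.log (a + (t + 1 : ℕ)) - Real.log (a + t) := by
  have h0 : 0 < a + t := by positivity
  have h1 : 0 < a + (t + 1 : ℕ) := by positivity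
  rw [← Real.log_div h1.ne' h0.ne']
  have h2 := Real.one_sub_inv_le_log_of_pos (x := (a + (t + 1 : ℕ)) / (a + t)) (by positivity)
  refine le_trans (le_of_eq ?_) h2
  rw [inv_div]
  field_simp
  push_cast
  ring

theorem sum_one_div_add_le_log (ha : 0 < a) (T : ℕ) :
    ∑ t ∈ Finset.Icc 1 T, 1 / (a + t) ≤ Real.log (1 + T / a) := by
  have key : ∑ t ∈ Finset.Icc 1 T, 1 / (a + t) ≤ Real.log (a + T) - Real.log a := by
    induction T with
    | zero => simp
    | succ T ih =>
      rw [Finset.sum_Icc_succ_top (by omega)]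
      have := one_div_le_log_sub_log ha T
      linarith
  have h1 : 1 + T / a = (a + T) / a := by field_simp
  rw [h1, Real.log_div (by positivity) ha.ne']
  exact key

/-- The fast decaying weights `√(a / (a + t))`. -/
noncomputable def decay (a : ℝ) (t : ℕ) : ℝ := √(a / (a + t))

theorem decay_pos (ha : 0 < a) (t : ℕ) : 0 < decay a t := by unfold decay; positivity

theorem decay_sq (ha : 0 < a) (t : ℕ) : decay a t ^ 2 = a / (a + t) :=
  Real.sq_sqrt (by positivity)

theorem decay_le_one (ha : 0 < a) (t : ℕ) : decay a t ≤ 1 := by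
  refine le_of_sq_le_sq ?_ zero_le_one
  rw [decay_sq ha, one_pow, div_le_one (by positivity)]
  linarith [(Nat.cast_nonneg t : (0 : ℝ) ≤ t)]

theorem decay_pow_three_div_le (ha : 0 < a) (t : ℕ) :
    decay a (t + 1) ^ 3 / a ≤ 2 * (decay a t - decay a (t + 1)) := by
  have hy := decay_pos ha (t + 1)
  have hx := decay_pos ha t
  set y := decay a (t + 1) with hyd
  set x := decay a t with hxd
  have hy2 : y ^ 2 = a / (a + (t + 1 : ℕ)) := decay_sq ha _
  have hx2 : x ^ 2 = a / (a + t) := decay_sq ha _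
  have h0 : 0 < a + t := by positivity
  -- Equivalent to 1/y² − 1/x² = 1/a. Dividing by x + y turns the cube y³/a into a telescoping
  -- difference of the weights.
  have hrel : y ^ 2 * x ^ 2 = a * (x ^ 2 - y ^ 2) := by
    rw [hy2, hx2]; push_cast; field_simp; ring
  have hyx : y ≤ x := by
    refine le_of_sq_le_sq ?_ hx.le
    have : 0 < y ^ 2 * x ^ 2 := by positivity
    have h1 : 0 < x ^ 2 - y ^ 2 := by
      rw [hrel] at this; exact pos_of_mul_pos_right this ha.le
    linarith
  rw [div_le_iff₀ ha]
  refine le_of_mul_le_mul_right ?_ (by positivity : 0 < x ^ 2)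
  calc y ^ 3 * x ^ 2 = y * (y ^ 2 * x ^ 2) := by ring
    _ = a * (x - y) * (y * (x + y)) := by rw [hrel]; ring
    _ ≤ a * (x - y) * (x * (x + x)) := by
        have : 0 ≤ a * (x - y) := mul_nonneg ha.le (by linarith)
        gcongr
    _ = 2 * (x - y) * a * x ^ 2 := by ring

theorem sum_decay_le (ha : 0 < a) (T : ℕ) :
    ∑ t ∈ Finset.Icc 1 T, decay a t ^ 3 / a ≤ 2 := by
  have key : ∑ t ∈ Finset.Icc 1 T, decay a t ^ 3 / a ≤ 2 * (decay a 0 - decay a T) := by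
    induction T with
    | zero => simp
    | succ T ih =>
      rw [Finset.sum_Icc_succ_top (by omega)]
      have := decay_pow_three_div_le ha T
      linarith
  have h0 := decay_le_one ha 0
  have h1 := decay_pos ha T
  linarith

/-- Compare with the sequence that attains the maximum now: its next value is below the next
maximum, so the reciprocal of the maximum grows no faster. -/
theorem slow_max {x' y' : ℝ} (hq : 0 ≤ q) (hx : 0 < x') (hy : 0 < y')
    (h1 : q / x' ≤ q / x + x) (h2 : q / y' ≤ q / y + y) :
    q / max x' y' ≤ q / max x y + max x y := by
  rcases max_choice x y with h | h <;> rw [h]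
  · exact (div_le_div_of_nonneg_left hq hx (le_max_left _ _)).trans h1
  · exact (div_le_div_of_nonneg_left hq hy (le_max_right _ _)).trans h2

end schedule

/-! ### The profile and the fixed-horizon steps -/

section parameters

/-- The common range of the parameters of the method: `q = B₁ / m`, and `a` is `κ⁻³ B₂ / q`. -/
structure ScheduleRange (κ a : ℝ) (m B₁ B₂ : ℕ) : Prop where
  hB₁ : 1 ≤ B₁
  hB₁m : B₁ ≤ m
  hB₂ : 1 ≤ B₂
  κ_pos : 0 < κ
  κ_le : κ ≤ 1
  ha : κ ^ 3 * a * (B₁ / m) = B₂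

namespace ScheduleRange

variable {κ a : ℝ} {m B₁ B₂ : ℕ} (h : ScheduleRange κ a m B₁ B₂)
include h

theorem hm : 1 ≤ m := h.hB₁.trans h.hB₁m

theorem q_pos : (0 : ℝ) < B₁ / m := by have := h.hB₁; have := h.hm; positivity

theorem q_le : (B₁ / m : ℝ) ≤ 1 := by
  have := h.hm
  rw [div_le_one (by positivity)]; exact_mod_cast h.hB₁m

theorem one_le_s : (1 : ℝ) ≤ B₂ := by exact_mod_cast h.hB₂

theorem a_ge : 1 ≤ a := by
  by_contra! hlt
  have h1 := h.ha
  have h2 := h.one_le_s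
  have h3 : κ ^ 3 ≤ 1 := pow_le_one₀ h.κ_pos.le h.κ_le
  have h4 := h.q_le
  have h5 := h.q_pos
  have h6 := h.κ_pos
  have h7 : κ ^ 3 * (B₁ / m : ℝ) ≤ 1 := mul_le_one₀ h3 h5.le h4
  have h8 : κ ^ 3 * (B₁ / m : ℝ) * a < κ ^ 3 * (B₁ / m : ℝ) * 1 := by gcongr
  linarith

theorem a_pos : 0 < a := by have := h.a_ge; linarith

theorem profile_pos (t : ℕ) : 0 < stepProfile 1 a m B₁ B₂ t :=
  stepProfile_pos h.hB₁ h.hm h.hB₂ h.a_pos t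

theorem profile_pow_three (t : ℕ) :
    stepProfile 1 a m B₁ B₂ t ^ 3 = (B₁ / m : ℝ) ^ 2 * B₂ / (a + t) :=
  stepProfile_pow_three h.hB₂ h.a_pos t

/-- The shift a is normalised so that the profile would start at κq at time 0, the largest
admissible step. -/
theorem profile_pow_three' (t : ℕ) :
    stepProfile 1 a m B₁ B₂ t ^ 3 = (κ * (B₁ / m : ℝ)) ^ 3 * (a / (a + t)) := by
  rw [h.profile_pow_three, ← h.ha]; ring

theorem profile_div (t : ℕ) :
    stepProfile 1 a m B₁ B₂ t ^ 3 / ((B₁ / m : ℝ) ^ 2 * B₂) = 1 / (a + t) := by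
  have := h.q_pos
  have h2 := h.one_le_s
  have h3 := h.a_pos
  rw [h.profile_pow_three]
  generalize (B₁ / m : ℝ) = q at this
  field_simp

theorem profile_antitone {t t' : ℕ} (htt : t ≤ t') :
    stepProfile 1 a m B₁ B₂ t' ≤ stepProfile 1 a m B₁ B₂ t := by
  refine le_of_pow_le_pow_left₀ three_ne_zero (h.profile_pos t).le ?_
  rw [h.profile_pow_three, h.profile_pow_three]
  have := h.a_pos
  gcongr

theorem profile_le (t : ℕ) : stepProfile 1 a m B₁ B₂ t ≤ κ * (B₁ / m) := by
  have h1 := h.κ_pos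
  have h2 := h.q_pos
  have h3 := h.a_pos
  refine le_of_pow_le_pow_left₀ three_ne_zero (by positivity) ?_
  rw [h.profile_pow_three']
  refine mul_le_of_le_one_right (by positivity) ?_
  rw [div_le_one (by positivity)]
  linarith [(Nat.cast_nonneg t : (0 : ℝ) ≤ t)]

theorem profile_slow (t : ℕ) : (B₁ / m : ℝ) / stepProfile 1 a m B₁ B₂ (t + 1)
    ≤ (B₁ / m : ℝ) / stepProfile 1 a m B₁ B₂ t + stepProfile 1 a m B₁ B₂ t := by
  refine slow_of_pow_three h.q_pos h.one_le_s h.κ_le (h.profile_pos t)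
    (h.profile_pos _) (h.profile_le t) ?_
  have h1 := h.q_pos
  have h2 := h.one_le_s
  have h3 := h.a_pos
  rw [h.profile_pow_three, h.profile_pow_three]
  push_cast
  field_simp
  ring

theorem admissible_profile {η : ℕ → ℝ} (hη : ∀ t, 1 ≤ t → η t = stepProfile 1 a m B₁ B₂ t) :
    AdmissibleSteps κ (B₁ / m) η where
  pos t ht := by rw [hη t ht]; exact h.profile_pos t
  le t ht := by rw [hη t ht]; exact h.profile_le t
  slow t ht := by rw [hη t ht, hη (t + 1) (by omega)]; exact h.profile_slow t

theorem half_le_profile_one : κ * (B₁ / m) / 2 ≤ stepProfile 1 a m B₁ B₂ 1 := by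
  refine le_of_pow_le_pow_left₀ three_ne_zero (h.profile_pos 1).le ?_
  have h1 := h.κ_pos
  have h2 := h.q_pos
  have h3 := h.a_pos
  have h4 := h.a_ge
  rw [h.profile_pow_three', div_eq_mul_inv, mul_pow]
  gcongr
  rw [le_div_iff₀ (by positivity)]
  push_cast
  norm_num
  linarith

/-- The fast decaying steps stay below the profile. -/
theorem fast_le_profile (t : ℕ) :
    κ * (B₁ / m) * decay a t ≤ stepProfile 1 a m B₁ B₂ t := by
  refine le_of_pow_le_pow_left₀ three_ne_zero (h.profile_pos t).le ?_
  have h1 := h.κ_pos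
  have h2 := h.q_pos
  have h3 := decay_pos h.a_pos t
  rw [h.profile_pow_three', mul_pow, ← decay_sq h.a_pos]
  refine mul_le_mul_of_nonneg_left ?_ (by positivity)
  exact pow_le_pow_of_le_one h3.le (decay_le_one h.a_pos t) (by norm_num)

theorem fast_slow (t : ℕ) : (B₁ / m : ℝ) / (κ * (B₁ / m) * decay a (t + 1))
    ≤ (B₁ / m : ℝ) / (κ * (B₁ / m) * decay a t) + κ * (B₁ / m) * decay a t := by
  have h1 := h.κ_pos
  have h2 := h.q_pos
  have h3 := h.a_pos
  have h4 := decay_pos h3 t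
  have h5 := decay_pos h3 (t + 1)
  refine slow_of_sq (κ := κ) h2 h3 h1 ?_ (by positivity) (by positivity) ?_
  · have h6 := h.ha
    have h7 := h.one_le_s
    have h8 : κ * (κ ^ 2 * a * (B₁ / m)) ≤ 1 * (κ ^ 2 * a * (B₁ / m)) := by
      have := h.κ_le
      gcongr
    have h9 : κ * (κ ^ 2 * a * (B₁ / m)) = κ ^ 3 * a * (B₁ / m) := by ring
    have h10 : a * κ ^ 2 * (B₁ / m) = κ ^ 2 * a * (B₁ / m) := by ring
    rw [h10]; linarith
  · rw [mul_pow _ (decay a t), mul_pow _ (decay a (t + 1)), decay_sq h3, decay_sq h3]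
    have h6 : (0 : ℝ) < a + t := by positivity
    generalize (B₁ / m : ℝ) = q at h2
    push_cast
    field_simp
    ring

/-- Steps for a fixed horizon `T`: fast decay down to the level of the profile at time `T`. -/
noncomputable def _root_.FCCO.horizonSteps (κ a : ℝ) (m B₁ B₂ T t : ℕ) : ℝ :=
  max (κ * (B₁ / m) * decay a t) (stepProfile 1 a m B₁ B₂ (max t T))

theorem horizonSteps_pos (T t : ℕ) : 0 < horizonSteps κ a m B₁ B₂ T t :=
  (h.profile_pos _).trans_le (le_max_right _ _)

theorem horizonSteps_le_profile (T t : ℕ) :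
    horizonSteps κ a m B₁ B₂ T t ≤ stepProfile 1 a m B₁ B₂ t :=
  max_le (h.fast_le_profile t) (h.profile_antitone (le_max_left _ _))

theorem admissible_horizonSteps (T : ℕ) :
    AdmissibleSteps κ (B₁ / m) (horizonSteps κ a m B₁ B₂ T) where
  pos t _ := h.horizonSteps_pos T t
  le t _ := (h.horizonSteps_le_profile T t).trans (h.profile_le t)
  slow t _ := by
    have h1 := h.κ_pos
    have h2 := h.q_pos
    have h5 := decay_pos h.a_pos (t + 1)
    refine slow_max h2.le (by positivity) (h.profile_pos _) (h.fast_slow t) ?_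
    -- Before the horizon the second sequence is constant; afterwards it follows the profile, so
    -- that the steps stay below the profile and admissible at all times.
    rcases Nat.lt_or_ge t T with htT | htT
    · rw [max_eq_right htT.le, max_eq_right (by omega : t + 1 ≤ T)]
      linarith [h.profile_pos T]
    · rw [max_eq_left htT, max_eq_left (by omega : T ≤ t + 1)]
      exact h.profile_slow t

omit h in
theorem profile_le_horizonSteps {T t : ℕ} (htT : t ≤ T) :
    stepProfile 1 a m B₁ B₂ T ≤ horizonSteps κ a m B₁ B₂ T t := by
  refine le_trans ?_ (le_max_right _ _)
  rw [max_eq_right htT]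

theorem half_le_horizonSteps_one (T : ℕ) :
    κ * (B₁ / m) / 2 ≤ horizonSteps κ a m B₁ B₂ T 1 := by
  refine le_trans ?_ (le_max_left _ _)
  have h1 := h.κ_pos
  have h2 := h.q_pos
  have h3 := h.a_pos
  have h4 := h.a_ge
  rw [div_eq_mul_inv]
  gcongr
  refine le_of_sq_le_sq ?_ (decay_pos h3 1).le
  rw [decay_sq h3, le_div_iff₀ (by positivity)]
  push_cast
  norm_num
  linarith

/-- The cube of the maximum is at most the sum of the cubes. The fast part telescopes to at most 2,
and the constant part contributes T/(a + T) ≤ 1, so no logarithm appears. -/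
theorem sum_horizonSteps_le (T : ℕ) : ∑ t ∈ Finset.Icc 1 T,
    horizonSteps κ a m B₁ B₂ T t ^ 3 / ((B₁ / m : ℝ) ^ 2 * B₂) ≤ 3 := by
  have h1 := h.κ_pos
  have h2 := h.q_pos
  have h3 := h.a_pos
  have h4 := h.one_le_s
  have hterm : ∀ t ∈ Finset.Icc 1 T,
      horizonSteps κ a m B₁ B₂ T t ^ 3 / ((B₁ / m : ℝ) ^ 2 * B₂)
        ≤ decay a t ^ 3 / a + 1 / (a + T) := by
    intro t ht
    have h5 := decay_pos h3 t
    have hfast : (κ * (B₁ / m) * decay a t) ^ 3 / ((B₁ / m : ℝ) ^ 2 * B₂)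
        = decay a t ^ 3 / a := by
      rw [← h.ha]; generalize (B₁ / m : ℝ) = q at h2; field_simp
    have hslow := h.profile_div T
    rw [horizonSteps, max_eq_right (Finset.mem_Icc.1 ht).2]
    rcases max_choice (κ * (B₁ / m : ℝ) * decay a t) (stepProfile 1 a m B₁ B₂ T) with h6 | h6 <;>
      rw [h6]
    · rw [hfast]; exact le_add_of_nonneg_right (by positivity)
    · rw [hslow]; exact le_add_of_nonneg_left (by positivity)
  refine (Finset.sum_le_sum hterm).trans ?_
  rw [Finset.sum_add_distrib, Finset.sum_const, Nat.card_Icc, Nat.add_sub_cancel, nsmul_eq_mul]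
  have h6 := sum_decay_le h3 T
  have h7 : (T : ℝ) * (1 / (a + T)) ≤ 1 := by
    rw [mul_one_div, div_le_one (by positivity)]; linarith
  linarith

theorem weight_le {x : ℝ} (hx : κ * (B₁ / m) / 2 ≤ x) : B₁ / m / x ≤ 2 / κ := by
  have h1 := h.κ_pos
  have h2 := h.q_pos
  have h3 : 0 < κ * (B₁ / m : ℝ) / 2 := by positivity
  rw [div_le_div_iff₀ (h3.trans_le hx) h1]
  linarith

end ScheduleRange

end parameters

/-- The constant that bounds twice the initial potential plus three units of noise. -/
noncomputable def totalConstant (Lf Cf Cg σ Δ D A cα cβ κ : ℝ) : ℝ :=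
  2 * (|Δ| + A * (2 / κ) * ((2 * (Cf * Cg)) ^ 2 + |D|)
    + potentialNoise (outerNoise Cf Cg σ) (outerMove Lf Cg σ) A cα cβ σ * 3)

/-! ### Guarantees for the two schedules -/

variable {Lf Cf Lg Cg σ Δ D A cα cβ κ a : ℝ} {m B₁ B₂ : ℕ} {η α β : ℕ → ℝ}

theorem PotentialConstants.noise_nonneg (hc : MethodConstants Lf Cf Lg Cg σ A cα cβ κ) :
    0 ≤ potentialNoise (outerNoise Cf Cg σ) (outerMove Lf Cg σ) A cα cβ σ :=
  potentialNoise_nonneg hc.A_pos.le (outerNoise_nonneg Cf Cg σ) hc.K₃_nonneg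

theorem PotentialConstants.totalConstant_nonneg (hc : MethodConstants Lf Cf Lg Cg σ A cα cβ κ) :
    0 ≤ totalConstant Lf Cf Cg σ Δ D A cα cβ κ := by
  have h1 := hc.noise_nonneg
  have h2 := hc.A_pos
  have h3 := hc.κ_pos
  unfold totalConstant
  positivity

/-- The rate in the second claim is, up to constants and the logarithm, the square root of 1/(T
s_T); this identity expresses that. -/
theorem ScheduleRange.profile_mul_sq (h : ScheduleRange κ a m B₁ B₂) (T : ℕ) :
    stepProfile 1 a m B₁ B₂ T *
      (((m : ℝ) / (B₁ * √(B₂ : ℝ))) ^ (1 / 3 : ℝ) * (a + T) ^ (1 / 6 : ℝ)) ^ 2 = 1 := by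
  have hm : (0 : ℝ) < m := by have := h.hm; positivity
  have hB₁ : (0 : ℝ) < B₁ := by have := h.hB₁; positivity
  have hB₂ : (0 : ℝ) < B₂ := by have := h.hB₂; positivity
  have ha := h.a_pos
  have h1 : (((m : ℝ) / (B₁ * √(B₂ : ℝ))) ^ (1 / 3 : ℝ)) ^ 3 = (m : ℝ) / (B₁ * √(B₂ : ℝ)) := by
    rw [← Real.rpow_natCast, ← Real.rpow_mul (by positivity)]; norm_num
  have h2 : ((a + T : ℝ) ^ (1 / 6 : ℝ)) ^ 6 = a + T := by
    rw [← Real.rpow_natCast, ← Real.rpow_mul (by positivity)]; norm_num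
  have h3 := (h.profile_pos T).le
  refine (pow_eq_one_iff_of_nonneg (by positivity) three_ne_zero).1 ?_
  calc (stepProfile 1 a m B₁ B₂ T *
      (((m : ℝ) / (B₁ * √(B₂ : ℝ))) ^ (1 / 3 : ℝ) * (a + T) ^ (1 / 6 : ℝ)) ^ 2) ^ 3
      = stepProfile 1 a m B₁ B₂ T ^ 3 * ((((m : ℝ) / (B₁ * √(B₂ : ℝ))) ^ (1 / 3 : ℝ)) ^ 3) ^ 2
        * ((a + T : ℝ) ^ (1 / 6 : ℝ)) ^ 6 := by ring
    _ = 1 := by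
      rw [h.profile_pow_three, h1, h2, div_pow, div_pow, mul_pow, Real.sq_sqrt hB₂.le]
      field_simp

theorem guarantee_profile (hLf : 0 ≤ Lf) (hCf : 0 ≤ Cf) (hLg : 0 ≤ Lg) (hCg : 0 ≤ Cg)
    (h : ScheduleRange κ a m B₁ B₂) (hB₂m : B₂ ≤ m)
    (hc : MethodConstants Lf Cf Lg Cg σ A cα cβ κ)
    (hκL : κ * (Cf * Lg + Cg ^ 2 * Lf) ≤ 1 / 4)
    (hη : ∀ t, 1 ≤ t → η t = stepProfile 1 a m B₁ B₂ t) (hαβ : Coupled cα cβ m B₁ η α β)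
    {T : ℕ} (hT : 1 ≤ T) {C : ℝ} (hC : 1 + totalConstant Lf Cf Cg σ Δ D A cα cβ κ ≤ C) :
    Guarantee.{u, v} Lf Cf Lg Cg σ Δ D m B₁ B₂ η α β T
      (C * √(1 + Real.log (1 + T / a)) * ((m : ℝ) / (B₁ * √(B₂ : ℝ))) ^ (1 / 3 : ℝ) *
        (a + T) ^ (1 / 6 : ℝ) / √(T : ℝ)) := by
  have ha := h.a_pos
  have hT0 : (0 : ℝ) < T := by positivity
  have hE := hc.totalConstant_nonneg (Δ := Δ) (D := D)
  have hC1 : 1 ≤ C := by linarith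
  have hlog : 0 ≤ Real.log (1 + T / a) :=
    Real.log_nonneg (by have : 0 ≤ T / a := by positivity
                        linarith)
  refine guarantee_of_le hLf hCf hLg hCg h.hB₁ h.hB₁m h.hB₂ hB₂m hc hκL
    (h.admissible_profile hη) hαβ hT (L := stepProfile 1 a m B₁ B₂ T) (H := 2 / κ)
    (N := Real.log (1 + T / a)) (h.profile_pos T) (fun t ht htT => ?_) ?_ ?_ (by positivity) ?_
  · rw [hη t ht]; exact h.profile_antitone htT
  · rw [hη 1 le_rfl]; exact h.weight_le h.half_le_profile_one
  · refine le_trans (le_of_eq ?_) (sum_one_div_add_le_log ha T)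
    refine Finset.sum_congr rfl fun t ht => ?_
    rw [hη t (Finset.mem_Icc.1 ht).1, h.profile_div]
  · have hPW := h.profile_mul_sq T
    set P := ((m : ℝ) / (B₁ * √(B₂ : ℝ))) ^ (1 / 3 : ℝ)
    set W := (a + T : ℝ) ^ (1 / 6 : ℝ)
    set ℓ := Real.log (1 + T / a)
    -- The claimed bound is calibrated so that all powers of T, a, m, B₁ and B₂ cancel, leaving a
    -- comparison of constants and logarithms.
    have hrhs : (C * √(1 + ℓ) * P * W / √(T : ℝ)) ^ 2 * (T * stepProfile 1 a m B₁ B₂ T)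
        = C ^ 2 * (1 + ℓ) := by
      calc (C * √(1 + ℓ) * P * W / √(T : ℝ)) ^ 2 * (T * stepProfile 1 a m B₁ B₂ T)
          = C ^ 2 * √(1 + ℓ) ^ 2 * (T / √(T : ℝ) ^ 2)
            * (stepProfile 1 a m B₁ B₂ T * (P * W) ^ 2) := by ring
        _ = C ^ 2 * (1 + ℓ) := by
          rw [hPW, Real.sq_sqrt (by positivity), Real.sq_sqrt hT0.le, div_self hT0.ne']; ring
    rw [hrhs]
    have h1 := hc.noise_nonneg
    have h2 := hc.A_pos
    have h3 := hc.κ_pos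
    set K₇ := potentialNoise (outerNoise Cf Cg σ) (outerMove Lf Cg σ) A cα cβ σ with hK₇
    set I := |Δ| + A * (2 / κ) * ((2 * (Cf * Cg)) ^ 2 + |D|) with hI
    have hI0 : 0 ≤ I := by positivity
    have hEdef : totalConstant Lf Cf Cg σ Δ D A cα cβ κ = 2 * (I + K₇ * 3) := rfl
    have h4 : 0 ≤ K₇ * ℓ := by positivity
    have h5 : 0 ≤ I * ℓ := by positivity
    have hCC : C * 1 ≤ C * C := by gcongr
    calc 2 * (I + K₇ * ℓ) ≤ 2 * (I + K₇ * 3) * (1 + ℓ) := by nlinarith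
      _ ≤ C ^ 2 * (1 + ℓ) := by
        refine mul_le_mul_of_nonneg_right ?_ (by positivity)
        rw [pow_two]; linarith

/-- The number of iterations that suffices for accuracy `ε`, for a suitable constant `M`. -/
noncomputable def horizon (M ε : ℝ) (m B₁ B₂ : ℕ) : ℕ :=
  ⌈M * ((m : ℝ) / (B₁ * √(B₂ : ℝ) * ε ^ 3))⌉₊

theorem guarantee_horizon (hLf : 0 ≤ Lf) (hCf : 0 ≤ Cf) (hLg : 0 ≤ Lg) (hCg : 0 ≤ Cg)
    (h : ScheduleRange κ a m B₁ B₂) (hB₂m : B₂ ≤ m)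
    (hc : MethodConstants Lf Cf Lg Cg σ A cα cβ κ)
    (hκL : κ * (Cf * Lg + Cg ^ 2 * Lf) ≤ 1 / 4) {T : ℕ} (hT : 1 ≤ T)
    (hαβ : Coupled cα cβ m B₁ (horizonSteps κ a m B₁ B₂ T) α β) {ε : ℝ} (hε : 0 < ε)
    (hfin : totalConstant Lf Cf Cg σ Δ D A cα cβ κ ≤
      ε ^ 2 * (T * stepProfile 1 a m B₁ B₂ T)) :
    Guarantee.{u, v} Lf Cf Lg Cg σ Δ D m B₁ B₂ (horizonSteps κ a m B₁ B₂ T) α β T ε :=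
  guarantee_of_le hLf hCf hLg hCg h.hB₁ h.hB₁m h.hB₂ hB₂m hc hκL
    (h.admissible_horizonSteps T) hαβ hT (h.profile_pos T)
    (fun _ _ htT => ScheduleRange.profile_le_horizonSteps htT)
    (h.weight_le (h.half_le_horizonSteps_one T)) (h.sum_horizonSteps_le T) hε.le hfin

theorem batch_mul_le {K ε : ℝ} (hε : 0 < ε) (hK : (B₂ : ℝ) ≤ K / ε ^ 2) :
    √(B₂ : ℝ) * ε ≤ √K ∧ B₂ * ε ^ 2 ≤ K := by
  have h1 : B₂ * ε ^ 2 ≤ K := (le_div_iff₀ (by positivity)).1 hK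
  refine ⟨?_, h1⟩
  refine Real.le_sqrt_of_sq_le ?_
  rwa [mul_pow, Real.sq_sqrt (by positivity)]

/-- For batch sizes `B₂ ≤ K / ε²`, the shift `a` is at most of the order of the horizon. -/
theorem ScheduleRange.horizon_bounds (h : ScheduleRange κ a m B₁ B₂) {K ε : ℝ} (hε : 0 < ε)
    (hK : (B₂ : ℝ) ≤ K / ε ^ 2) :
    1 ≤ K * √K * ((m : ℝ) / (B₁ * √(B₂ : ℝ) * ε ^ 3)) ∧
      a ≤ 1 / κ ^ 3 * (K * √K) * ((m : ℝ) / (B₁ * √(B₂ : ℝ) * ε ^ 3)) := by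
  obtain ⟨h1, h2⟩ := batch_mul_le hε hK
  have hm : (0 : ℝ) < m := by have := h.hm; positivity
  have hB₁ : (0 : ℝ) < B₁ := by have := h.hB₁; positivity
  have hB₂ : (0 : ℝ) < B₂ := by have := h.hB₂; positivity
  have hB₁m : (B₁ : ℝ) ≤ m := by exact_mod_cast h.hB₁m
  have hs := h.one_le_s
  have hκ := h.κ_pos
  have hK0 : 0 < K := lt_of_lt_of_le (by positivity) h2
  have hsq := Real.sq_sqrt hB₂.le
  have h3 : (B₂ * ε ^ 2) * (√(B₂ : ℝ) * ε) ≤ K * √K := mul_le_mul h2 h1 (by positivity) hK0.le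
  have h4 : B₂ * (√(B₂ : ℝ) * ε ^ 3) ≤ K * √K := by linarith
  constructor
  · rw [← mul_div_assoc, le_div_iff₀ (by positivity), one_mul]
    calc B₁ * √(B₂ : ℝ) * ε ^ 3 ≤ m * √(B₂ : ℝ) * ε ^ 3 := by gcongr
      _ ≤ B₂ * (m * √(B₂ : ℝ) * ε ^ 3) := le_mul_of_one_le_left (by positivity) hs
      _ = B₂ * (√(B₂ : ℝ) * ε ^ 3) * m := by ring
      _ ≤ K * √K * m := by gcongr
  · have ha : a = 1 / κ ^ 3 * B₂ * (m / B₁) := by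
      rw [← h.ha]; field_simp
    have h5 : B₂ ≤ K * √K / (√(B₂ : ℝ) * ε ^ 3) := (le_div_iff₀ (by positivity)).2 h4
    calc a = 1 / κ ^ 3 * B₂ * (m / B₁) := ha
      _ ≤ 1 / κ ^ 3 * (K * √K / (√(B₂ : ℝ) * ε ^ 3)) * (m / B₁) := by gcongr
      _ = 1 / κ ^ 3 * (K * √K) * ((m : ℝ) / (B₁ * √(B₂ : ℝ) * ε ^ 3)) := by
        field_simp

/-- Cubed, the right side is ε⁶T³q²B₂/(a + T). Once a is of order T this is of order ε⁶q²B₂T², which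
is bounded below by M² up to a constant since T ≥ M N and ε⁶q²B₂N² = 1. -/
theorem ScheduleRange.le_horizon_profile (h : ScheduleRange κ a m B₁ B₂) {K ε E M : ℝ} {T : ℕ}
    (hε : 0 < ε) (hK : (B₂ : ℝ) ≤ K / ε ^ 2) (hE : 0 ≤ E)
    (hM : 1 + E ^ 3 * (1 + 1 / κ ^ 3 * (K * √K)) ≤ M)
    (hT : M * ((m : ℝ) / (B₁ * √(B₂ : ℝ) * ε ^ 3)) ≤ T) :
    E ≤ ε ^ 2 * (T * stepProfile 1 a m B₁ B₂ T) := by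
  obtain ⟨-, ha⟩ := h.horizon_bounds hε hK
  obtain ⟨-, h2⟩ := batch_mul_le hε hK
  have hm : (0 : ℝ) < m := by have := h.hm; positivity
  have hB₁ : (0 : ℝ) < B₁ := by have := h.hB₁; positivity
  have hB₂ : (0 : ℝ) < B₂ := by have := h.hB₂; positivity
  have hκ := h.κ_pos
  have hK0 : 0 < K := lt_of_lt_of_le (by positivity) h2
  have ha0 := h.a_pos
  have hprof := (h.profile_pos T).le
  set N := (m : ℝ) / (B₁ * √(B₂ : ℝ) * ε ^ 3) with hN
  have hN0 : 0 < N := by positivity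
  set b := 1 / κ ^ 3 * (K * √K) with hb
  have hb0 : 0 ≤ b := by positivity
  have hEb : 0 ≤ E ^ 3 * (1 + b) := by positivity
  have hM1 : 1 ≤ M := by linarith
  have hNT : N ≤ T := (le_mul_of_one_le_left hN0.le hM1).trans hT
  have hT0 : (0 : ℝ) < T := hN0.trans_le hNT
  have haT : a + T ≤ (1 + b) * T := by
    have : b * N ≤ b * T := by gcongr
    linarith
  have hNsq : ((B₁ / m : ℝ) ^ 2 * B₂) * ε ^ 6 * N ^ 2 = 1 := by
    rw [hN, div_pow, div_pow, mul_pow, mul_pow, Real.sq_sqrt hB₂.le]; field_simp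
  refine le_of_pow_le_pow_left₀ three_ne_zero (by positivity) ?_
  calc E ^ 3 = E ^ 3 * (a + T) / (a + T) := by field_simp
    _ ≤ E ^ 3 * ((1 + b) * T) / (a + T) := by gcongr
    _ = E ^ 3 * (1 + b) * T / (a + T) := by ring
    -- M dominates E³(1 + b) and is at least 1, so its square dominates it as well.
    _ ≤ M ^ 2 * T / (a + T) := by
        have : M * 1 ≤ M * M := by gcongr
        gcongr
        rw [pow_two]; linarith
    _ = (M * N) ^ 2 * T / (a + T) * (((B₁ / m : ℝ) ^ 2 * B₂) * ε ^ 6) := by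
        calc M ^ 2 * T / (a + T)
            = M ^ 2 * T / (a + T) * (((B₁ / m : ℝ) ^ 2 * B₂) * ε ^ 6 * N ^ 2) := by
              rw [hNsq, mul_one]
          _ = _ := by ring
    _ ≤ (T : ℝ) ^ 2 * T / (a + T) * (((B₁ / m : ℝ) ^ 2 * B₂) * ε ^ 6) := by gcongr
    _ = (ε ^ 2 * (T * stepProfile 1 a m B₁ B₂ T)) ^ 3 := by
        rw [mul_pow, mul_pow, h.profile_pow_three]; ring

/-- The shift by one is needed because the parameters at time t + 1 are determined by the step at
time t. -/
theorem exists_coupled (cα cβ : ℝ) (m B₁ : ℕ) (η : ℕ → ℝ) :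
    ∃ α β, Coupled cα cβ m B₁ η α β :=
  ⟨fun t => cα * (m * η (t - 1) ^ 2 / B₁),
    fun t => cβ * ((m : ℝ) ^ 2 * η (t - 1) ^ 2 / (B₁ : ℝ) ^ 2), fun _ _ => ⟨rfl, rfl⟩⟩

end FCCO

/-! ### Choice of the constants -/

theorem mainTheorem1 (Lf Cf Lg Cg σ : ℝ)
    (hLf : 0 ≤ Lf) (hCf : 0 ≤ Cf) (hLg : 0 ≤ Lg) (hCg : 0 ≤ Cg) (hσ : 0 ≤ σ) :
    ∃ cη ca cα cβ : ℝ, 0 < cη ∧ 0 < ca ∧ 0 < cα ∧ 0 < cβ ∧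
    ∀ Δ D K : ℝ, ∃ C : ℝ, 0 < C ∧
    ∀ m B₁ B₂ : ℕ, 1 ≤ B₁ → B₁ ≤ m → 1 ≤ B₂ → B₂ ≤ m →
      -- the complexity, with step sizes bounded by the profile
      (∀ ε : ℝ, 0 < ε → (B₂ : ℝ) ≤ K / ε ^ 2 →
        ∃ (T : ℕ) (η α β : ℕ → ℝ), 1 ≤ T ∧
          (∀ t, 1 ≤ t → 0 < η t ∧
            η t ≤ FCCO.stepProfile cη (ca * (m * B₂ / B₁)) m B₁ B₂ t) ∧
          FCCO.Coupled cα cβ m B₁ η α β ∧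
          (T : ℝ) ≤ C * (m / (B₁ * √(B₂ : ℝ) * ε ^ 3)) ∧
          (T : ℝ) * (B₁ * B₂) ≤ C * (m * √(B₂ : ℝ) / ε ^ 3) ∧
          FCCO.Guarantee.{u, v} Lf Cf Lg Cg σ Δ D m B₁ B₂ η α β T ε) ∧
      -- the bound at every horizon, with step sizes equal to the profile
      (∀ η α β : ℕ → ℝ,
        (∀ t, 1 ≤ t → η t = FCCO.stepProfile cη (ca * (m * B₂ / B₁)) m B₁ B₂ t) →
        FCCO.Coupled cα cβ m B₁ η α β →
        ∀ T : ℕ, 1 ≤ T →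
          FCCO.Guarantee.{u, v} Lf Cf Lg Cg σ Δ D m B₁ B₂ η α β T
            (C * √(1 + Real.log (1 + T / (ca * (m * B₂ / B₁)))) *
              ((m : ℝ) / (B₁ * √(B₂ : ℝ))) ^ (1 / 3 : ℝ) *
              (ca * (m * B₂ / B₁) + T) ^ (1 / 6 : ℝ) / √(T : ℝ))) := by
  obtain ⟨A, cα, cβ, κ, hc, hκL⟩ := FCCO.exists_methodConstants σ hLf hCf hLg (Cg := Cg)
  have hκ := hc.κ_pos
  have hA := hc.A_pos
  have hK₆ := hc.K₆_nonneg
  refine ⟨1, 1 / κ ^ 3, cα, cβ, one_pos, by positivity, ?_, ?_, fun Δ D K => ?_⟩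
  · rw [hc.cα_eq]; positivity
  · rw [hc.cβ_eq]; positivity
  set E := FCCO.totalConstant Lf Cf Cg σ Δ D A cα cβ κ with hE
  have hE0 : 0 ≤ E := hc.totalConstant_nonneg
  -- For K ≤ 0 no batch size is admissible in the first claim, but the constant must still be
  -- positive; the square root is then zero.
  have hKK : 0 ≤ K * √K := by
    rcases le_total 0 K with h | h
    · positivity
    · rw [Real.sqrt_eq_zero_of_nonpos h, mul_zero]
  set M := 1 + E ^ 3 * (1 + 1 / κ ^ 3 * (K * √K)) with hM
  have hM1 : 1 ≤ M := by
    have : 0 ≤ E ^ 3 * (1 + 1 / κ ^ 3 * (K * √K)) := by positivity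
    linarith
  -- M N bounds the horizon before rounding, K√K N pays for the rounding up, and M + E ≥ 1 + E is
  -- what the second claim requires.
  refine ⟨M + K * √K + E, by positivity, fun m B₁ B₂ hB₁ hB₁m hB₂ hB₂m => ?_⟩
  have hm0 : (0 : ℝ) < m := by have := hB₁.trans hB₁m; positivity
  have hB₁0 : (0 : ℝ) < B₁ := by positivity
  have hB₂0 : (0 : ℝ) < B₂ := by positivity
  have h : FCCO.ScheduleRange κ (1 / κ ^ 3 * (m * B₂ / B₁)) m B₁ B₂ :=
    ⟨hB₁, hB₁m, hB₂, hκ, hc.κ_le, by field_simp⟩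
  refine ⟨fun ε hε hK => ?_, fun η α β hη hαβ T hT =>
    FCCO.guarantee_profile hLf hCf hLg hCg h hB₂m hc hκL hη hαβ hT (by linarith)⟩
  set N := (m : ℝ) / (B₁ * √(B₂ : ℝ) * ε ^ 3) with hN
  have hN0 : 0 < N := by positivity
  set T := FCCO.horizon M ε m B₁ B₂ with hT
  have hMT : M * N ≤ T := Nat.le_ceil _
  have hT1 : 1 ≤ T := Nat.one_le_ceil_iff.2 (by positivity)
  have hTC : (T : ℝ) ≤ (M + K * √K + E) * N := by
    have h1 : (T : ℝ) < M * N + 1 := Nat.ceil_lt_add_one (by positivity)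
    have h2 := (h.horizon_bounds hε hK).1
    have h3 : 0 ≤ E * N := by positivity
    linarith
  obtain ⟨α, β, hαβ⟩ := FCCO.exists_coupled cα cβ m B₁
    (FCCO.horizonSteps κ (1 / κ ^ 3 * (m * B₂ / B₁)) m B₁ B₂ T)
  refine ⟨T, _, α, β, hT1, fun t _ => ⟨h.horizonSteps_pos T t, h.horizonSteps_le_profile T t⟩,
    hαβ, hTC, ?_, FCCO.guarantee_horizon hLf hCf hLg hCg h hB₂m hc hκL hT1 hαβ hε
      (h.le_horizon_profile hε hK hE0 le_rfl hMT)⟩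
  calc (T : ℝ) * (B₁ * B₂) ≤ (M + K * √K + E) * N * (B₁ * B₂) := by gcongr
    _ = (M + K * √K + E) * (m * √(B₂ : ℝ) / ε ^ 3) := by
      have h1 : N * (B₁ * B₂) = m * √(B₂ : ℝ) / ε ^ 3 := by
        rw [hN]
        nth_rewrite 2 [← Real.sq_sqrt hB₂0.le]
        field_simp
      rw [mul_assoc, h1]
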